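/- Let $\phi$ be the norm on $\mathbb{R}^2$ whose closed unit ball $B^\phi$ (the Wulff shape) is the regular hexagon circumscribed to the unit circle with two horizontal facets, and let $\phi^o(\xi)=\sup\{\xi\cdot\eta:\phi(\eta)=1\}$ be the dual norm. *Networks.* A polygonal network $\mathcal S=\bigcup_i S_i$ is a connected finite union of oriented closed segments (of positive length) and half-lines $S_i$, with unit tangents $\tau_i$ and unit normals $\nu_i=\tau_i^\perp$ ($90^\circ$ counterclockwise rotation), which meet pairwise at most at common endpoints, such that no endpoint belongs to a single $S_i$; at an endpoint of exactly two of the $S_i$ (a simple vertex) one enters and the other one exits. A point that is an endpoint of $m\ge 3$ of the $S_i$ is an $m$-junction. The network is admissible if every $S_i$ is parallel to a facet of $B^\phi$ and the angle at every simple vertex is $120^\circ$. It is simple if moreover all its junctions are triple junctions at which the three segments/half-lines meet at $120^\circ$. *Curvature.* A Cahn–Hoffman (CH) field $N$ on $\mathcal S$ is a family of Lipschitz maps $N_i:S_i\to\partial B^\phi$ with $N_i\cdot\nu_i=\phi^o(\nu_i)$, which agree at simple vertices and satisfy $\sum_i(-1)^{\sigma_i}N_i(X)=0$ at each junction $X$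 (sum over the $S_i$ ending at $X$; $\sigma_i=0$ if $S_i$ is oriented from $X$, and $\sigma_i=1$ otherwise). $\mathcal S$ is $\phi$-regular if it has a CH field. A CH field is minimal if it minimizes $\sum_i\int_{S_i}(\mathrm{div}_\tau N_i)^2\phi^o(\nu_i)\,d\mathcal H^1$ among all CH fields. The $\phi$-curvature $\kappa^\phi_{S_i}$ is the constant value of $\mathrm{div}_\tau N_i$ on $S_i$, common to all minimal CH fields $N$. *Flow.* A network $\bar{\mathcal S}=\bigcup_i\bar S_i$ is parallel to $\mathcal S=\bigcup_i S_i$ if $\bar S_i$ and $S_i$ have the same unit tangent, $\bar S_i$ is a segment (resp. half-line) whenever $S_i$ is, $S_i\Delta\bar S_i$ is bounded when $S_i$ is a half-line, and endpoints that coincide in $\mathcal S$ coincide in $\bar{\mathcal S}$. The height from $S_i$ to $\bar S_i$ is the number $h$ such that the line through $\bar S_i$ is the line through $S_i$ translated by $h\nu_i$. Given a $\phi$-regular admissible network $\mathcal S^0=\bigcup_iS_i^0$ and $T\in(0,+\infty]$, a $\phi$-curvature flow on $[0,T)$ starting from $\mathcal S^0$ is a family $\{\mathcal S(t)\}_{t\in[0,T)}$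 of networks parallel to $\mathcal S^0$, with $\mathcal S(0)=\mathcal S^0$, such that the heights $h_i(t)$ from $S_i^0$ to $S_i(t)$ belong to $C^1((0,T))\cap C^0([0,T))$ and $h_i'(t)=-\phi^o(\nu_{S_i(t)})\,\kappa^\phi_{S_i(t)}$ for all $t\in(0,T)$ and all $i$. **Theorem.** Let $\mathcal S^0$ be a simple network. Then there exist $T^\dagger\in(0,+\infty]$ and a family $\{\mathcal S(t)\}_{t\in[0,T^\dagger)}$ of simple networks that is a $\phi$-curvature flow on $[0,T^\dagger)$ starting from $\mathcal S^0$. This flow is unique and $T^\dagger$ is maximal: every $\phi$-curvature flow $\{\mathcal S'(t)\}_{t\in[0,T')}$ starting from $\mathcal S^0$ satisfies $T'\le T^\dagger$ and $\mathcal S'(t)=\mathcal S(t)$ for all $t\in[0,T')$. Moreover, if $T^\dagger<+\infty$, then there is a segment $S_i$ with $\lim_{t\nearrow T^\dagger}\mathcal H^1(S_i(t))=0$. -/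

import Mathlib

open Set Filter Topology MeasureTheory
open scoped ENNReal NNReal

noncomputable section

namespace HexNetwork

/-- The Euclidean plane. -/
abbrev Plane : Type := EuclideanSpace ℝ (Fin 2)

/-- Counterclockwise rotation by 90 degrees. -/
def rot (v : Plane) : Plane := !₂[-(v 1), v 0]

/-! ### The anisotropy -/

/-- The outer unit normals of the six facets of the Wulff shape (angles 30°, 90°, 150°, ...). -/
def facetNormal (k : Fin 6) : Plane :=
  !₂[Real.cos (Real.pi / 6 + k.val * (Real.pi / 3)), Real.sin (Real.pi / 6 + k.val * (Real.pi / 3))]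

/-- The norm `φ` whose closed unit ball is the regular hexagon circumscribed to the unit circle
with two horizontal facets. -/
def phi (x : Plane) : ℝ := ⨆ k : Fin 6, inner ℝ x (facetNormal k)

/-- The dual norm `φᵒ`. -/
def phiDual (ξ : Plane) : ℝ := sSup {r : ℝ | ∃ η : Plane, phi η = 1 ∧ r = inner ℝ ξ η}

/-! ### Oriented segments and half-lines -/

/-- Kind of a piece of a polygonal network: a segment of length `L`, a half-line oriented away from
its endpoint, or a half-line oriented towards its endpoint. -/
inductive Extent where
  | segment (L : ℝ)
  | outgoing
  | incoming

/-- An oriented segment or half-line: `base` is the starting point of a segment, and the only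
endpoint of a half-line; `tangent` is the unit tangent vector giving the orientation. -/
structure Piece where
  base : Plane
  tangent : Plane
  extent : Extent

namespace Piece

/-- Arclength parametrization. -/
def point (p : Piece) (s : ℝ) : Plane := p.base + s • p.tangent

/-- Interval of the arclength parameter. -/
def dom (p : Piece) : Set ℝ :=
  match p.extent with
  | .segment L => Icc 0 L
  | .outgoing => Ici 0
  | .incoming => Iic 0

/-- The (closed) segment or half-line as a set. -/
def carrier (p : Piece) : Set Plane := p.point '' p.dom

/-- The unit normal: the counterclockwise rotation of the tangent. -/
def normal (p : Piece) : Plane := rot p.tangent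

/-- The initial point, if there is one. -/
def startPt (p : Piece) : Option Plane :=
  match p.extent with
  | .segment _ => some p.base
  | .outgoing => some p.base
  | .incoming => none

/-- The final point, if there is one. -/
def endPt (p : Piece) : Option Plane :=
  match p.extent with
  | .segment L => some (p.point L)
  | .outgoing => none
  | .incoming => some p.base

/-- `X` is an endpoint of `p`. -/
def IsEndpoint (p : Piece) (X : Plane) : Prop := p.startPt = some X ∨ p.endPt = some X

open Classical in
/-- The unit vector pointing from the endpoint `X` of `p` into `p`. -/
def dirFrom (p : Piece) (X : Plane) : Plane := if p.startPt = some X then p.tangent else -p.tangent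

/-- `p` is a segment (and not a half-line). -/
def IsSegment (p : Piece) : Prop := ∃ L : ℝ, p.extent = .segment L

/-- Euclidean length. -/
def length (p : Piece) : ℝ≥0∞ :=
  match p.extent with
  | .segment L => ENNReal.ofReal L
  | .outgoing => ⊤
  | .incoming => ⊤

/-- The tangent is a unit vector, and a segment has positive length. -/
def Nondegenerate (p : Piece) : Prop :=
  ‖p.tangent‖ = 1 ∧ ∀ L : ℝ, p.extent = .segment L → 0 < L

/-- `p` and `q` are both segments, or half-lines that are both oriented away from, or both towards,
their endpoints. -/
def SameKind (p q : Piece) : Prop :=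
  match p.extent, q.extent with
  | .segment _, .segment _ => True
  | .outgoing, .outgoing => True
  | .incoming, .incoming => True
  | _, _ => False

/-- Signed height from `p` to a parallel piece `q`, with respect to the normal of `p`: the line
through `q` is the line through `p` translated by `height p q • p.normal`. -/
def height (p q : Piece) : ℝ := inner ℝ (q.base - p.base) p.normal

end Piece

/-! ### Polygonal networks -/

variable {ι : Type*} [Fintype ι]

/-- Number of segments and half-lines having `X` as an endpoint. -/
def degree (S : ι → Piece) (X : Plane) : ℕ := {i | (S i).IsEndpoint X}.ncard

/-- The pieces `S i` are the segments and half-lines of an oriented polygonal network. At a vertex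
of degree two (a simple vertex, interior to one of the curves) the orientations of the two pieces
agree with one orientation of the curve; vertices of degree at least three are the multiple
junctions, where the curves end. -/
structure IsNetwork (S : ι → Piece) : Prop where
  nonempty : Nonempty ι
  nondegenerate : ∀ i, (S i).Nondegenerate
  /-- Distinct pieces meet at most at common endpoints. -/
  meet : ∀ i j, i ≠ j → ∀ x ∈ (S i).carrier ∩ (S j).carrier,
    (S i).IsEndpoint x ∧ (S j).IsEndpoint x
  /-- There are no free endpoints. -/
  no_free_end : ∀ i X, (S i).IsEndpoint X → ∃ j, j ≠ i ∧ (S j).IsEndpoint X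
  oriented : ∀ i j X, i ≠ j → (S i).IsEndpoint X → (S j).IsEndpoint X → degree S X = 2 →
    ((S i).startPt = some X ↔ (S j).endPt = some X)
  connected : ∀ i j, Relation.ReflTransGen
    (fun a b => ∃ X, (S a).IsEndpoint X ∧ (S b).IsEndpoint X) i j

/-- Admissible network: every piece is parallel to a facet of the Wulff shape, and the angle at
every simple vertex is 120°. -/
structure IsAdmissible (S : ι → Piece) : Prop where
  network : IsNetwork S
  parallel_facet : ∀ i, ∃ k, inner ℝ (S i).tangent (facetNormal k) = 0
  angle_vertex : ∀ i j X, i ≠ j → (S i).IsEndpoint X → (S j).IsEndpoint X → degree S X = 2 →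
    InnerProductGeometry.angle ((S i).dirFrom X) ((S j).dirFrom X) = 2 * Real.pi / 3

/-- Simple network: an admissible network all of whose multiple junctions are triple junctions
at which the pieces meet at 120°. -/
structure IsSimple (S : ι → Piece) : Prop where
  admissible : IsAdmissible S
  triple : ∀ X, 3 ≤ degree S X → degree S X = 3
  angle_triple : ∀ i j X, i ≠ j → (S i).IsEndpoint X → (S j).IsEndpoint X → degree S X = 3 →
    InnerProductGeometry.angle ((S i).dirFrom X) ((S j).dirFrom X) = 2 * Real.pi / 3

/-! ### Cahn-Hoffman fields and crystalline curvature -/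

open Classical in
/-- `N` is a Cahn-Hoffman field on `S`; `N i` is its restriction to the piece `S i` (the values of
`N i` off `S i` play no role). At a simple vertex the balance condition says that the values on the
incoming and on the outgoing piece agree, so that `N` is Lipschitz along each curve. -/
structure IsCHField (S : ι → Piece) (N : ι → Plane → Plane) : Prop where
  lipschitz : ∀ i, ∃ K : ℝ≥0, LipschitzOnWith K (N i) (S i).carrier
  phi_eq_one : ∀ i, ∀ x ∈ (S i).carrier, phi (N i x) = 1
  inner_normal : ∀ i, ∀ x ∈ (S i).carrier, inner ℝ (N i x) (S i).normal = phiDual (S i).normal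
  balance : ∀ X : Plane,
    ∑ i, ((if (S i).startPt = some X then N i X else 0)
      - (if (S i).endPt = some X then N i X else 0)) = 0

/-- A network is `φ`-regular if it admits a (Lipschitz) Cahn-Hoffman field. -/
def IsPhiRegular (S : ι → Piece) : Prop := ∃ N, IsCHField S N

/-- Tangential divergence along the piece `p` of a vector field `g`, at the point of arclength
parameter `s`. -/
def tangentialDiv (p : Piece) (g : Plane → Plane) (s : ℝ) : ℝ :=
  inner ℝ (deriv (fun r => g (p.point r)) s) p.tangent

/-- The functional `∑ i, ∫_{S i} (div_τ N)² φᵒ(ν) dℋ¹`. -/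
def energy (S : ι → Piece) (N : ι → Plane → Plane) : ℝ≥0∞ :=
  ∑ i, ∫⁻ s in (S i).dom,
    ENNReal.ofReal ((tangentialDiv (S i) (N i) s) ^ 2 * phiDual (S i).normal)

/-- Minimal Cahn-Hoffman fields. -/
structure IsMinimalCHField (S : ι → Piece) (N : ι → Plane → Plane) : Prop where
  field : IsCHField S N
  minimal : ∀ N', IsCHField S N' → energy S N ≤ energy S N'

/-- `κ` is the `φ`-curvature of the piece `S i`: minimal Cahn-Hoffman fields exist, and all of them
have tangential divergence `κ` along `S i`. -/
def HasPhiCurvature (S : ι → Piece) (i : ι) (κ : ℝ) : Prop :=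
  (∃ N, IsMinimalCHField S N) ∧
    ∀ N, IsMinimalCHField S N →
      ∀ᵐ s ∂(volume.restrict (S i).dom), tangentialDiv (S i) (N i) s = κ

/-! ### Parallel networks and the flow -/

/-- The network `T` is parallel to the network `S`. -/
structure IsParallel (S T : ι → Piece) : Prop where
  tangent_eq : ∀ i, (T i).tangent = (S i).tangent
  same_kind : ∀ i, (S i).SameKind (T i)
  half_line : ∀ i, ¬ (S i).IsSegment →
    Bornology.IsBounded (symmDiff (S i).carrier (T i).carrier)
  /-- Endpoints that coincide in `S` coincide in `T`. -/
  start_start : ∀ i j X, (S i).startPt = some X → (S j).startPt = some X →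
    (T i).startPt = (T j).startPt
  start_end : ∀ i j X, (S i).startPt = some X → (S j).endPt = some X →
    (T i).startPt = (T j).endPt
  end_end : ∀ i j X, (S i).endPt = some X → (S j).endPt = some X →
    (T i).endPt = (T j).endPt

/-- `S` is a (regular) `φ`-curvature flow in `[0, T)` starting from `S₀`. Only the values `S t` with
`0 ≤ t < T` matter. -/
structure IsPhiCurvatureFlow (S₀ : ι → Piece) (T : EReal) (S : ℝ → ι → Piece) : Prop where
  pos : 0 < T
  admissible : IsAdmissible S₀
  regular : IsPhiRegular S₀
  initial : S 0 = S₀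
  network : ∀ t : ℝ, 0 ≤ t → (t : EReal) < T → IsNetwork (S t)
  parallel : ∀ t : ℝ, 0 ≤ t → (t : EReal) < T → IsParallel S₀ (S t)
  continuousOn : ∀ i, ContinuousOn (fun t => (S₀ i).height (S t i))
    {t : ℝ | 0 ≤ t ∧ (t : EReal) < T}
  contDiffOn : ∀ i, ContDiffOn ℝ 1 (fun t => (S₀ i).height (S t i))
    {t : ℝ | 0 < t ∧ (t : EReal) < T}
  evolution : ∀ t : ℝ, 0 < t → (t : EReal) < T → ∀ i, ∃ κ : ℝ, HasPhiCurvature (S t) i κ ∧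
    HasDerivAt (fun r => (S₀ i).height (S r i)) (-(phiDual (S t i).normal * κ)) t

end HexNetwork

end

open HexNetwork

set_option linter.unusedSectionVars false

noncomputable section

namespace HexNetwork

/-! ### Elementary geometry of the plane -/

theorem plane_inner (x y : Plane) : inner ℝ x y = x 0 * y 0 + x 1 * y 1 := by
  simp [PiLp.inner_apply, Fin.sum_univ_two, mul_comm]

@[simp] theorem rot_zero_apply (x : Plane) : rot x 0 = -(x 1) := by simp [rot]

@[simp] theorem rot_one_apply (x : Plane) : rot x 1 = x 0 := by simp [rot]

theorem plane_ext {x y : Plane} (h0 : x 0 = y 0) (h1 : x 1 = y 1) : x = y := by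
  ext i; fin_cases i <;> assumption

theorem plane_norm_sq (x : Plane) : ‖x‖ ^ 2 = x 0 ^ 2 + x 1 ^ 2 := by
  rw [← real_inner_self_eq_norm_sq, plane_inner]; ring

/-- The rotation by 90 degrees as a linear map. -/
def rotLin : Plane →ₗ[ℝ] Plane where
  toFun := rot
  map_add' x y := by apply plane_ext <;> simp; ring
  map_smul' r x := by apply plane_ext <;> simp

theorem eq_one_or_neg_one_of_sq {a : ℝ} (h : a ^ 2 = 1) : a = 1 ∨ a = -1 := by
  have : (a - 1) * (a + 1) = 0 := by linear_combination h
  rcases mul_eq_zero.1 this with h | h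
  · left; linarith
  · right; linarith

theorem norm_eq_one_of_sq {x : Plane} (h : ‖x‖ ^ 2 = 1) : ‖x‖ = 1 := by
  rcases eq_one_or_neg_one_of_sq h with h | h
  · exact h
  · linarith [norm_nonneg x]

theorem rot_smul (r : ℝ) (x : Plane) : rot (r • x) = r • rot x := rotLin.map_smul r x

theorem rot_zero : rot 0 = 0 := rotLin.map_zero

theorem rot_sum {ι : Type*} (s : Finset ι) (f : ι → Plane) :
    rot (∑ i ∈ s, f i) = ∑ i ∈ s, rot (f i) := map_sum rotLin f s

theorem inner_rot_rot (x y : Plane) : inner ℝ (rot x) (rot y) = inner ℝ x y := by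
  simp only [plane_inner, rot_zero_apply, rot_one_apply]; ring

theorem inner_rot_self (x : Plane) : inner ℝ (rot x) x = 0 := by
  simp only [plane_inner, rot_zero_apply, rot_one_apply]; ring

theorem inner_self_rot (x : Plane) : inner ℝ x (rot x) = 0 := by
  simp only [plane_inner, rot_zero_apply, rot_one_apply]; ring

theorem inner_rot_left (x y : Plane) : inner ℝ (rot x) y = - inner ℝ x (rot y) := by
  simp only [plane_inner, rot_zero_apply, rot_one_apply]; ring

theorem norm_rot (x : Plane) : ‖rot x‖ = ‖x‖ := by
  have : ‖rot x‖ ^ 2 = ‖x‖ ^ 2 := by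
    simp only [plane_norm_sq, rot_zero_apply, rot_one_apply]; ring
  exact (sq_eq_sq₀ (norm_nonneg _) (norm_nonneg _)).1 this

theorem unit_sq {u : Plane} (hu : ‖u‖ = 1) : u 0 ^ 2 + u 1 ^ 2 = 1 := by
  rw [← plane_norm_sq, hu, one_pow]

theorem inner_self_unit {u : Plane} (hu : ‖u‖ = 1) : inner ℝ u u = (1 : ℝ) := by
  rw [real_inner_self_eq_norm_sq, hu, one_pow]

theorem plane_decomp {u : Plane} (hu : ‖u‖ = 1) (x : Plane) :
    x = (inner ℝ x u : ℝ) • u + (inner ℝ x (rot u) : ℝ) • rot u := by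
  have h := unit_sq hu
  apply plane_ext <;>
    simp only [plane_inner, rot_zero_apply, rot_one_apply, PiLp.add_apply, PiLp.smul_apply,
      smul_eq_mul]
  · linear_combination (-(x 0)) * h
  · linear_combination (-(x 1)) * h

theorem inner_decomp {u : Plane} (hu : ‖u‖ = 1) (x y : Plane) :
    (inner ℝ x y : ℝ) = inner ℝ x u * inner ℝ y u + inner ℝ x (rot u) * inner ℝ y (rot u) := by
  have h := unit_sq hu
  simp only [plane_inner, rot_zero_apply, rot_one_apply]
  linear_combination (-(x 0 * y 0 + x 1 * y 1)) * h

theorem plane_ext_inner {u x y : Plane} (hu : ‖u‖ = 1) (h1 : (inner ℝ x u : ℝ) = inner ℝ y u)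
    (h2 : (inner ℝ x (rot u) : ℝ) = inner ℝ y (rot u)) : x = y := by
  rw [plane_decomp hu x, plane_decomp hu y, h1, h2]

theorem abs_inner_unit_le {u : Plane} (hu : ‖u‖ = 1) (x : Plane) : |(inner ℝ x u : ℝ)| ≤ ‖x‖ := by
  simpa [hu] using abs_real_inner_le_norm x u

theorem sqrt_three_sq : Real.sqrt 3 * Real.sqrt 3 = 3 := Real.mul_self_sqrt (by norm_num)

theorem sqrt_three_pos : 0 < Real.sqrt 3 := Real.sqrt_pos.2 (by norm_num)

theorem inner_of_angle {u v : Plane} (hu : ‖u‖ = 1) (hv : ‖v‖ = 1)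
    (h : InnerProductGeometry.angle u v = 2 * Real.pi / 3) : (inner ℝ u v : ℝ) = -1 / 2 := by
  have h1 := InnerProductGeometry.cos_angle u v
  rw [h, hu, hv] at h1
  have : Real.cos (2 * Real.pi / 3) = -1 / 2 := by
    rw [show 2 * Real.pi / 3 = Real.pi - Real.pi / 3 by ring, Real.cos_pi_sub,
      Real.cos_pi_div_three]; ring
  rw [this] at h1
  simpa using h1.symm

theorem angle_of_inner {u v : Plane} (hu : ‖u‖ = 1) (hv : ‖v‖ = 1)
    (h : (inner ℝ u v : ℝ) = -1 / 2) : InnerProductGeometry.angle u v = 2 * Real.pi / 3 := by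
  have : Real.cos (2 * Real.pi / 3) = -1 / 2 := by
    rw [show 2 * Real.pi / 3 = Real.pi - Real.pi / 3 by ring, Real.cos_pi_sub,
      Real.cos_pi_div_three]; ring
  rw [InnerProductGeometry.angle, hu, hv, h, mul_one, div_one, ← this, Real.arccos_cos]
  · positivity
  · linarith [Real.pi_pos]

/-! ### Directions of the facets -/

/-- Unit vectors parallel to a facet of the Wulff shape. -/
def IsHexDir (u : Plane) : Prop := ‖u‖ = 1 ∧ u 1 * (3 * u 0 ^ 2 - u 1 ^ 2) = 0

theorem IsHexDir.neg {u : Plane} (h : IsHexDir u) : IsHexDir (-u) := by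
  refine ⟨by rw [norm_neg]; exact h.1, ?_⟩
  have := h.2
  simp only [PiLp.neg_apply]
  linear_combination -this

theorem IsHexDir.smul_sign {u : Plane} (h : IsHexDir u) {s : ℝ} (hs : s = 1 ∨ s = -1) :
    IsHexDir (s • u) := by
  rcases hs with rfl | rfl
  · simpa using h
  · simpa using h.neg

theorem hex_coords {p q : ℝ} (h1 : p ^ 2 + q ^ 2 = 1) (h2 : q * (3 * p ^ 2 - q ^ 2) = 0) :
    (q = 0 ∧ (p = 1 ∨ p = -1)) ∨
      ((q = Real.sqrt 3 / 2 ∨ q = -(Real.sqrt 3 / 2)) ∧ (p = 1 / 2 ∨ p = -(1 / 2))) := by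
  rcases mul_eq_zero.1 h2 with h | h
  · left
    refine ⟨h, ?_⟩
    rw [h] at h1
    have : (p - 1) * (p + 1) = 0 := by linear_combination h1
    rcases mul_eq_zero.1 this with h | h
    · left; linarith
    · right; linarith
  · right
    constructor
    · have : (q - Real.sqrt 3 / 2) * (q + Real.sqrt 3 / 2) = 0 := by
        linear_combination (3 / 4) * h1 - h / 4 - sqrt_three_sq / 4
      rcases mul_eq_zero.1 this with h | h
      · left; linarith
      · right; linarith
    · have : (p - 1 / 2) * (p + 1 / 2) = 0 := by linear_combination h1 / 4 + h / 4
      rcases mul_eq_zero.1 this with h | h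
      · left; linarith
      · right; linarith

/-- Relative position of two facet directions. -/
theorem IsHexDir.relative {u w : Plane} (hu : IsHexDir u) (hw : IsHexDir w) :
    ((inner ℝ w (rot u) : ℝ) = 0 ∧ ((inner ℝ w u : ℝ) = 1 ∨ (inner ℝ w u : ℝ) = -1)) ∨
      (((inner ℝ w (rot u) : ℝ) = Real.sqrt 3 / 2 ∨
          (inner ℝ w (rot u) : ℝ) = -(Real.sqrt 3 / 2)) ∧
        ((inner ℝ w u : ℝ) = 1 / 2 ∨ (inner ℝ w u : ℝ) = -(1 / 2))) := by
  obtain ⟨hu1, hu2⟩ := hu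
  obtain ⟨hw1, hw2⟩ := hw
  have hu1 := unit_sq hu1
  have hw1 := unit_sq hw1
  simp only [plane_inner, rot_zero_apply, rot_one_apply]
  apply hex_coords
  · linear_combination (w 0 ^ 2 + w 1 ^ 2) * hu1 + hw1
  · linear_combination (u 0 ^ 3 - 3 * u 0 * u 1 ^ 2) * hw2 - (w 0 ^ 3 - 3 * w 0 * w 1 ^ 2) * hu2

theorem IsHexDir.of_relative {u w : Plane} (hu : IsHexDir u) (hw : ‖w‖ = 1)
    (h : (inner ℝ w (rot u) : ℝ) * (3 * (inner ℝ w u : ℝ) ^ 2 - (inner ℝ w (rot u) : ℝ) ^ 2) = 0) :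
    IsHexDir w := by
  refine ⟨hw, ?_⟩
  have hu2 := hu.2
  have e0 := congrArg (fun v : Plane => v 0) (plane_decomp hu.1 w)
  have e1 := congrArg (fun v : Plane => v 1) (plane_decomp hu.1 w)
  simp only [PiLp.add_apply, PiLp.smul_apply, smul_eq_mul, rot_zero_apply, rot_one_apply] at e0 e1
  set p := (inner ℝ w u : ℝ)
  set q := (inner ℝ w (rot u) : ℝ)
  rw [e0, e1]
  linear_combination (u 0 ^ 3 - 3 * u 0 * u 1 ^ 2) * h + (p ^ 3 - 3 * p * q ^ 2) * hu2

/-! ### Facet normals, the norm and its dual -/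

theorem facetNormal_zero (k : Fin 6) :
    facetNormal k 0 = Real.cos (Real.pi / 6 + k.val * (Real.pi / 3)) := by simp [facetNormal]

theorem facetNormal_one (k : Fin 6) :
    facetNormal k 1 = Real.sin (Real.pi / 6 + k.val * (Real.pi / 3)) := by simp [facetNormal]

theorem facetNormal_coords (k : Fin 6) : facetNormal k =
    (![!₂[Real.sqrt 3 / 2, 1 / 2], !₂[0, 1], !₂[-(Real.sqrt 3 / 2), 1 / 2],
      !₂[-(Real.sqrt 3 / 2), -(1 / 2)], !₂[0, -1], !₂[Real.sqrt 3 / 2, -(1 / 2)]] k : Plane) := by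
  have c0 := Real.cos_pi_div_six
  have s0 := Real.sin_pi_div_six
  have c1 := Real.cos_pi_div_three
  have s1 := Real.sin_pi_div_three
  fin_cases k
  · apply plane_ext <;> simp [facetNormal_zero, facetNormal_one]
  · have e : Real.pi / 6 + Real.pi / 3 = Real.pi / 2 := by ring
    apply plane_ext <;> simp [facetNormal_zero, facetNormal_one, e]
  · have e : Real.pi / 6 + 2 * (Real.pi / 3) = Real.pi - Real.pi / 6 := by ring
    apply plane_ext <;> simp [facetNormal_zero, facetNormal_one, e]
  · have e : Real.pi / 6 + 3 * (Real.pi / 3) = Real.pi / 6 + Real.pi := by ring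
    apply plane_ext <;> simp [facetNormal_zero, facetNormal_one, e]
  · have e : Real.pi / 6 + 4 * (Real.pi / 3) = Real.pi / 2 + Real.pi := by ring
    apply plane_ext <;> simp [facetNormal_zero, facetNormal_one, e]
  · have e : Real.pi / 6 + 5 * (Real.pi / 3) = 2 * Real.pi - Real.pi / 6 := by ring
    apply plane_ext <;> simp [facetNormal_zero, facetNormal_one, e, Real.cos_two_pi_sub,
      Real.sin_two_pi_sub]

theorem exists_facetNormal {u : Plane} (hu : IsHexDir u) : ∃ k, facetNormal k = rot u := by
  rcases hex_coords (unit_sq hu.1) hu.2 with ⟨h1, h0 | h0⟩ | ⟨h1 | h1, h0 | h0⟩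
  · exact ⟨1, by rw [facetNormal_coords]; apply plane_ext <;> simp [h0, h1]⟩
  · exact ⟨4, by rw [facetNormal_coords]; apply plane_ext <;> simp [h0, h1]⟩
  · exact ⟨2, by rw [facetNormal_coords]; apply plane_ext <;> simp [h0, h1]⟩
  · exact ⟨3, by rw [facetNormal_coords]; apply plane_ext <;> simp [h0, h1]⟩
  · exact ⟨0, by rw [facetNormal_coords]; apply plane_ext <;> simp [h0, h1]⟩
  · exact ⟨5, by rw [facetNormal_coords]; apply plane_ext <;> simp [h0, h1]⟩

theorem norm_facetNormal (k : Fin 6) : ‖facetNormal k‖ = 1 := by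
  have : ‖facetNormal k‖ ^ 2 = 1 := by
    rw [plane_norm_sq, facetNormal_zero, facetNormal_one, add_comm, Real.sin_sq_add_cos_sq]
  exact norm_eq_one_of_sq this

theorem isHexDir_rot_facetNormal (k : Fin 6) : IsHexDir (rot (facetNormal k)) := by
  refine ⟨by rw [norm_rot, norm_facetNormal], ?_⟩
  rw [rot_zero_apply, rot_one_apply, facetNormal_coords]
  have h := sqrt_three_sq
  fin_cases k <;> simp
  all_goals nlinarith

theorem isHexDir_of_inner_facetNormal {u : Plane} (hu : ‖u‖ = 1) {k : Fin 6}
    (h : (inner ℝ u (facetNormal k) : ℝ) = 0) : IsHexDir u := by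
  have hn := norm_facetNormal k
  have := plane_decomp hn u
  rw [h, zero_smul, zero_add] at this
  have hr := isHexDir_rot_facetNormal k
  have h1 : (inner ℝ u (rot (facetNormal k)) : ℝ) ^ 2 = 1 := by
    have := inner_decomp hn u u
    rw [inner_self_unit hu, h] at this
    linarith
  rw [this]
  exact hr.smul_sign (eq_one_or_neg_one_of_sq h1)

theorem inner_facetNormal_le_phi (x : Plane) (k : Fin 6) :
    (inner ℝ x (facetNormal k) : ℝ) ≤ phi x :=
  le_ciSup (f := fun k : Fin 6 => (inner ℝ x (facetNormal k) : ℝ)) (Set.finite_range _).bddAbove k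

theorem inner_rot_le_phi {u : Plane} (hu : IsHexDir u) (x : Plane) :
    (inner ℝ x (rot u) : ℝ) ≤ phi x := by
  obtain ⟨k, hk⟩ := exists_facetNormal hu
  rw [← hk]; exact inner_facetNormal_le_phi x k

/-- `phi x` is bounded by `r` as soon as the six products with the facet normals are. -/
theorem phi_le_of_relative {u : Plane} (hu : IsHexDir u) {x : Plane} {r : ℝ}
    (h1 : |(inner ℝ x (rot u) : ℝ)| ≤ r)
    (h2 : |(inner ℝ x (rot u) : ℝ)| / 2 + Real.sqrt 3 / 2 * |(inner ℝ x u : ℝ)| ≤ r) :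
    phi x ≤ r := by
  apply ciSup_le
  intro k
  have hk := (hu.relative (isHexDir_rot_facetNormal k))
  rw [inner_rot_rot] at hk
  have e : (inner ℝ (facetNormal k) (rot u) : ℝ) = -inner ℝ (rot (facetNormal k)) u := by
    rw [inner_rot_left]; ring
  rw [inner_decomp hu.1 x (facetNormal k), e]
  have a1 := abs_le.1 (le_refl |(inner ℝ x (rot u) : ℝ)|)
  have a2 := abs_le.1 (le_refl |(inner ℝ x u : ℝ)|)
  have s3 := sqrt_three_pos
  rcases hk with ⟨h, h' | h'⟩ | ⟨h | h, h' | h'⟩ <;> rw [h, h'] <;> nlinarith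

theorem phi_rot {u : Plane} (hu : IsHexDir u) : phi (rot u) = 1 := by
  apply le_antisymm
  · apply phi_le_of_relative hu
    · rw [inner_rot_rot, inner_self_unit hu.1]; norm_num
    · rw [inner_rot_rot, inner_self_unit hu.1, inner_rot_self]; norm_num
  · have := inner_rot_le_phi hu (rot u)
    rwa [inner_rot_rot, inner_self_unit hu.1] at this

theorem phiDual_rot {u : Plane} (hu : IsHexDir u) : phiDual (rot u) = 1 := by
  apply IsGreatest.csSup_eq
  constructor
  · exact ⟨rot u, phi_rot hu, by rw [inner_rot_rot, inner_self_unit hu.1]⟩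
  · rintro r ⟨η, hη, rfl⟩
    rw [real_inner_comm, ← hη]
    exact inner_rot_le_phi hu η

/-- Half the Euclidean length of a facet of the Wulff shape. -/
def halfFacet : ℝ := Real.sqrt 3 / 3

theorem halfFacet_pos : 0 < halfFacet := by
  have := sqrt_three_pos
  unfold halfFacet; positivity

theorem halfFacet_sq : halfFacet * halfFacet = 1 / 3 := by
  unfold halfFacet; linear_combination sqrt_three_sq / 9

theorem sqrt_three_eq : Real.sqrt 3 = 3 * halfFacet := by unfold halfFacet; ring

/-- The facet of the Wulff shape with normal `rot u`. -/
theorem mem_facet_iff {u : Plane} (hu : IsHexDir u) (x : Plane) :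
    (phi x = 1 ∧ (inner ℝ x (rot u) : ℝ) = phiDual (rot u)) ↔
      ((inner ℝ x (rot u) : ℝ) = 1 ∧ |(inner ℝ x u : ℝ)| ≤ halfFacet) := by
  rw [phiDual_rot hu]
  have hs := sqrt_three_eq
  have hq := halfFacet_sq
  have hc := halfFacet_pos
  constructor
  · rintro ⟨h1, h2⟩
    refine ⟨h2, ?_⟩
    have key : ∀ s : ℝ, (s = 1 ∨ s = -1) → s * (inner ℝ x u : ℝ) ≤ halfFacet := by
      intro s hsgn
      have hs2 : s ^ 2 = 1 := by rcases hsgn with rfl | rfl <;> norm_num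
      let w : Plane := (1 / 2 : ℝ) • u + (-(s * (Real.sqrt 3 / 2))) • rot u
      have hwu : (inner ℝ w u : ℝ) = 1 / 2 := by
        simp only [w, inner_add_left, real_inner_smul_left, inner_self_unit hu.1, inner_rot_self]
        ring
      have hwr : (inner ℝ w (rot u) : ℝ) = -(s * (Real.sqrt 3 / 2)) := by
        simp only [w, inner_add_left, real_inner_smul_left, inner_rot_rot, inner_self_unit hu.1,
          inner_self_rot]
        ring
      have hw : IsHexDir w := by
        apply hu.of_relative
        · have := inner_decomp hu.1 w w
          rw [hwu, hwr, real_inner_self_eq_norm_sq] at this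
          have h1 : ‖w‖ ^ 2 = 1 := by
            rw [this]; linear_combination (Real.sqrt 3 ^ 2 / 4) * hs2 + sqrt_three_sq / 4
          exact norm_eq_one_of_sq h1
        · rw [hwu, hwr]
          have : 3 * (1 / 2 : ℝ) ^ 2 - (-(s * (Real.sqrt 3 / 2))) ^ 2 = 0 := by
            linear_combination -(Real.sqrt 3 ^ 2 / 4) * hs2 - sqrt_three_sq / 4
          rw [this, mul_zero]
      have := inner_rot_le_phi hw x
      rw [h1, inner_decomp hu.1 x (rot w), inner_rot_rot, hwu, h2, inner_rot_left, hwr, hs] at this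
      nlinarith
    rw [abs_le]
    have k1 := key 1 (Or.inl rfl)
    have k2 := key (-1) (Or.inr rfl)
    constructor <;> linarith
  · rintro ⟨h1, h2⟩
    refine ⟨le_antisymm ?_ ?_, h1⟩
    · apply phi_le_of_relative hu
      · rw [h1]; norm_num
      · rw [h1, hs, abs_one]; nlinarith
    · rw [← h1]; exact inner_rot_le_phi hu x

/-! ### Directions at 120 degrees -/

theorem sum_eq_zero_of_inner {u v w : Plane} (hu : ‖u‖ = 1) (hv : ‖v‖ = 1) (hw : ‖w‖ = 1)
    (huv : (inner ℝ u v : ℝ) = -1 / 2) (huw : (inner ℝ u w : ℝ) = -1 / 2)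
    (hvw : (inner ℝ v w : ℝ) = -1 / 2) : u + v + w = 0 := by
  rw [← inner_self_eq_zero (𝕜 := ℝ)]
  simp only [inner_add_left, inner_add_right, inner_self_unit hu, inner_self_unit hv,
    inner_self_unit hw, huv, huw, hvw, real_inner_comm u v, real_inner_comm u w,
    real_inner_comm v w]
  norm_num

theorem inner_rot_antisymm (u v : Plane) : (inner ℝ (rot u) v : ℝ) = -inner ℝ (rot v) u := by
  rw [inner_rot_left, real_inner_comm]

theorem inner_rot_sq {u v : Plane} (hu : ‖u‖ = 1) (hv : ‖v‖ = 1)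
    (huv : (inner ℝ u v : ℝ) = -1 / 2) : (inner ℝ (rot u) v : ℝ) ^ 2 = 3 / 4 := by
  have := inner_decomp hu v v
  rw [inner_self_unit hv, real_inner_comm u v, huv, real_inner_comm (rot u) v] at this
  linarith

/-- Expansion of a vector in the basis given by two directions at 120 degrees. -/
theorem decomp_two {u v : Plane} (hu : ‖u‖ = 1) (hv : ‖v‖ = 1)
    (huv : (inner ℝ u v : ℝ) = -1 / 2) (x : Plane) :
    x = ((4 / 3) * ((inner ℝ (rot v) u : ℝ) * inner ℝ (rot v) x)) • u +
      ((4 / 3) * ((inner ℝ (rot u) v : ℝ) * inner ℝ (rot u) x)) • v := by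
  have h2 := inner_rot_sq hu hv huv
  have ha := inner_rot_antisymm v u
  rw [ha]
  apply plane_ext <;>
    simp only [plane_inner, rot_zero_apply, rot_one_apply, PiLp.add_apply, PiLp.smul_apply,
      smul_eq_mul] at *
  · linear_combination (-(4 / 3) * x 0) * h2
  · linear_combination (-(4 / 3) * x 1) * h2

theorem ext_two {u v : Plane} (hu : ‖u‖ = 1) (hv : ‖v‖ = 1)
    (huv : (inner ℝ u v : ℝ) = -1 / 2) {x y : Plane}
    (h1 : (inner ℝ (rot u) x : ℝ) = inner ℝ (rot u) y)
    (h2 : (inner ℝ (rot v) x : ℝ) = inner ℝ (rot v) y) : x = y := by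
  rw [decomp_two hu hv huv x, decomp_two hu hv huv y, h1, h2]

theorem coeff_eq_zero_two {u v : Plane} (hu : ‖u‖ = 1) (hv : ‖v‖ = 1)
    (huv : (inner ℝ u v : ℝ) = -1 / 2) {a b : ℝ} (h : a • u + b • v = 0) : a = 0 ∧ b = 0 := by
  have h2 := inner_rot_sq hu hv huv
  have ha := inner_rot_antisymm v u
  have e1 := congrArg (fun x => (inner ℝ (rot u) x : ℝ)) h
  have e2 := congrArg (fun x => (inner ℝ (rot v) x : ℝ)) h
  simp only [inner_add_right, real_inner_smul_right, inner_rot_self, inner_zero_right, mul_zero,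
    zero_add, add_zero] at e1 e2
  have hne : (inner ℝ (rot u) v : ℝ) ≠ 0 := by intro h0; rw [h0] at h2; norm_num at h2
  have hne' : (inner ℝ (rot v) u : ℝ) ≠ 0 := by rw [ha]; exact neg_ne_zero.2 hne
  exact ⟨(mul_eq_zero.1 e2).resolve_right hne', (mul_eq_zero.1 e1).resolve_right hne⟩

/-! ### Incidences -/

open Classical in
/-- Orientation of `p` at its endpoint `X`: `1` if `p` starts at `X`, `-1` if it ends there. -/
def Piece.sgn (p : Piece) (X : Plane) : ℝ :=
  (if p.startPt = some X then 1 else 0) - (if p.endPt = some X then 1 else 0)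

/-- The unit vector at the endpoint `X` of `p` pointing into `p`; zero if `X` is no endpoint. -/
def Piece.dirAt (p : Piece) (X : Plane) : Plane := p.sgn X • p.tangent

/-- The rotated direction `dirAt`. -/
def Piece.norAt (p : Piece) (X : Plane) : Plane := p.sgn X • p.normal

theorem Piece.norAt_eq_rot (p : Piece) (X : Plane) : p.norAt X = rot (p.dirAt X) := by
  rw [Piece.norAt, Piece.dirAt, rot_smul]; rfl

theorem Piece.point_zero (p : Piece) : p.point 0 = p.base := by simp [Piece.point]

theorem Piece.Nondegenerate.not_start_and_end {p : Piece} (hp : p.Nondegenerate) {X : Plane}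
    (h1 : p.startPt = some X) (h2 : p.endPt = some X) : False := by
  obtain ⟨base, tangent, extent⟩ := p
  cases extent with
  | segment L =>
    simp only [Piece.startPt, Piece.endPt, Piece.point, Option.some.injEq] at h1 h2
    have hL := hp.2 L rfl
    have h3 : L • tangent = 0 := by
      have : base + L • tangent = base := by rw [h2, h1]
      simpa using this
    have h4 : ‖tangent‖ = 1 := hp.1
    rcases smul_eq_zero.1 h3 with h | h
    · linarith
    · rw [h, norm_zero] at h4; norm_num at h4
  | outgoing => simp [Piece.endPt] at h2
  | incoming => simp [Piece.startPt] at h1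

theorem Piece.Nondegenerate.sgn_start {p : Piece} (hp : p.Nondegenerate) {X : Plane}
    (h1 : p.startPt = some X) : p.sgn X = 1 := by
  have : ¬ p.endPt = some X := fun h => hp.not_start_and_end h1 h
  simp [Piece.sgn, h1, this]

theorem Piece.Nondegenerate.sgn_end {p : Piece} (hp : p.Nondegenerate) {X : Plane}
    (h1 : p.endPt = some X) : p.sgn X = -1 := by
  have : ¬ p.startPt = some X := fun h => hp.not_start_and_end h h1
  simp [Piece.sgn, h1, this]

theorem Piece.sgn_eq_zero {p : Piece} {X : Plane} (h : ¬ p.IsEndpoint X) : p.sgn X = 0 := by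
  rw [Piece.IsEndpoint, not_or] at h
  simp [Piece.sgn, h.1, h.2]

theorem Piece.Nondegenerate.sgn_eq {p : Piece} (hp : p.Nondegenerate) {X : Plane}
    (h : p.IsEndpoint X) : p.sgn X = 1 ∨ p.sgn X = -1 :=
  h.imp hp.sgn_start hp.sgn_end

theorem Piece.Nondegenerate.sgn_mul_self {p : Piece} (hp : p.Nondegenerate) {X : Plane}
    (h : p.IsEndpoint X) : p.sgn X * p.sgn X = 1 := by
  rcases hp.sgn_eq h with h | h <;> rw [h] <;> norm_num

theorem Piece.Nondegenerate.dirFrom_eq {p : Piece} (hp : p.Nondegenerate) {X : Plane}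
    (h : p.IsEndpoint X) : p.dirFrom X = p.dirAt X := by
  rcases h with h | h
  · simp [Piece.dirFrom, Piece.dirAt, hp.sgn_start h, h]
  · have : ¬ p.startPt = some X := fun h' => hp.not_start_and_end h' h
    simp [Piece.dirFrom, Piece.dirAt, hp.sgn_end h, this]

theorem Piece.Nondegenerate.norm_dirAt {p : Piece} (hp : p.Nondegenerate) {X : Plane}
    (h : p.IsEndpoint X) : ‖p.dirAt X‖ = 1 := by
  rcases hp.sgn_eq h with h | h <;> simp [Piece.dirAt, h, hp.1]

variable {ι : Type*} [Fintype ι] {S : ι → Piece}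

/-- `i` and `j` are the two pieces meeting at the simple vertex `X`. -/
structure IsPair (S : ι → Piece) (X : Plane) (i j : ι) : Prop where
  ne : i ≠ j
  left : (S i).IsEndpoint X
  right : (S j).IsEndpoint X
  only : ∀ k, (S k).IsEndpoint X → k = i ∨ k = j
  degree : degree S X = 2
  inner_eq : (inner ℝ ((S i).dirAt X) ((S j).dirAt X) : ℝ) = -1 / 2

/-- `i`, `j` and `k` are the three pieces meeting at the triple junction `X`. -/
structure IsTriple (S : ι → Piece) (X : Plane) (i j k : ι) : Prop where
  ne_ij : i ≠ j
  ne_ik : i ≠ k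
  ne_jk : j ≠ k
  first : (S i).IsEndpoint X
  second : (S j).IsEndpoint X
  third : (S k).IsEndpoint X
  only : ∀ l, (S l).IsEndpoint X → l = i ∨ l = j ∨ l = k
  degree : degree S X = 3
  inner_ij : (inner ℝ ((S i).dirAt X) ((S j).dirAt X) : ℝ) = -1 / 2
  inner_ik : (inner ℝ ((S i).dirAt X) ((S k).dirAt X) : ℝ) = -1 / 2
  inner_jk : (inner ℝ ((S j).dirAt X) ((S k).dirAt X) : ℝ) = -1 / 2

theorem IsPair.symm {X : Plane} {i j : ι} (h : IsPair S X i j) : IsPair S X j i :=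
  ⟨h.ne.symm, h.right, h.left, fun k hk => (h.only k hk).symm, h.degree, by
    rw [real_inner_comm]; exact h.inner_eq⟩

namespace IsSimple

theorem network (hS : IsSimple S) : IsNetwork S := hS.admissible.network

theorem nondegenerate (hS : IsSimple S) (i : ι) : (S i).Nondegenerate :=
  hS.network.nondegenerate i

theorem isHexDir (hS : IsSimple S) (i : ι) : IsHexDir (S i).tangent := by
  obtain ⟨k, hk⟩ := hS.admissible.parallel_facet i
  exact isHexDir_of_inner_facetNormal (hS.nondegenerate i).1 hk

theorem isHexDir_dirAt (hS : IsSimple S) {i : ι} {X : Plane} (h : (S i).IsEndpoint X) :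
    IsHexDir ((S i).dirAt X) :=
  (hS.isHexDir i).smul_sign ((hS.nondegenerate i).sgn_eq h)

theorem degree_eq (hS : IsSimple S) {i : ι} {X : Plane} (h : (S i).IsEndpoint X) :
    degree S X = 2 ∨ degree S X = 3 := by
  obtain ⟨j, hj, hjX⟩ := hS.network.no_free_end i X h
  have : 1 < degree S X := by
    rw [degree, Set.one_lt_ncard]
    exact ⟨i, h, j, hjX, hj.symm⟩
  by_cases h3 : 3 ≤ degree S X
  · exact Or.inr (hS.triple X h3)
  · left; omega

theorem inner_dirAt (hS : IsSimple S) {i j : ι} {X : Plane} (hij : i ≠ j)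
    (hi : (S i).IsEndpoint X) (hj : (S j).IsEndpoint X) :
    (inner ℝ ((S i).dirAt X) ((S j).dirAt X) : ℝ) = -1 / 2 := by
  rw [← (hS.nondegenerate i).dirFrom_eq hi, ← (hS.nondegenerate j).dirFrom_eq hj]
  apply inner_of_angle
  · rw [(hS.nondegenerate i).dirFrom_eq hi]; exact (hS.nondegenerate i).norm_dirAt hi
  · rw [(hS.nondegenerate j).dirFrom_eq hj]; exact (hS.nondegenerate j).norm_dirAt hj
  · rcases hS.degree_eq hi with h | h
    · exact hS.admissible.angle_vertex i j X hij hi hj h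
    · exact hS.angle_triple i j X hij hi hj h

theorem exists_pair (hS : IsSimple S) {i : ι} {X : Plane} (hi : (S i).IsEndpoint X)
    (h : degree S X = 2) : ∃ j, IsPair S X i j := by
  obtain ⟨a, b, hab, hset⟩ := Set.ncard_eq_two.1 h
  have hmem : ∀ k, (S k).IsEndpoint X ↔ k = a ∨ k = b := fun k => by
    have : k ∈ {i | (S i).IsEndpoint X} ↔ k ∈ ({a, b} : Set ι) := by rw [hset]
    simpa using this
  have ha := (hmem a).2 (Or.inl rfl)
  have hb := (hmem b).2 (Or.inr rfl)
  have hp : IsPair S X a b := ⟨hab, ha, hb, fun k hk => (hmem k).1 hk, h, hS.inner_dirAt hab ha hb⟩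
  rcases (hmem i).1 hi with rfl | rfl
  · exact ⟨b, hp⟩
  · exact ⟨a, hp.symm⟩

theorem exists_triple (hS : IsSimple S) {i : ι} {X : Plane} (hi : (S i).IsEndpoint X)
    (h : degree S X = 3) : ∃ j k, IsTriple S X i j k := by
  obtain ⟨a, b, c, hab, hac, hbc, hset⟩ := Set.ncard_eq_three.1 h
  have hmem : ∀ k, (S k).IsEndpoint X ↔ k = a ∨ k = b ∨ k = c := fun k => by
    have : k ∈ {i | (S i).IsEndpoint X} ↔ k ∈ ({a, b, c} : Set ι) := by rw [hset]
    simpa using this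
  have ha := (hmem a).2 (by simp)
  have hb := (hmem b).2 (by simp)
  have hc := (hmem c).2 (by simp)
  have key : ∀ x y z : ι, x ≠ y → x ≠ z → y ≠ z → (S x).IsEndpoint X → (S y).IsEndpoint X →
      (S z).IsEndpoint X → (∀ l, (S l).IsEndpoint X → l = x ∨ l = y ∨ l = z) →
      IsTriple S X x y z := fun x y z hxy hxz hyz hx hy hz ho =>
    ⟨hxy, hxz, hyz, hx, hy, hz, ho, h, hS.inner_dirAt hxy hx hy, hS.inner_dirAt hxz hx hz,
      hS.inner_dirAt hyz hy hz⟩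
  rcases (hmem i).1 hi with rfl | rfl | rfl
  · exact ⟨b, c, key _ _ _ hab hac hbc ha hb hc fun l hl => (hmem l).1 hl⟩
  · exact ⟨a, c, key _ _ _ hab.symm hbc hac hb ha hc fun l hl => by have := (hmem l).1 hl; tauto⟩
  · exact ⟨a, b, key _ _ _ hac.symm hbc.symm hab hc ha hb fun l hl => by
      have := (hmem l).1 hl; tauto⟩

end IsSimple

theorem IsPair.sum_eq {M : Type*} [AddCommMonoid M] {X : Plane} {i j : ι} (h : IsPair S X i j)
    {f : ι → M} (hf : ∀ k, ¬ (S k).IsEndpoint X → f k = 0) : ∑ k, f k = f i + f j := by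
  classical
  rw [← Finset.sum_subset (Finset.subset_univ {i, j}), Finset.sum_pair h.ne]
  intro k _ hk
  apply hf
  intro hk'
  simpa using hk (by simpa using h.only k hk')

theorem IsTriple.sum_eq {M : Type*} [AddCommMonoid M] {X : Plane} {i j k : ι}
    (h : IsTriple S X i j k) {f : ι → M} (hf : ∀ k, ¬ (S k).IsEndpoint X → f k = 0) :
    ∑ l, f l = f i + f j + f k := by
  classical
  rw [← Finset.sum_subset (Finset.subset_univ {i, j, k}), Finset.sum_insert, Finset.sum_pair h.ne_jk,
    add_assoc]
  · simp [h.ne_ij, h.ne_ik]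
  intro l _ hl
  apply hf
  intro hl'
  simpa using hl (by simpa using h.only l hl')

theorem dirAt_eq_zero {i : ι} {X : Plane} (h : ¬ (S i).IsEndpoint X) : (S i).dirAt X = 0 := by
  rw [Piece.dirAt, Piece.sgn_eq_zero h, zero_smul]

theorem norAt_eq_zero {i : ι} {X : Plane} (h : ¬ (S i).IsEndpoint X) : (S i).norAt X = 0 := by
  rw [Piece.norAt, Piece.sgn_eq_zero h, zero_smul]

/-- Tangential component at `X`, along the piece `i`, of a balanced field: the value forced by the
balance condition at a simple vertex, and zero at a triple junction. -/
def vertexValue (S : ι → Piece) (i : ι) (X : Plane) : ℝ :=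
  2 / 3 * inner ℝ ((S i).norAt X) (∑ j, (S j).dirAt X)

theorem IsPair.vertexValue_left {X : Plane} {i j : ι} (h : IsPair S X i j) :
    vertexValue S i X = 2 / 3 * inner ℝ ((S i).norAt X) ((S j).dirAt X) := by
  rw [vertexValue, h.sum_eq (fun k hk => dirAt_eq_zero hk), inner_add_right, Piece.norAt_eq_rot,
    inner_rot_self, zero_add]

theorem IsTriple.sum_dirAt (hS : IsSimple S) {X : Plane} {i j k : ι} (h : IsTriple S X i j k) :
    ∑ l, (S l).dirAt X = 0 := by
  rw [h.sum_eq (fun k hk => dirAt_eq_zero hk)]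
  exact sum_eq_zero_of_inner ((hS.nondegenerate i).norm_dirAt h.first)
    ((hS.nondegenerate j).norm_dirAt h.second) ((hS.nondegenerate k).norm_dirAt h.third)
    h.inner_ij h.inner_ik h.inner_jk

theorem vertexValue_of_degree_three (hS : IsSimple S) {X : Plane} (h : degree S X = 3) (i : ι) :
    vertexValue S i X = 0 := by
  by_cases hi : (S i).IsEndpoint X
  · obtain ⟨j, k, ht⟩ := hS.exists_triple hi h
    rw [vertexValue, ht.sum_dirAt hS, inner_zero_right, mul_zero]
  · rw [vertexValue, norAt_eq_zero hi, inner_zero_left, mul_zero]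

theorem IsPair.norAt_inner_sq (hS : IsSimple S) {X : Plane} {i j : ι} (h : IsPair S X i j) :
    (inner ℝ ((S i).norAt X) ((S j).dirAt X) : ℝ) ^ 2 = 3 / 4 := by
  rw [Piece.norAt_eq_rot]
  exact inner_rot_sq ((hS.nondegenerate i).norm_dirAt h.left)
    ((hS.nondegenerate j).norm_dirAt h.right) h.inner_eq

theorem abs_vertexValue_of_degree_two (hS : IsSimple S) {X : Plane} (h : degree S X = 2) {i : ι}
    (hi : (S i).IsEndpoint X) : |vertexValue S i X| = halfFacet := by
  obtain ⟨j, hp⟩ := hS.exists_pair hi h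
  rw [← abs_of_pos halfFacet_pos, ← sq_eq_sq_iff_abs_eq_abs, hp.vertexValue_left, mul_pow,
    hp.norAt_inner_sq hS, pow_two halfFacet, halfFacet_sq]
  norm_num

theorem abs_vertexValue_le (hS : IsSimple S) {X : Plane} {i : ι} (hi : (S i).IsEndpoint X) :
    |vertexValue S i X| ≤ halfFacet := by
  rcases hS.degree_eq hi with h | h
  · exact (abs_vertexValue_of_degree_two hS h hi).le
  · rw [vertexValue_of_degree_three hS h, abs_zero]; exact halfFacet_pos.le

/-- Two families of tangential components satisfying the balance condition at `X` differ by a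
constant, which is zero at a simple vertex. -/
theorem balance_iff (hS : IsSimple S) {X : Plane} {i₀ : ι} (hi₀ : (S i₀).IsEndpoint X)
    (a : ι → ℝ) :
    (∑ i, ((S i).norAt X + a i • (S i).dirAt X) = 0) ↔
      ∃ α : ℝ, (degree S X = 2 → α = 0) ∧
        ∀ i, (S i).IsEndpoint X → a i = vertexValue S i X + α := by
  have hz : ∀ k, ¬ (S k).IsEndpoint X → (S k).norAt X + a k • (S k).dirAt X = 0 := fun k hk => by
    rw [norAt_eq_zero hk, dirAt_eq_zero hk, smul_zero, add_zero]
  rcases hS.degree_eq hi₀ with h | h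
  · obtain ⟨j₀, hp⟩ := hS.exists_pair hi₀ h
    have hu := (hS.nondegenerate i₀).norm_dirAt hp.left
    have hv := (hS.nondegenerate j₀).norm_dirAt hp.right
    have h2 := inner_rot_sq hu hv hp.inner_eq
    have ha := inner_rot_antisymm ((S j₀).dirAt X) ((S i₀).dirAt X)
    have hbase : rot ((S i₀).dirAt X) + rot ((S j₀).dirAt X) =
        -((2 / 3 * (inner ℝ (rot ((S i₀).dirAt X)) ((S j₀).dirAt X) : ℝ)) • (S i₀).dirAt X +
        (2 / 3 * (inner ℝ (rot ((S j₀).dirAt X)) ((S i₀).dirAt X) : ℝ)) • (S j₀).dirAt X) := by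
      apply ext_two hu hv hp.inner_eq
      · simp only [inner_add_right, inner_neg_right, real_inner_smul_right, inner_rot_self,
          inner_rot_rot, inner_self_unit hu, hp.inner_eq, ha]
        linear_combination (-2 / 3) * h2
      · simp only [inner_add_right, inner_neg_right, real_inner_smul_right, inner_rot_self,
          inner_rot_rot, inner_self_unit hv, hp.symm.inner_eq, ha]
        linear_combination (-2 / 3) * h2
    rw [hp.sum_eq hz]
    have e : (S i₀).norAt X + a i₀ • (S i₀).dirAt X + ((S j₀).norAt X + a j₀ • (S j₀).dirAt X) =
        (a i₀ - vertexValue S i₀ X) • (S i₀).dirAt X +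
          (a j₀ - vertexValue S j₀ X) • (S j₀).dirAt X := by
      rw [hp.vertexValue_left, hp.symm.vertexValue_left]
      simp only [Piece.norAt_eq_rot]
      rw [show ∀ p q r s : Plane, p + q + (r + s) = p + r + (q + s) from fun p q r s => by abel, hbase]
      module
    rw [e]
    constructor
    · intro h0
      have := coeff_eq_zero_two hu hv hp.inner_eq h0
      refine ⟨0, fun _ => rfl, fun k hk => ?_⟩
      rcases hp.only k hk with rfl | rfl <;> linarith
    · rintro ⟨α, hα, hk⟩
      rw [hk _ hp.left, hk _ hp.right, hα h]; simp
  · obtain ⟨j₀, k₀, ht⟩ := hS.exists_triple hi₀ h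
    have hu := (hS.nondegenerate i₀).norm_dirAt ht.first
    have hv := (hS.nondegenerate j₀).norm_dirAt ht.second
    have hs := ht.sum_dirAt hS
    have hn : ∑ l, (S l).norAt X = 0 := by
      simp only [Piece.norAt_eq_rot]
      rw [← rot_sum, hs, rot_zero]
    rw [Finset.sum_add_distrib, hn, zero_add]
    rw [ht.sum_eq (fun k hk => dirAt_eq_zero hk)] at hs
    have h3 : (S k₀).dirAt X = -((S i₀).dirAt X + (S j₀).dirAt X) := by
      rw [eq_neg_iff_add_eq_zero, add_comm]; exact hs
    rw [ht.sum_eq (fun k hk => by rw [dirAt_eq_zero hk, smul_zero])]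
    have e : a i₀ • (S i₀).dirAt X + a j₀ • (S j₀).dirAt X + a k₀ • (S k₀).dirAt X =
        (a i₀ - a k₀) • (S i₀).dirAt X + (a j₀ - a k₀) • (S j₀).dirAt X := by
      rw [h3]; module
    rw [e]
    constructor
    · intro h0
      have := coeff_eq_zero_two hu hv ht.inner_ij h0
      refine ⟨a k₀, fun h' => by omega, fun k hk => ?_⟩
      rw [vertexValue_of_degree_three hS h]
      rcases ht.only k hk with rfl | rfl | rfl <;> linarith
    · rintro ⟨α, hα, hk⟩
      simp only [vertexValue_of_degree_three hS h] at hk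
      rw [hk _ ht.first, hk _ ht.second, hk _ ht.third]; simp

/-! ### Displacements of vertices -/

/-- The displacement of the vertex `X` when the pieces ending there move by the heights `v`. -/
def vertexShift (S : ι → Piece) (v : ι → ℝ) (X : Plane) : Plane :=
  (2 / 3 : ℝ) • (∑ i, ((S i).sgn X * v i) • (S i).norAt X +
    (∑ i, (S i).sgn X * v i) • ∑ i, (S i).norAt X)

theorem inner_vertexShift (hS : IsSimple S) {v : ι → ℝ} {X : Plane}
    (hv : degree S X = 3 → ∑ i, (S i).sgn X * v i = 0) {i : ι} (hi : (S i).IsEndpoint X) :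
    (inner ℝ (vertexShift S v X) (S i).normal : ℝ) = v i := by
  have key : (inner ℝ (vertexShift S v X) (rot ((S i).dirAt X)) : ℝ) = (S i).sgn X * v i := by
    rcases hS.degree_eq hi with h | h
    · obtain ⟨j, hp⟩ := hS.exists_pair hi h
      have hu := (hS.nondegenerate i).norm_dirAt hp.left
      rw [vertexShift, hp.sum_eq (fun k hk => by rw [norAt_eq_zero hk, smul_zero]),
        hp.sum_eq (fun k hk => by rw [Piece.sgn_eq_zero hk, zero_mul]),
        hp.sum_eq (fun k hk => norAt_eq_zero hk)]
      simp only [Piece.norAt_eq_rot, inner_add_left, real_inner_smul_left, inner_rot_rot,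
        inner_self_unit hu, hp.symm.inner_eq]
      ring
    · obtain ⟨j, k, ht⟩ := hS.exists_triple hi h
      have hu := (hS.nondegenerate i).norm_dirAt ht.first
      have h0 := hv h
      rw [vertexShift, h0, zero_smul, add_zero,
        ht.sum_eq (fun k hk => by rw [norAt_eq_zero hk, smul_zero])]
      rw [ht.sum_eq (fun k hk => by rw [Piece.sgn_eq_zero hk, zero_mul])] at h0
      simp only [Piece.norAt_eq_rot, inner_add_left, real_inner_smul_left, inner_rot_rot,
        inner_self_unit hu, real_inner_comm ((S i).dirAt X) ((S j).dirAt X),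
        real_inner_comm ((S i).dirAt X) ((S k).dirAt X), ht.inner_ij, ht.inner_ik]
      linear_combination (-1 / 3) * h0
  have h1 : rot ((S i).dirAt X) = (S i).sgn X • (S i).normal := by
    rw [← Piece.norAt_eq_rot]; rfl
  rw [h1, real_inner_smul_right] at key
  rcases (hS.nondegenerate i).sgn_eq hi with h | h <;> rw [h] at key <;> linarith

theorem eq_vertexShift (hS : IsSimple S) {v : ι → ℝ} {X : Plane}
    (hv : degree S X = 3 → ∑ i, (S i).sgn X * v i = 0) {i₀ : ι} (hi₀ : (S i₀).IsEndpoint X)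
    {D : Plane} (hD : ∀ i, (S i).IsEndpoint X → (inner ℝ D (S i).normal : ℝ) = v i) :
    D = vertexShift S v X := by
  obtain ⟨j, hj, hjX⟩ := hS.network.no_free_end i₀ X hi₀
  have key : ∀ i, (S i).IsEndpoint X → (inner ℝ (rot ((S i).dirAt X)) D : ℝ) =
      inner ℝ (rot ((S i).dirAt X)) (vertexShift S v X) := by
    intro i hi
    rw [← Piece.norAt_eq_rot, Piece.norAt, real_inner_smul_left, real_inner_smul_left,
      real_inner_comm, hD i hi, real_inner_comm, inner_vertexShift hS hv hi]
  exact ext_two ((hS.nondegenerate i₀).norm_dirAt hi₀) ((hS.nondegenerate j).norm_dirAt hjX)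
    (hS.inner_dirAt hj.symm hi₀ hjX) (key _ hi₀) (key _ hjX)

theorem sum_sgn_eq_zero_of_inner (hS : IsSimple S) {v : ι → ℝ} {X : Plane}
    (h : degree S X = 3) {D : Plane}
    (hD : ∀ i, (S i).IsEndpoint X → (inner ℝ D (S i).normal : ℝ) = v i) :
    ∑ i, (S i).sgn X * v i = 0 := by
  have : ∀ i, (S i).sgn X * v i = inner ℝ D ((S i).norAt X) := fun i => by
    by_cases hi : (S i).IsEndpoint X
    · rw [Piece.norAt, real_inner_smul_right, hD i hi]
    · rw [norAt_eq_zero hi, Piece.sgn_eq_zero hi, zero_mul, inner_zero_right]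
  simp only [this]
  rw [← inner_sum]
  have hne : {i | (S i).IsEndpoint X}.Nonempty := by
    rw [Set.nonempty_iff_ne_empty]; intro he
    rw [degree, he, Set.ncard_empty] at h; omega
  obtain ⟨i, hi⟩ := hne
  obtain ⟨j, k, ht⟩ := hS.exists_triple hi h
  simp only [Piece.norAt_eq_rot]
  rw [← rot_sum, ht.sum_dirAt hS, rot_zero, inner_zero_right]

theorem inner_vertexShift_sum_dirAt (S : ι → Piece) (v : ι → ℝ) (X : Plane) :
    (inner ℝ (vertexShift S v X) (∑ i, (S i).dirAt X) : ℝ) =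
      ∑ i, (S i).sgn X * v i * vertexValue S i X := by
  have : ∑ i, (S i).norAt X = rot (∑ i, (S i).dirAt X) := by
    simp only [Piece.norAt_eq_rot]; rw [rot_sum]
  rw [vertexShift, this, real_inner_smul_left, inner_add_left, real_inner_smul_left,
    inner_rot_self, mul_zero, add_zero, sum_inner, Finset.mul_sum]
  apply Finset.sum_congr rfl
  intro i _
  rw [real_inner_smul_left, vertexValue]; ring

namespace Piece

theorem startPt_segment {p : Piece} {L : ℝ} (h : p.extent = .segment L) :
    p.startPt = some p.base := by simp [startPt, h]

theorem endPt_segment {p : Piece} {L : ℝ} (h : p.extent = .segment L) :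
    p.endPt = some (p.point L) := by simp [endPt, h]

theorem dom_segment {p : Piece} {L : ℝ} (h : p.extent = .segment L) :
    p.dom = Icc 0 L := by simp [dom, h]

theorem startPt_outgoing {p : Piece} (h : p.extent = .outgoing) :
    p.startPt = some p.base := by simp [startPt, h]

theorem endPt_outgoing {p : Piece} (h : p.extent = .outgoing) :
    p.endPt = none := by simp [endPt, h]

theorem dom_outgoing {p : Piece} (h : p.extent = .outgoing) :
    p.dom = Ici 0 := by simp [dom, h]

theorem startPt_incoming {p : Piece} (h : p.extent = .incoming) :
    p.startPt = none := by simp [startPt, h]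

theorem endPt_incoming {p : Piece} (h : p.extent = .incoming) :
    p.endPt = some p.base := by simp [endPt, h]

theorem dom_incoming {p : Piece} (h : p.extent = .incoming) :
    p.dom = Iic 0 := by simp [dom, h]

theorem extent_cases (p : Piece) :
    (∃ L, p.extent = .segment L) ∨ p.extent = .outgoing ∨ p.extent = .incoming := by
  cases h : p.extent with
  | segment L => exact Or.inl ⟨L, rfl⟩
  | outgoing => exact Or.inr (Or.inl rfl)
  | incoming => exact Or.inr (Or.inr rfl)

theorem isEndpoint_base (p : Piece) : p.IsEndpoint p.base := by
  rcases p.extent_cases with ⟨L, h⟩ | h | h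
  · exact Or.inl (startPt_segment h)
  · exact Or.inl (startPt_outgoing h)
  · exact Or.inr (endPt_incoming h)

theorem isEndpoint_point {p : Piece} {L : ℝ} (h : p.extent = .segment L) :
    p.IsEndpoint (p.point L) := Or.inr (endPt_segment h)

theorem isEndpoint_segment_iff {p : Piece} {L : ℝ} (h : p.extent = .segment L) {X : Plane} :
    p.IsEndpoint X ↔ X = p.base ∨ X = p.point L := by
  simp [IsEndpoint, startPt_segment h, endPt_segment h, eq_comm]

theorem isEndpoint_halfLine_iff {p : Piece} (h : ¬ p.IsSegment) {X : Plane} :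
    p.IsEndpoint X ↔ X = p.base := by
  rcases p.extent_cases with ⟨L, h'⟩ | h' | h'
  · exact absurd ⟨L, h'⟩ h
  · simp [IsEndpoint, startPt_outgoing h', endPt_outgoing h', eq_comm]
  · simp [IsEndpoint, startPt_incoming h', endPt_incoming h', eq_comm]

theorem convex_dom (p : Piece) : Convex ℝ p.dom := by
  rcases p.extent_cases with ⟨L, h⟩ | h | h
  · rw [dom_segment h]; exact convex_Icc _ _
  · rw [dom_outgoing h]; exact convex_Ici _
  · rw [dom_incoming h]; exact convex_Iic _

theorem ae_mem_interior_dom (p : Piece) :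
    ∀ᵐ s ∂(volume.restrict p.dom), s ∈ interior p.dom := by
  have h := interior_ae_eq_of_null_frontier (p.convex_dom.addHaar_frontier volume)
  rw [← Measure.restrict_congr_set h]
  exact ae_restrict_mem measurableSet_interior

theorem point_mem_carrier {p : Piece} {s : ℝ} (hs : s ∈ p.dom) : p.point s ∈ p.carrier :=
  ⟨s, hs, rfl⟩

theorem Nondegenerate.zero_mem_dom {p : Piece} (hp : p.Nondegenerate) : (0 : ℝ) ∈ p.dom := by
  rcases p.extent_cases with ⟨L, h⟩ | h | h
  · rw [dom_segment h]; exact ⟨le_rfl, (hp.2 L h).le⟩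
  · rw [dom_outgoing h]; exact self_mem_Ici
  · rw [dom_incoming h]; exact self_mem_Iic

theorem Nondegenerate.endpoint_mem_carrier {p : Piece} (hp : p.Nondegenerate) {X : Plane}
    (h : p.IsEndpoint X) : X ∈ p.carrier := by
  have h0 : p.base ∈ p.carrier := by
    rw [← p.point_zero]; exact point_mem_carrier hp.zero_mem_dom
  by_cases hseg : p.IsSegment
  · obtain ⟨L, hL⟩ := hseg
    rcases (isEndpoint_segment_iff hL).1 h with rfl | rfl
    · exact h0
    · apply point_mem_carrier
      rw [dom_segment hL]; exact ⟨(hp.2 L hL).le, le_rfl⟩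
  · rw [(isEndpoint_halfLine_iff hseg).1 h]; exact h0

theorem inner_tangent_normal (p : Piece) : (inner ℝ p.tangent p.normal : ℝ) = 0 :=
  inner_self_rot _

theorem inner_normal_tangent (p : Piece) : (inner ℝ p.normal p.tangent : ℝ) = 0 :=
  inner_rot_self _

theorem point_sub (p : Piece) (s : ℝ) : p.point s - p.base = s • p.tangent := by simp [point]

end Piece

/-! ### Vertices and summation by parts -/

open Classical in
/-- The finite set of endpoints of the pieces of `S`. -/
def vertices (S : ι → Piece) : Finset Plane :=
  Finset.univ.biUnion fun i => (S i).startPt.toFinset ∪ (S i).endPt.toFinset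

theorem mem_vertices {X : Plane} : X ∈ vertices S ↔ ∃ i, (S i).IsEndpoint X := by
  simp [vertices, Piece.IsEndpoint]

theorem mem_vertices_of {i : ι} {X : Plane} (h : (S i).IsEndpoint X) : X ∈ vertices S :=
  mem_vertices.2 ⟨i, h⟩

theorem sum_sgn_smul {M : Type*} [AddCommGroup M] [Module ℝ M] (f : Plane → M) (i : ι) :
    ∑ X ∈ vertices S, (S i).sgn X • f X =
      (S i).startPt.elim 0 f - (S i).endPt.elim 0 f := by
  classical
  have key : ∀ o : Option Plane, (∀ X, o = some X → X ∈ vertices S) →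
      ∑ X ∈ vertices S, (if o = some X then (1 : ℝ) else 0) • f X = o.elim 0 f := by
    intro o ho
    cases o with
    | none => simp
    | some Y =>
      have := ho Y rfl
      simp only [Option.some.injEq, ite_smul, one_smul, zero_smul, Option.elim_some]
      rw [Finset.sum_ite_eq, if_pos this]
  simp only [Piece.sgn, sub_smul, Finset.sum_sub_distrib]
  rw [key _ fun X h => mem_vertices_of (Or.inl h), key _ fun X h => mem_vertices_of (Or.inr h)]

theorem sum_sgn_smul_segment {M : Type*} [AddCommGroup M] [Module ℝ M] (f : Plane → M) {i : ι}
    {L : ℝ} (h : (S i).extent = .segment L) :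
    ∑ X ∈ vertices S, (S i).sgn X • f X = f (S i).base - f ((S i).point L) := by
  rw [sum_sgn_smul, Piece.startPt_segment h, Piece.endPt_segment h]; rfl

/-- Currents without sources at the triple junctions are orthogonal to the differences of
potentials vanishing at the simple vertices. -/
theorem sum_mul_sum_sgn_eq_zero {κ : ι → ℝ} {β : Plane → ℝ}
    (hκ : ∀ X, degree S X = 3 → ∑ i, (S i).sgn X * κ i = 0)
    (hβ : ∀ X ∈ vertices S, degree S X ≠ 3 → β X = 0) :
    ∑ i, κ i * ∑ X ∈ vertices S, (S i).sgn X • β X = 0 := by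
  simp only [Finset.mul_sum]
  rw [Finset.sum_comm]
  apply Finset.sum_eq_zero
  intro X hX
  by_cases h : degree S X = 3
  · have := hκ X h
    calc ∑ i, κ i * ((S i).sgn X • β X) = (∑ i, (S i).sgn X * κ i) * β X := by
          rw [Finset.sum_mul]
          apply Finset.sum_congr rfl
          intro i _
          rw [smul_eq_mul]; ring
      _ = 0 := by rw [this, zero_mul]
  · apply Finset.sum_eq_zero
    intro i _
    rw [hβ X hX h, smul_zero, mul_zero]

/-! ### Cahn-Hoffman fields in coordinates -/

/-- Tangential component along `p` of the field `g`, in the arclength parameter. -/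
def tangentialPart (p : Piece) (g : Plane → Plane) (s : ℝ) : ℝ :=
  inner ℝ (g (p.point s)) p.tangent

theorem tangentialDiv_eq_deriv {p : Piece} (hp : p.Nondegenerate) {g : Plane → Plane}
    (hg : ∀ x ∈ p.carrier, (inner ℝ (g x) p.normal : ℝ) = 1) {s : ℝ} (hs : s ∈ interior p.dom) :
    tangentialDiv p g s = deriv (tangentialPart p g) s := by
  have hev : (fun r => g (p.point r)) =ᶠ[𝓝 s]
      fun r => p.normal + tangentialPart p g r • p.tangent := by
    filter_upwards [mem_interior_iff_mem_nhds.1 hs] with r hr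
    have := plane_decomp hp.1 (g (p.point r))
    have h1 := hg _ (Piece.point_mem_carrier hr)
    rw [Piece.normal] at h1
    rw [h1, one_smul] at this
    rw [this, add_comm]
    simp only [tangentialPart, Piece.normal]
  rw [tangentialDiv]
  by_cases hd : DifferentiableAt ℝ (tangentialPart p g) s
  · rw [hev.deriv_eq, deriv_const_add, deriv_smul_const hd, real_inner_smul_left,
      inner_self_unit hp.1, mul_one]
  · rw [deriv_zero_of_not_differentiableAt hd, deriv_zero_of_not_differentiableAt,
      inner_zero_left]
    intro h
    exact hd (h.inner ℝ (differentiableAt_const _))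

theorem measurable_tangentialDiv (p : Piece) (g : Plane → Plane) :
    Measurable (tangentialDiv p g) := by
  unfold tangentialDiv
  exact (measurable_deriv _).inner measurable_const

theorem IsCHField.inner_normal_eq_one (hS : IsSimple S) {N : ι → Plane → Plane}
    (hN : IsCHField S N) (i : ι) : ∀ x ∈ (S i).carrier, (inner ℝ (N i x) (S i).normal : ℝ) = 1 :=
  fun x hx => ((mem_facet_iff (hS.isHexDir i) _).1
    ⟨hN.phi_eq_one i x hx, hN.inner_normal i x hx⟩).1

theorem Piece.dist_point {p : Piece} (hp : p.Nondegenerate) (s r : ℝ) :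
    dist (p.point s) (p.point r) = dist s r := by
  rw [dist_eq_norm, Piece.point, Piece.point, add_sub_add_left_eq_sub, ← sub_smul, norm_smul, hp.1,
    mul_one, ← dist_eq_norm]

theorem IsCHField.lipschitzOnWith_tangentialPart (hS : IsSimple S) {N : ι → Plane → Plane}
    (hN : IsCHField S N) (i : ι) :
    ∃ K : ℝ≥0, LipschitzOnWith K (tangentialPart (S i) (N i)) (S i).dom := by
  obtain ⟨K, hK⟩ := hN.lipschitz i
  refine ⟨K, LipschitzOnWith.of_dist_le_mul fun x hx y hy => ?_⟩
  have h1 := hK.dist_le_mul _ (Piece.point_mem_carrier hx) _ (Piece.point_mem_carrier hy)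
  rw [Piece.dist_point (hS.nondegenerate i)] at h1
  refine le_trans ?_ h1
  rw [tangentialPart, tangentialPart, Real.dist_eq, ← inner_sub_left, dist_eq_norm]
  exact abs_inner_unit_le (hS.nondegenerate i).1 _

/-- Expansion of the square for the derivative of a Lipschitz function. -/
theorem lintegral_deriv_sq {b : ℝ → ℝ} {K : ℝ≥0} {L κ : ℝ} (hL : 0 < L)
    (hb : LipschitzOnWith K b (Icc 0 L)) :
    ∃ r : ℝ, 0 ≤ r ∧ 0 ≤ r + (2 * κ * (b L - b 0) - κ ^ 2 * L) ∧
      ∫⁻ s in Icc 0 L, ENNReal.ofReal ((deriv b s - κ) ^ 2) = ENNReal.ofReal r ∧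
      ∫⁻ s in Icc 0 L, ENNReal.ofReal (deriv b s ^ 2) =
        ENNReal.ofReal (r + (2 * κ * (b L - b 0) - κ ^ 2 * L)) := by
  have hac : AbsolutelyContinuousOnInterval b 0 L := by
    apply LipschitzOnWith.absolutelyContinuousOnInterval (K := K)
    rwa [uIcc_of_le hL.le]
  have hftc := hac.integral_deriv_eq_sub
  have hint := hac.intervalIntegrable_deriv
  rw [intervalIntegrable_iff_integrableOn_Icc_of_le hL.le] at hint
  rw [intervalIntegral.integral_of_le hL.le, ← integral_Icc_eq_integral_Ioc] at hftc
  have hbd : ∀ᵐ s ∂(volume.restrict (Icc 0 L)), ‖deriv b s‖ ≤ K := by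
    rw [← Measure.restrict_congr_set (Ioo_ae_eq_Icc (μ := (volume : Measure ℝ)))]
    filter_upwards [ae_restrict_mem measurableSet_Ioo] with s hs
    exact norm_deriv_le_of_lipschitzOn (Icc_mem_nhds hs.1 hs.2) hb
  have hsq : ∀ c : ℝ, IntegrableOn (fun s => (deriv b s - c) ^ 2) (Icc 0 L) := by
    intro c
    have hm : Measurable (fun s => (deriv b s - c) ^ 2) := by
      have := measurable_deriv b; fun_prop
    apply Measure.integrableOn_of_bounded (M := ((K : ℝ) + |c|) ^ 2) (by simp)
      hm.aestronglyMeasurable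
    filter_upwards [hbd] with s hs
    rw [norm_pow]
    gcongr
    exact (norm_sub_le _ _).trans (add_le_add hs le_rfl)
  have hs0 := hsq 0
  simp only [sub_zero] at hs0
  have hr : ∫ s in Icc 0 L, deriv b s ^ 2 =
      (∫ s in Icc 0 L, (deriv b s - κ) ^ 2) + (2 * κ * (b L - b 0) - κ ^ 2 * L) := by
    have e : ∀ s, (deriv b s - κ) ^ 2 = deriv b s ^ 2 - (2 * κ * deriv b s - κ ^ 2) := fun s => by
      ring
    have hi2 : IntegrableOn (fun s => 2 * κ * deriv b s) (Icc 0 L) := hint.const_mul _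
    have hi3 : IntegrableOn (fun _ : ℝ => κ ^ 2) (Icc 0 L) := by
      simp
    have hi4 : IntegrableOn (fun s => 2 * κ * deriv b s - κ ^ 2) (Icc 0 L) := hi2.sub hi3
    simp only [e]
    rw [integral_sub hs0 hi4, integral_sub hi2 hi3, integral_const_mul, hftc]
    simp [hL.le]
    ring
  refine ⟨∫ s in Icc 0 L, (deriv b s - κ) ^ 2, integral_nonneg fun s => sq_nonneg _, ?_, ?_, ?_⟩
  · rw [← hr]; exact integral_nonneg fun s => sq_nonneg _
  · rw [ofReal_integral_eq_lintegral_ofReal (hsq κ) (ae_of_all _ fun s => sq_nonneg _)]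
  · rw [← ofReal_integral_eq_lintegral_ofReal hs0 (ae_of_all _ fun s => sq_nonneg _), hr]

/-- Excess of a field over the constant divergence `κ`. -/
def excess (p : Piece) (g : Plane → Plane) (κ : ℝ) : ℝ≥0∞ :=
  ∫⁻ s in p.dom, ENNReal.ofReal ((tangentialDiv p g s - κ) ^ 2)

theorem excess_eq_zero_iff {p : Piece} {g : Plane → Plane} {κ : ℝ} :
    excess p g κ = 0 ↔ ∀ᵐ s ∂(volume.restrict p.dom), tangentialDiv p g s = κ := by
  rw [excess, lintegral_eq_zero_iff]
  · apply eventually_congr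
    filter_upwards with s
    simp only [Pi.zero_apply, ENNReal.ofReal_eq_zero]
    constructor
    · intro h
      have := pow_eq_zero_iff (two_ne_zero) |>.1 (le_antisymm h (sq_nonneg _))
      linarith
    · rintro rfl; simp
  · have := measurable_tangentialDiv p g
    fun_prop

/-- Constant currents `κ` driven by the tangential components `a` at the vertices: the data of a
Cahn-Hoffman field of minimal energy. -/
structure IsEquilibrium (S : ι → Piece) (κ : ι → ℝ) (a : ι → Plane → ℝ) : Prop where
  halfLine : ∀ i, ¬ (S i).IsSegment → κ i = 0
  segment : ∀ i L, (S i).extent = .segment L → κ i * L = a i ((S i).point L) - a i (S i).base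
  bound : ∀ i X, (S i).IsEndpoint X → |a i X| ≤ halfFacet
  balance : ∀ X ∈ vertices S, ∃ α : ℝ, (degree S X = 2 → α = 0) ∧
    ∀ i, (S i).IsEndpoint X → a i X = vertexValue S i X + α
  junction : ∀ X, degree S X = 3 → ∑ i, (S i).sgn X * κ i = 0

namespace IsEquilibrium

variable {κ : ι → ℝ} {a : ι → Plane → ℝ}

/-- The Cahn-Hoffman field with affine tangential components. -/
def affineField (S : ι → Piece) (κ : ι → ℝ) (a : ι → Plane → ℝ) (i : ι) (x : Plane) : Plane :=
  (S i).normal + (a i (S i).base + κ i * inner ℝ (x - (S i).base) (S i).tangent) • (S i).tangent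

theorem affineField_point (hS : IsSimple S) (i : ι) (s : ℝ) :
    affineField S κ a i ((S i).point s) =
      (S i).normal + (a i (S i).base + κ i * s) • (S i).tangent := by
  rw [affineField, Piece.point_sub, real_inner_smul_left,
    inner_self_unit (hS.nondegenerate i).1, mul_one]

theorem tangentialPart_affineField (hS : IsSimple S) (i : ι) (s : ℝ) :
    tangentialPart (S i) (affineField S κ a i) s = a i (S i).base + κ i * s := by
  rw [tangentialPart, affineField_point hS, inner_add_left, real_inner_smul_left,
    inner_self_unit (hS.nondegenerate i).1, Piece.inner_normal_tangent, zero_add, mul_one]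

theorem affineField_endpoint (hS : IsSimple S) (h : IsEquilibrium S κ a) {i : ι} {X : Plane}
    (hX : (S i).IsEndpoint X) :
    affineField S κ a i X = (S i).normal + a i X • (S i).tangent := by
  have h0 : affineField S κ a i (S i).base = (S i).normal + a i (S i).base • (S i).tangent := by
    simp [affineField]
  by_cases hseg : (S i).IsSegment
  · obtain ⟨L, hL⟩ := hseg
    rcases (Piece.isEndpoint_segment_iff hL).1 hX with rfl | rfl
    · exact h0
    · rw [affineField_point hS, h.segment i L hL]; congr 2; ring
  · rw [(Piece.isEndpoint_halfLine_iff hseg).1 hX]; exact h0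

theorem sum_sgn_smul_eq {N : ι → Plane → Plane} {b : ι → ℝ} {X : Plane}
    (hb : ∀ i, (S i).IsEndpoint X → N i X = (S i).normal + b i • (S i).tangent) :
    (∑ i, (S i).sgn X • N i X) = ∑ i, ((S i).norAt X + b i • (S i).dirAt X) := by
  apply Finset.sum_congr rfl
  intro i _
  by_cases hi : (S i).IsEndpoint X
  · rw [hb i hi, Piece.norAt, Piece.dirAt, smul_add, smul_comm]
  · rw [Piece.sgn_eq_zero hi, norAt_eq_zero hi, dirAt_eq_zero hi]; simp

theorem sum_balance_eq (N : ι → Plane → Plane) (X : Plane) [∀ p : Prop, Decidable p] :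
    ∑ i, ((if (S i).startPt = some X then N i X else 0)
      - (if (S i).endPt = some X then N i X else 0)) = ∑ i, (S i).sgn X • N i X := by
  apply Finset.sum_congr rfl
  intro i _
  rw [Piece.sgn, sub_smul, ite_smul, ite_smul, one_smul, zero_smul]
  congr 1 <;> congr 1

theorem abs_affine_le (hS : IsSimple S) (h : IsEquilibrium S κ a) {i : ι} {s : ℝ}
    (hs : s ∈ (S i).dom) : |a i (S i).base + κ i * s| ≤ halfFacet := by
  have h0 := h.bound i _ (S i).isEndpoint_base
  by_cases hseg : (S i).IsSegment
  · obtain ⟨L, hL⟩ := hseg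
    have h1 := h.bound i _ (Piece.isEndpoint_point hL)
    have hLpos := (hS.nondegenerate i).2 L hL
    rw [Piece.dom_segment hL] at hs
    have h2 := h.segment i L hL
    have e : a i (S i).base + κ i * s =
        (1 - s / L) * a i (S i).base + (s / L) * a i ((S i).point L) := by
      field_simp; linear_combination s * h2
    rw [e, abs_le] at *
    have hs1 : 0 ≤ s / L := div_nonneg hs.1 hLpos.le
    have hs2 : s / L ≤ 1 := (div_le_one hLpos).2 hs.2
    constructor <;> nlinarith
  · rw [h.halfLine i hseg, zero_mul, add_zero]; exact h0

theorem isCHField_affineField (hS : IsSimple S) (h : IsEquilibrium S κ a) :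
    IsCHField S (affineField S κ a) := by
  have hfacet : ∀ i, ∀ x ∈ (S i).carrier, phi (affineField S κ a i x) = 1 ∧
      (inner ℝ (affineField S κ a i x) (S i).normal : ℝ) = phiDual (S i).normal := by
    rintro i _ ⟨s, hs, rfl⟩
    apply (mem_facet_iff (hS.isHexDir i) _).2
    have e := tangentialPart_affineField (κ := κ) (a := a) hS i s
    rw [tangentialPart] at e
    refine ⟨?_, by rw [e]; exact h.abs_affine_le hS hs⟩
    rw [affineField_point hS, inner_add_left, real_inner_smul_left]
    simp only [Piece.normal]
    rw [inner_self_rot, inner_rot_rot, inner_self_unit (hS.nondegenerate i).1]; ring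
  refine ⟨fun i => ⟨‖κ i‖₊, ?_⟩, fun i x hx => (hfacet i x hx).1, fun i x hx => (hfacet i x hx).2,
    fun X => ?_⟩
  · apply LipschitzWith.lipschitzOnWith
    apply LipschitzWith.of_dist_le_mul
    intro x y
    rw [dist_eq_norm, affineField, affineField, add_sub_add_left_eq_sub, ← sub_smul,
      add_sub_add_left_eq_sub, ← mul_sub, ← inner_sub_left, sub_sub_sub_cancel_right, norm_smul,
      (hS.nondegenerate i).1, mul_one, norm_mul, dist_eq_norm]
    exact mul_le_mul_of_nonneg_left (abs_inner_unit_le (hS.nondegenerate i).1 _) (norm_nonneg _)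
  · classical
    have := sum_balance_eq (S := S) (affineField S κ a) X
    convert this using 1
    · apply Finset.sum_congr rfl; intro i _; congr
    · rw [sum_sgn_smul_eq (b := fun i => a i X) fun i hi => h.affineField_endpoint hS hi]
      by_cases hX : X ∈ vertices S
      · obtain ⟨i₀, hi₀⟩ := mem_vertices.1 hX
        exact ((balance_iff hS hi₀ _).2 (h.balance X hX)).symm
      · symm
        apply Finset.sum_eq_zero
        intro i _
        have : ¬ (S i).IsEndpoint X := fun hi => hX (mem_vertices_of hi)
        rw [norAt_eq_zero this, dirAt_eq_zero this, smul_zero, add_zero]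

theorem excess_affineField (hS : IsSimple S) (h : IsEquilibrium S κ a) (i : ι) :
    excess (S i) (affineField S κ a i) (κ i) = 0 := by
  rw [excess_eq_zero_iff]
  filter_upwards [(S i).ae_mem_interior_dom] with s hs
  rw [tangentialDiv_eq_deriv (hS.nondegenerate i)
    ((h.isCHField_affineField hS).inner_normal_eq_one hS i) hs]
  have : tangentialPart (S i) (affineField S κ a i) = fun s => a i (S i).base + κ i * s :=
    funext fun s => tangentialPart_affineField hS i s
  rw [this, deriv_const_add, deriv_const_mul _ differentiableAt_id]
  simp

theorem exists_potential_sub (hS : IsSimple S) (h : IsEquilibrium S κ a)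
    {N : ι → Plane → Plane} (hN : IsCHField S N) :
    ∃ β : Plane → ℝ, (∀ X ∈ vertices S, degree S X ≠ 3 → β X = 0) ∧
      ∀ i X, (S i).IsEndpoint X → (inner ℝ (N i X) (S i).tangent : ℝ) - a i X = β X := by
  have key : ∀ X, ∃ β : ℝ, (X ∈ vertices S → degree S X ≠ 3 → β = 0) ∧
      ∀ i, (S i).IsEndpoint X → (inner ℝ (N i X) (S i).tangent : ℝ) - a i X = β := by
    intro X
    by_cases hX : X ∈ vertices S
    · obtain ⟨i₀, hi₀⟩ := mem_vertices.1 hX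
      obtain ⟨α, hα, ha⟩ := h.balance X hX
      have hb : ∑ i, ((S i).norAt X +
          (inner ℝ (N i X) (S i).tangent : ℝ) • (S i).dirAt X) = 0 := by
        rw [← sum_sgn_smul_eq (N := N)]
        · classical
          rw [← sum_balance_eq]
          convert hN.balance X
        · intro i hi
          have h1 := hN.inner_normal_eq_one hS i X
            ((hS.nondegenerate i).endpoint_mem_carrier hi)
          have := plane_decomp (hS.nondegenerate i).1 (N i X)
          rw [Piece.normal] at *
          rw [h1, one_smul] at this
          rw [add_comm]; exact this
      obtain ⟨α', hα', ha'⟩ := (balance_iff hS hi₀ _).1 hb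
      refine ⟨α' - α, fun _ h3 => ?_, fun i hi => by rw [ha' i hi, ha i hi]; ring⟩
      have h2 := (hS.degree_eq hi₀).resolve_right h3
      rw [hα h2, hα' h2, sub_zero]
    · exact ⟨0, fun h => absurd h hX, fun i hi => absurd (mem_vertices_of hi) hX⟩
  choose β h1 h2 using key
  exact ⟨β, fun X hX => h1 X hX, fun i X => h2 X i⟩

/-- Pythagoras: the energy of a Cahn-Hoffman field exceeds the energy of the equilibrium exactly by
the squared distance. -/
theorem exists_energy_eq (hS : IsSimple S) (h : IsEquilibrium S κ a) :
    ∃ E : ℝ, ∀ N, IsCHField S N →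
      energy S N = ∑ i, excess (S i) (N i) (κ i) + ENNReal.ofReal E := by
  classical
  let len : ι → ℝ := fun i => match (S i).extent with
    | .segment L => L
    | _ => 0
  refine ⟨∑ i, κ i ^ 2 * len i, fun N hN => ?_⟩
  have hE : 0 ≤ ∑ i, κ i ^ 2 * len i := by
    apply Finset.sum_nonneg
    intro i _
    apply mul_nonneg (sq_nonneg _)
    rcases (S i).extent_cases with ⟨L, hL⟩ | hL | hL
    · simp only [len, hL]; exact ((hS.nondegenerate i).2 L hL).le
    · simp only [len, hL]; exact le_rfl
    · simp only [len, hL]; exact le_rfl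
  obtain ⟨β, hβ0, hβ⟩ := h.exists_potential_sub hS hN
  let δ : ι → ℝ := fun i => κ i ^ 2 * len i - 2 * (κ i * ∑ X ∈ vertices S, (S i).sgn X • β X)
  have hδ : ∑ i, δ i = ∑ i, κ i ^ 2 * len i := by
    simp only [δ]
    rw [Finset.sum_sub_distrib, ← Finset.mul_sum, sum_mul_sum_sgn_eq_zero h.junction hβ0]
    ring
  have key : ∀ i, (∫⁻ s in (S i).dom,
      ENNReal.ofReal ((tangentialDiv (S i) (N i) s) ^ 2 * phiDual (S i).normal)) +
        ENNReal.ofReal |δ i| = excess (S i) (N i) (κ i) + ENNReal.ofReal (|δ i| + δ i) := by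
    intro i
    have hdual : phiDual (S i).normal = 1 := phiDual_rot (hS.isHexDir i)
    simp only [hdual, mul_one]
    by_cases hseg : (S i).IsSegment
    · obtain ⟨L, hL⟩ := hseg
      obtain ⟨K, hK⟩ := hN.lipschitzOnWith_tangentialPart hS i
      rw [Piece.dom_segment hL] at hK
      obtain ⟨r, hr0, hx, hr1, hr2⟩ := lintegral_deriv_sq (κ := κ i) ((hS.nondegenerate i).2 L hL) hK
      have hcongr : ∀ f : ℝ → ℝ≥0∞, ∫⁻ s in (S i).dom, f (tangentialDiv (S i) (N i) s) =
          ∫⁻ s in Icc 0 L, f (deriv (tangentialPart (S i) (N i)) s) := by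
        intro f
        rw [← Piece.dom_segment hL]
        apply lintegral_congr_ae
        filter_upwards [(S i).ae_mem_interior_dom] with s hs
        rw [tangentialDiv_eq_deriv (hS.nondegenerate i) (hN.inner_normal_eq_one hS i) hs]
      rw [excess, hcongr fun x => ENNReal.ofReal (x ^ 2),
        hcongr fun x => ENNReal.ofReal ((x - κ i) ^ 2), hr1, hr2]
      have e : 2 * κ i * (tangentialPart (S i) (N i) L - tangentialPart (S i) (N i) 0) -
          κ i ^ 2 * L = δ i := by
        simp only [δ, len, hL]
        rw [sum_sgn_smul_segment β hL, ← hβ i _ (S i).isEndpoint_base,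
          ← hβ i _ (Piece.isEndpoint_point hL)]
        simp only [tangentialPart, Piece.point_zero]
        have := h.segment i L hL
        linear_combination (-2 * κ i) * this
      rw [e] at hx ⊢
      rw [← ENNReal.ofReal_add hx (abs_nonneg _), ← ENNReal.ofReal_add hr0
        (by linarith [neg_abs_le (δ i)])]
      congr 1; ring
    · have h0 := h.halfLine i hseg
      have : δ i = 0 := by simp only [δ, h0]; ring
      rw [this, excess, h0]; simp
  have hsum : energy S N + ENNReal.ofReal (∑ i, |δ i|) =
      ∑ i, excess (S i) (N i) (κ i) + ENNReal.ofReal (∑ i, κ i ^ 2 * len i) +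
        ENNReal.ofReal (∑ i, |δ i|) := by
    rw [energy, ENNReal.ofReal_sum_of_nonneg fun i _ => abs_nonneg (δ i),
      ← Finset.sum_add_distrib, Finset.sum_congr rfl fun i _ => key i, Finset.sum_add_distrib,
      ← ENNReal.ofReal_sum_of_nonneg fun i _ => by linarith [neg_abs_le (δ i)],
      Finset.sum_add_distrib, hδ, add_assoc, ENNReal.ofReal_add
        (Finset.sum_nonneg fun i _ => abs_nonneg _) hE,
      ENNReal.ofReal_sum_of_nonneg fun i _ => abs_nonneg (δ i)]
    congr 1
    exact add_comm _ _
  exact (ENNReal.add_left_inj ENNReal.ofReal_ne_top).1 hsum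

theorem isMinimalCHField (hS : IsSimple S) (h : IsEquilibrium S κ a) :
    IsMinimalCHField S (affineField S κ a) := by
  obtain ⟨E, hE⟩ := h.exists_energy_eq hS
  refine ⟨h.isCHField_affineField hS, fun N' hN' => ?_⟩
  rw [hE _ (h.isCHField_affineField hS), hE _ hN']
  simp [h.excess_affineField hS]

/-- The equilibrium currents are the crystalline curvatures. -/
theorem hasPhiCurvature (hS : IsSimple S) (h : IsEquilibrium S κ a) (i : ι) :
    HasPhiCurvature S i (κ i) := by
  refine ⟨⟨_, h.isMinimalCHField hS⟩, fun N hN => ?_⟩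
  obtain ⟨E, hE⟩ := h.exists_energy_eq hS
  have h1 := hN.minimal _ (h.isCHField_affineField hS)
  rw [hE _ (h.isCHField_affineField hS), hE _ hN.field] at h1
  simp only [h.excess_affineField hS, Finset.sum_const_zero, zero_add] at h1
  have h2 : ∑ i, excess (S i) (N i) (κ i) = 0 := by
    by_contra hne
    have : ENNReal.ofReal E < ∑ i, excess (S i) (N i) (κ i) + ENNReal.ofReal E :=
      lt_of_lt_of_eq (ENNReal.lt_add_right ENNReal.ofReal_ne_top hne) (add_comm _ _)
    exact absurd h1 (not_le.2 this)
  rw [← excess_eq_zero_iff]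
  exact (Finset.sum_eq_zero_iff.1 h2) i (Finset.mem_univ i)

end IsEquilibrium

theorem HasPhiCurvature.unique {S : ι → Piece} {i : ι} {κ κ' : ℝ} (hp : (S i).Nondegenerate)
    (h : HasPhiCurvature S i κ) (h' : HasPhiCurvature S i κ') : κ = κ' := by
  obtain ⟨N, hN⟩ := h.1
  have hne : (volume.restrict (S i).dom) ≠ 0 := by
    rw [Ne, Measure.restrict_eq_zero]
    rcases (S i).extent_cases with ⟨L, hL⟩ | hL | hL
    · rw [Piece.dom_segment hL, Real.volume_Icc]
      simpa using hp.2 L hL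
    · rw [Piece.dom_outgoing hL]; simp
    · rw [Piece.dom_incoming hL]; simp
  have : (ae (volume.restrict (S i).dom)).NeBot := ae_neBot.2 hne
  obtain ⟨s, hs1, hs2⟩ := ((h.2 N hN).and (h'.2 N hN)).exists
  rw [← hs1, hs2]

/-! ### The space of heights and the deformed networks -/

theorem vertexShift_add (S : ι → Piece) (v w : ι → ℝ) (X : Plane) :
    vertexShift S (v + w) X = vertexShift S v X + vertexShift S w X := by
  simp only [vertexShift, Pi.add_apply, mul_add, add_smul, Finset.sum_add_distrib, smul_add]
  abel

theorem vertexShift_smul (S : ι → Piece) (r : ℝ) (v : ι → ℝ) (X : Plane) :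
    vertexShift S (r • v) X = r • vertexShift S v X := by
  have h1 : ∑ i, ((S i).sgn X * (r * v i)) • (S i).norAt X =
      r • ∑ i, ((S i).sgn X * v i) • (S i).norAt X := by
    rw [Finset.smul_sum]
    apply Finset.sum_congr rfl
    intro i _
    rw [smul_smul]; congr 1; ring
  have h2 : ∑ i, (S i).sgn X * (r * v i) = r * ∑ i, (S i).sgn X * v i := by
    rw [Finset.mul_sum]
    apply Finset.sum_congr rfl
    intro i _
    ring
  simp only [vertexShift, Pi.smul_apply, smul_eq_mul, h1, h2]
  module

/-- The displacement of a vertex as a linear map. -/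
def vertexShiftLin (S : ι → Piece) (X : Plane) : (ι → ℝ) →ₗ[ℝ] Plane where
  toFun v := vertexShift S v X
  map_add' v w := vertexShift_add S v w X
  map_smul' r v := vertexShift_smul S r v X

theorem vertexShift_zero (S : ι → Piece) (X : Plane) : vertexShift S 0 X = 0 :=
  (vertexShiftLin S X).map_zero

theorem continuous_vertexShift (S : ι → Piece) (X : Plane) :
    Continuous fun v => vertexShift S v X :=
  (vertexShiftLin S X).continuous_of_finiteDimensional

/-- Heights of the networks parallel to `S`. -/
def heightSpace (S : ι → Piece) : Submodule ℝ (ι → ℝ) where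
  carrier := {v | (∀ i, ¬ (S i).IsSegment → v i = 0) ∧
    ∀ X, degree S X = 3 → ∑ i, (S i).sgn X * v i = 0}
  add_mem' := by
    rintro v w ⟨hv1, hv2⟩ ⟨hw1, hw2⟩
    refine ⟨fun i hi => by rw [Pi.add_apply, hv1 i hi, hw1 i hi, add_zero], fun X hX => ?_⟩
    simp only [Pi.add_apply, mul_add, Finset.sum_add_distrib, hv2 X hX, hw2 X hX, add_zero]
  zero_mem' := by simp
  smul_mem' := by
    rintro r v ⟨hv1, hv2⟩
    refine ⟨fun i hi => by rw [Pi.smul_apply, hv1 i hi, smul_zero], fun X hX => ?_⟩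
    have : ∑ i, (S i).sgn X * (r • v) i = r * ∑ i, (S i).sgn X * v i := by
      rw [Finset.mul_sum]
      apply Finset.sum_congr rfl
      intro i _
      simp only [Pi.smul_apply, smul_eq_mul]; ring
    rw [this, hv2 X hX, mul_zero]

theorem inner_vertexShift_of_mem (hS : IsSimple S) {v : ι → ℝ} (hv : v ∈ heightSpace S) {i : ι}
    {X : Plane} (hi : (S i).IsEndpoint X) :
    (inner ℝ (vertexShift S v X) (S i).normal : ℝ) = v i :=
  inner_vertexShift hS (hv.2 X) hi

/-- The new position of the vertex `X`. -/
def movedVertex (S : ι → Piece) (v : ι → ℝ) (X : Plane) : Plane := X + vertexShift S v X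

theorem continuous_movedVertex (S : ι → Piece) (X : Plane) :
    Continuous fun v => movedVertex S v X :=
  continuous_const.add (continuous_vertexShift S X)

/-- The length of the piece `i` of the network with heights `v` (zero for half-lines). -/
def deformedLength (S : ι → Piece) (v : ι → ℝ) (i : ι) : ℝ :=
  match (S i).extent with
  | .segment L => L + inner ℝ (vertexShift S v ((S i).point L) - vertexShift S v (S i).base)
      (S i).tangent
  | .outgoing => 0
  | .incoming => 0

theorem deformedLength_segment {i : ι} {L : ℝ} (h : (S i).extent = .segment L) (v : ι → ℝ) :
    deformedLength S v i = L + inner ℝ (vertexShift S v ((S i).point L) -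
      vertexShift S v (S i).base) (S i).tangent := by
  simp [deformedLength, h]

theorem deformedLength_halfLine {i : ι} (h : ¬ (S i).IsSegment) (v : ι → ℝ) :
    deformedLength S v i = 0 := by
  rcases (S i).extent_cases with ⟨L, h'⟩ | h' | h'
  · exact absurd ⟨L, h'⟩ h
  · simp [deformedLength, h']
  · simp [deformedLength, h']

theorem continuous_deformedLength (S : ι → Piece) (i : ι) :
    Continuous fun v => deformedLength S v i := by
  by_cases h : (S i).IsSegment
  · obtain ⟨L, h⟩ := h
    simp only [deformedLength_segment h]
    exact continuous_const.add
      (((continuous_vertexShift S _).sub (continuous_vertexShift S _)).inner continuous_const)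
  · simp only [deformedLength_halfLine h]; exact continuous_const

/-- The network parallel to `S` with heights `v`. -/
def deform (S : ι → Piece) (v : ι → ℝ) (i : ι) : Piece where
  base := movedVertex S v (S i).base
  tangent := (S i).tangent
  extent :=
    match (S i).extent with
    | .segment _ => .segment (deformedLength S v i)
    | .outgoing => .outgoing
    | .incoming => .incoming

theorem deform_segment {i : ι} {L : ℝ} (h : (S i).extent = .segment L) (v : ι → ℝ) :
    (deform S v i).extent = .segment (deformedLength S v i) := by simp [deform, h]

theorem deform_outgoing {i : ι} (h : (S i).extent = .outgoing) (v : ι → ℝ) :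
    (deform S v i).extent = .outgoing := by simp [deform, h]

theorem deform_incoming {i : ι} (h : (S i).extent = .incoming) (v : ι → ℝ) :
    (deform S v i).extent = .incoming := by simp [deform, h]

theorem deform_isSegment_iff {i : ι} {v : ι → ℝ} :
    (deform S v i).IsSegment ↔ (S i).IsSegment := by
  rcases (S i).extent_cases with ⟨L, h⟩ | h | h
  · exact ⟨fun _ => ⟨L, h⟩, fun _ => ⟨_, deform_segment h v⟩⟩
  · simp [Piece.IsSegment, deform_outgoing h, h]
  · simp [Piece.IsSegment, deform_incoming h, h]

theorem deform_normal (S : ι → Piece) (v : ι → ℝ) (i : ι) :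
    (deform S v i).normal = (S i).normal := rfl

theorem deform_zero (S : ι → Piece) : deform S 0 = S := by
  funext i
  have h1 : movedVertex S 0 (S i).base = (S i).base := by
    rw [movedVertex, vertexShift_zero, add_zero]
  have h2 : (deform S 0 i).extent = (S i).extent := by
    rcases (S i).extent_cases with ⟨L, h⟩ | h | h
    · rw [deform_segment h, deformedLength_segment h, vertexShift_zero, vertexShift_zero, sub_zero,
        inner_zero_left, add_zero, h]
    · rw [deform_outgoing h, h]
    · rw [deform_incoming h, h]
  change Piece.mk _ _ (deform S 0 i).extent = S i
  rw [h1, h2]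

theorem height_deform (hS : IsSimple S) {v : ι → ℝ} (hv : v ∈ heightSpace S) (i : ι) :
    (S i).height (deform S v i) = v i := by
  rw [Piece.height]
  change inner ℝ ((S i).base + vertexShift S v (S i).base - (S i).base) _ = _
  rw [add_sub_cancel_left]
  exact inner_vertexShift_of_mem hS hv (S i).isEndpoint_base

theorem startPt_deform (S : ι → Piece) (v : ι → ℝ) (i : ι) :
    (deform S v i).startPt = (S i).startPt.map (movedVertex S v) := by
  rcases (S i).extent_cases with ⟨L, h⟩ | h | h
  · rw [Piece.startPt_segment h, Piece.startPt_segment (deform_segment h v)]; rfl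
  · rw [Piece.startPt_outgoing h, Piece.startPt_outgoing (deform_outgoing h v)]; rfl
  · rw [Piece.startPt_incoming h, Piece.startPt_incoming (deform_incoming h v)]; rfl

theorem deform_point (hS : IsSimple S) {v : ι → ℝ} (hv : v ∈ heightSpace S) {i : ι} {L : ℝ}
    (h : (S i).extent = .segment L) :
    (deform S v i).point (deformedLength S v i) = movedVertex S v ((S i).point L) := by
  have hu := (hS.nondegenerate i).1
  have h1 := inner_vertexShift_of_mem hS hv (S i).isEndpoint_base
  have h2 := inner_vertexShift_of_mem hS hv (Piece.isEndpoint_point h)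
  rw [deformedLength_segment h, Piece.point]
  change (S i).base + vertexShift S v (S i).base + _ • (S i).tangent = _
  have h3 := plane_decomp hu (vertexShift S v ((S i).point L) - vertexShift S v (S i).base)
  have h4 : (inner ℝ (vertexShift S v ((S i).point L) - vertexShift S v (S i).base)
      (rot (S i).tangent) : ℝ) = 0 := by
    rw [inner_sub_left]; change inner ℝ _ (S i).normal - inner ℝ _ (S i).normal = _
    rw [h1, h2, sub_self]
  rw [h4, zero_smul, add_zero] at h3
  rw [movedVertex, add_smul, ← h3]
  simp only [Piece.point]
  abel

theorem endPt_deform (hS : IsSimple S) {v : ι → ℝ} (hv : v ∈ heightSpace S) (i : ι) :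
    (deform S v i).endPt = (S i).endPt.map (movedVertex S v) := by
  rcases (S i).extent_cases with ⟨L, h⟩ | h | h
  · rw [Piece.endPt_segment h, Piece.endPt_segment (deform_segment h v), deform_point hS hv h]; rfl
  · rw [Piece.endPt_outgoing h, Piece.endPt_outgoing (deform_outgoing h v)]; rfl
  · rw [Piece.endPt_incoming h, Piece.endPt_incoming (deform_incoming h v)]; rfl

theorem isEndpoint_deform_iff (hS : IsSimple S) {v : ι → ℝ} (hv : v ∈ heightSpace S) {i : ι}
    {Y : Plane} :
    (deform S v i).IsEndpoint Y ↔ ∃ X, (S i).IsEndpoint X ∧ movedVertex S v X = Y := by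
  simp only [Piece.IsEndpoint, startPt_deform, endPt_deform hS hv, Option.map_eq_some_iff]
  constructor
  · rintro (⟨X, h1, h2⟩ | ⟨X, h1, h2⟩)
    · exact ⟨X, Or.inl h1, h2⟩
    · exact ⟨X, Or.inr h1, h2⟩
  · rintro ⟨X, h1 | h1, h2⟩
    · exact Or.inl ⟨X, h1, h2⟩
    · exact Or.inr ⟨X, h1, h2⟩

theorem bounded_symmDiff_deform (hS : IsSimple S) {v : ι → ℝ} (hv : v ∈ heightSpace S) {i : ι}
    (hi : ¬ (S i).IsSegment) :
    Bornology.IsBounded (symmDiff (S i).carrier (deform S v i).carrier) := by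
  have hu := (hS.nondegenerate i).1
  have h0 := inner_vertexShift_of_mem hS hv (S i).isEndpoint_base
  rw [hv.1 i hi, Piece.normal] at h0
  have hd := plane_decomp hu (vertexShift S v (S i).base)
  rw [h0, zero_smul, add_zero] at hd
  set r := (inner ℝ (vertexShift S v (S i).base) (S i).tangent : ℝ)
  have hpt : ∀ s, (deform S v i).point s = (S i).point (s + r) := by
    intro s
    change (S i).base + vertexShift S v (S i).base + s • (S i).tangent = _
    rw [hd, Piece.point, add_smul]; abel
  have hsub : symmDiff (S i).carrier (deform S v i).carrier ⊆ (S i).point '' Icc (-|r|) |r| := by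
    have hr1 := neg_abs_le r
    have hr2 := le_abs_self r
    rcases (S i).extent_cases with ⟨L, h⟩ | h | h
    · exact absurd ⟨L, h⟩ hi
    · rintro x (⟨⟨s, hs, rfl⟩, h2⟩ | ⟨⟨s, hs, rfl⟩, h2⟩)
      · rw [Piece.dom_outgoing h, mem_Ici] at hs
        refine ⟨s, ⟨by linarith [abs_nonneg r], ?_⟩, rfl⟩
        by_contra hlt
        push Not at hlt
        apply h2
        refine ⟨s - r, ?_, by rw [hpt]; congr 1; ring⟩
        rw [Piece.dom_outgoing (deform_outgoing h v), mem_Ici]; linarith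
      · rw [Piece.dom_outgoing (deform_outgoing h v), mem_Ici] at hs
        rw [hpt] at h2 ⊢
        refine ⟨s + r, ⟨by linarith, ?_⟩, rfl⟩
        by_contra hlt
        push Not at hlt
        apply h2
        exact ⟨s + r, by rw [Piece.dom_outgoing h, mem_Ici]; linarith [abs_nonneg r], rfl⟩
    · rintro x (⟨⟨s, hs, rfl⟩, h2⟩ | ⟨⟨s, hs, rfl⟩, h2⟩)
      · rw [Piece.dom_incoming h, mem_Iic] at hs
        refine ⟨s, ⟨?_, by linarith [abs_nonneg r]⟩, rfl⟩
        by_contra hlt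
        push Not at hlt
        apply h2
        refine ⟨s - r, ?_, by rw [hpt]; congr 1; ring⟩
        rw [Piece.dom_incoming (deform_incoming h v), mem_Iic]; linarith
      · rw [Piece.dom_incoming (deform_incoming h v), mem_Iic] at hs
        rw [hpt] at h2 ⊢
        refine ⟨s + r, ⟨?_, by linarith⟩, rfl⟩
        by_contra hlt
        push Not at hlt
        apply h2
        exact ⟨s + r, by rw [Piece.dom_incoming h, mem_Iic]; linarith [abs_nonneg r], rfl⟩
  refine Bornology.IsBounded.subset ?_ hsub
  apply IsCompact.isBounded
  apply isCompact_Icc.image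
  unfold Piece.point
  fun_prop

theorem isParallel_deform (hS : IsSimple S) {v : ι → ℝ} (hv : v ∈ heightSpace S) :
    IsParallel S (deform S v) := by
  refine ⟨fun i => rfl, fun i => ?_, fun i hi => bounded_symmDiff_deform hS hv hi, ?_, ?_, ?_⟩
  · rcases (S i).extent_cases with ⟨L, h⟩ | h | h
    · simp [Piece.SameKind, h, deform_segment h v]
    · simp [Piece.SameKind, h, deform_outgoing h v]
    · simp [Piece.SameKind, h, deform_incoming h v]
  · intro i j X hi hj
    rw [startPt_deform, startPt_deform, hi, hj]
  · intro i j X hi hj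
    rw [startPt_deform, endPt_deform hS hv, hi, hj]
  · intro i j X hi hj
    rw [endPt_deform hS hv, endPt_deform hS hv, hi, hj]

/-! ### Parallel networks are deformed networks -/

section Parallel

variable {T : ι → Piece}

theorem Piece.extent_of_sameKind_segment {p q : Piece} {L : ℝ} (h : p.SameKind q)
    (hp : p.extent = .segment L) : ∃ L', q.extent = .segment L' := by
  rcases q.extent_cases with ⟨L, hq⟩ | hq | hq
  · exact ⟨L, hq⟩
  · simp [SameKind, hp, hq] at h
  · simp [SameKind, hp, hq] at h

theorem Piece.extent_of_sameKind_outgoing {p q : Piece} (h : p.SameKind q)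
    (hp : p.extent = .outgoing) : q.extent = .outgoing := by
  rcases q.extent_cases with ⟨L, hq⟩ | hq | hq
  · simp [SameKind, hp, hq] at h
  · exact hq
  · simp [SameKind, hp, hq] at h

theorem Piece.extent_of_sameKind_incoming {p q : Piece} (h : p.SameKind q)
    (hp : p.extent = .incoming) : q.extent = .incoming := by
  rcases q.extent_cases with ⟨L, hq⟩ | hq | hq
  · simp [SameKind, hp, hq] at h
  · simp [SameKind, hp, hq] at h
  · exact hq

theorem Piece.not_isBounded_carrier {p : Piece} (hp : p.Nondegenerate) (h : ¬ p.IsSegment) :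
    ¬ Bornology.IsBounded p.carrier := by
  intro hb
  obtain ⟨R, hR⟩ := hb.subset_closedBall p.base
  have key : ∀ s ∈ p.dom, |s| ≤ R := by
    intro s hs
    have := hR (point_mem_carrier hs)
    rw [Metric.mem_closedBall, ← p.point_zero, Piece.dist_point hp, Real.dist_eq, sub_zero] at this
    exact this
  rcases p.extent_cases with ⟨L, h'⟩ | h' | h'
  · exact h ⟨L, h'⟩
  · have := key (|R| + 1) (by rw [dom_outgoing h', mem_Ici]; positivity)
    rw [abs_of_pos (by positivity)] at this
    linarith [le_abs_self R]
  · have := key (-(|R| + 1)) (by rw [dom_incoming h', mem_Iic]; linarith [abs_nonneg R])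
    rw [abs_neg, abs_of_pos (by positivity)] at this
    linarith [le_abs_self R]

theorem IsParallel.height_eq_zero (hS : IsSimple S) (h : IsParallel S T) {i : ι}
    (hi : ¬ (S i).IsSegment) : (S i).height (T i) = 0 := by
  by_contra hne
  have hp := hS.nondegenerate i
  apply Piece.not_isBounded_carrier hp hi
  refine (h.half_line i hi).subset ?_
  rintro x ⟨s, hs, rfl⟩
  refine Or.inl ⟨⟨s, hs, rfl⟩, ?_⟩
  rintro ⟨r, -, hr⟩
  apply hne
  have : (T i).base - (S i).base = (s - r) • (S i).tangent := by
    rw [Piece.point, Piece.point, h.tangent_eq] at hr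
    rw [sub_smul]
    have := congrArg (fun x => x - (S i).base - r • (S i).tangent) hr
    beta_reduce at this
    rw [show (T i).base - (S i).base = (T i).base + r • (S i).tangent - (S i).base -
      r • (S i).tangent by abel, this]
    abel
  rw [Piece.height, this, real_inner_smul_left, Piece.inner_tangent_normal, mul_zero]

/-- The endpoint of `T i` corresponding to the endpoint `X` of `S i`. -/
theorem IsParallel.exists_vertex (h : IsParallel S T) (X : Plane) :
    ∃ Y, ∀ i, ((S i).startPt = some X → (T i).startPt = some Y) ∧
      ((S i).endPt = some X → (T i).endPt = some Y) := by
  have hs : ∀ i, (S i).startPt = some X → ∃ Y, (T i).startPt = some Y := by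
    intro i hi
    rcases (S i).extent_cases with ⟨L, hL⟩ | hL | hL
    · obtain ⟨L', hL'⟩ := Piece.extent_of_sameKind_segment (h.same_kind i) hL
      exact ⟨_, Piece.startPt_segment hL'⟩
    · exact ⟨_, Piece.startPt_outgoing (Piece.extent_of_sameKind_outgoing (h.same_kind i) hL)⟩
    · rw [Piece.startPt_incoming hL] at hi; simp at hi
  have he : ∀ i, (S i).endPt = some X → ∃ Y, (T i).endPt = some Y := by
    intro i hi
    rcases (S i).extent_cases with ⟨L, hL⟩ | hL | hL
    · obtain ⟨L', hL'⟩ := Piece.extent_of_sameKind_segment (h.same_kind i) hL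
      exact ⟨_, Piece.endPt_segment hL'⟩
    · rw [Piece.endPt_outgoing hL] at hi; simp at hi
    · exact ⟨_, Piece.endPt_incoming (Piece.extent_of_sameKind_incoming (h.same_kind i) hL)⟩
  by_cases hX : ∃ i, (S i).IsEndpoint X
  · obtain ⟨i, hi | hi⟩ := hX
    · obtain ⟨Y, hY⟩ := hs i hi
      exact ⟨Y, fun j => ⟨fun hj => by rw [← h.start_start i j X hi hj, hY],
        fun hj => by rw [← h.start_end i j X hi hj, hY]⟩⟩
    · obtain ⟨Y, hY⟩ := he i hi
      exact ⟨Y, fun j => ⟨fun hj => by rw [h.start_end j i X hj hi, hY],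
        fun hj => by rw [← h.end_end i j X hi hj, hY]⟩⟩
  · refine ⟨0, fun i => ⟨fun hi => absurd ⟨i, Or.inl hi⟩ hX, fun hi => absurd ⟨i, Or.inr hi⟩ hX⟩⟩

theorem IsParallel.inner_sub_normal (h : IsParallel S T) {X Y : Plane} {i : ι}
    (hXY : ((S i).startPt = some X ∧ (T i).startPt = some Y) ∨
      ((S i).endPt = some X ∧ (T i).endPt = some Y)) :
    (inner ℝ (Y - X) (S i).normal : ℝ) = (S i).height (T i) := by
  have hbase : ∀ X Y, X = (S i).base → Y = (T i).base →
      (inner ℝ (Y - X) (S i).normal : ℝ) = (S i).height (T i) := by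
    rintro X Y rfl rfl; rfl
  rcases (S i).extent_cases with ⟨L, hL⟩ | hL | hL
  · obtain ⟨L', hL'⟩ := Piece.extent_of_sameKind_segment (h.same_kind i) hL
    rcases hXY with ⟨h1, h2⟩ | ⟨h1, h2⟩
    · rw [Piece.startPt_segment hL, Option.some_inj] at h1
      rw [Piece.startPt_segment hL', Option.some_inj] at h2
      exact hbase _ _ h1.symm h2.symm
    · rw [Piece.endPt_segment hL, Option.some_inj] at h1
      rw [Piece.endPt_segment hL', Option.some_inj] at h2
      rw [← h1, ← h2, Piece.height, Piece.point, Piece.point, h.tangent_eq]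
      rw [show (T i).base + L' • (S i).tangent - ((S i).base + L • (S i).tangent) =
        (T i).base - (S i).base + (L' - L) • (S i).tangent by rw [sub_smul]; abel]
      rw [inner_add_left, real_inner_smul_left, Piece.inner_tangent_normal, mul_zero, add_zero]
  · have hL' := Piece.extent_of_sameKind_outgoing (h.same_kind i) hL
    rcases hXY with ⟨h1, h2⟩ | ⟨h1, h2⟩
    · rw [Piece.startPt_outgoing hL, Option.some_inj] at h1
      rw [Piece.startPt_outgoing hL', Option.some_inj] at h2
      exact hbase _ _ h1.symm h2.symm
    · rw [Piece.endPt_outgoing hL] at h1; simp at h1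
  · have hL' := Piece.extent_of_sameKind_incoming (h.same_kind i) hL
    rcases hXY with ⟨h1, h2⟩ | ⟨h1, h2⟩
    · rw [Piece.startPt_incoming hL] at h1; simp at h1
    · rw [Piece.endPt_incoming hL, Option.some_inj] at h1
      rw [Piece.endPt_incoming hL', Option.some_inj] at h2
      exact hbase _ _ h1.symm h2.symm

/-- Heights of the pieces of `T` over those of `S`. -/
def heights (S T : ι → Piece) (i : ι) : ℝ := (S i).height (T i)

theorem IsParallel.heights_mem (hS : IsSimple S) (h : IsParallel S T) :
    heights S T ∈ heightSpace S := by
  refine ⟨fun i hi => h.height_eq_zero hS hi, fun X hX => ?_⟩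
  obtain ⟨Y, hY⟩ := h.exists_vertex X
  apply sum_sgn_eq_zero_of_inner hS hX (D := Y - X)
  rintro i (hi | hi)
  · exact h.inner_sub_normal (Or.inl ⟨hi, (hY i).1 hi⟩)
  · exact h.inner_sub_normal (Or.inr ⟨hi, (hY i).2 hi⟩)

theorem IsParallel.eq_movedVertex (hS : IsSimple S) (h : IsParallel S T) {i : ι} {X Y : Plane}
    (hXY : ((S i).startPt = some X ∧ (T i).startPt = some Y) ∨
      ((S i).endPt = some X ∧ (T i).endPt = some Y)) :
    Y = movedVertex S (heights S T) X := by
  obtain ⟨Z, hZ⟩ := h.exists_vertex X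
  have hi : (S i).IsEndpoint X := hXY.imp And.left And.left
  have hYZ : Y = Z := by
    rcases hXY with ⟨h1, h2⟩ | ⟨h1, h2⟩
    · have := (hZ i).1 h1; rw [h2] at this; exact Option.some_inj.1 this
    · have := (hZ i).2 h1; rw [h2] at this; exact Option.some_inj.1 this
  rw [hYZ, movedVertex, ← eq_vertexShift hS ((h.heights_mem hS).2 X) hi (D := Z - X)]
  · abel
  rintro j (hj | hj)
  · exact h.inner_sub_normal (Or.inl ⟨hj, (hZ j).1 hj⟩)
  · exact h.inner_sub_normal (Or.inr ⟨hj, (hZ j).2 hj⟩)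

theorem IsParallel.eq_deform (hS : IsSimple S) (h : IsParallel S T) :
    T = deform S (heights S T) := by
  funext i
  have ht := h.tangent_eq i
  have hu := (hS.nondegenerate i).1
  have key : (T i).base = movedVertex S (heights S T) (S i).base ∧
      (T i).extent = (deform S (heights S T) i).extent := by
    rcases (S i).extent_cases with ⟨L, hL⟩ | hL | hL
    · obtain ⟨L', hL'⟩ := Piece.extent_of_sameKind_segment (h.same_kind i) hL
      have h1 := h.eq_movedVertex hS
        (Or.inl ⟨Piece.startPt_segment hL, Piece.startPt_segment hL'⟩)
      have h2 := h.eq_movedVertex hS (Or.inr ⟨Piece.endPt_segment hL, Piece.endPt_segment hL'⟩)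
      refine ⟨h1, ?_⟩
      rw [deform_segment hL, hL', deformedLength_segment hL]
      congr 1
      rw [Piece.point, ht, h1, movedVertex, movedVertex, Piece.point] at h2
      have h3 := congrArg (fun x => (inner ℝ x (S i).tangent : ℝ)) h2
      simp only [inner_add_left, real_inner_smul_left, inner_self_unit hu] at h3
      rw [inner_sub_left, Piece.point]
      linarith
    · have hL' := Piece.extent_of_sameKind_outgoing (h.same_kind i) hL
      exact ⟨h.eq_movedVertex hS (Or.inl ⟨Piece.startPt_outgoing hL, Piece.startPt_outgoing hL'⟩),
        by rw [deform_outgoing hL, hL']⟩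
    · have hL' := Piece.extent_of_sameKind_incoming (h.same_kind i) hL
      exact ⟨h.eq_movedVertex hS (Or.inr ⟨Piece.endPt_incoming hL, Piece.endPt_incoming hL'⟩),
        by rw [deform_incoming hL, hL']⟩
  change T i = Piece.mk (movedVertex S (heights S T) (S i).base) (S i).tangent
    (deform S (heights S T) i).extent
  rw [← key.1, ← key.2, ← ht]

end Parallel

/-! ### Regularity of the deformed network -/

section Regular

variable {v : ι → ℝ}

theorem isEndpoint_deform_movedVertex (hS : IsSimple S) (hv : v ∈ heightSpace S)
    (hinj : Set.InjOn (movedVertex S v) (vertices S)) {i : ι} {X : Plane} (hX : X ∈ vertices S) :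
    (deform S v i).IsEndpoint (movedVertex S v X) ↔ (S i).IsEndpoint X := by
  rw [isEndpoint_deform_iff hS hv]
  constructor
  · rintro ⟨X', h1, h2⟩
    rwa [← hinj (mem_vertices_of h1) hX h2]
  · exact fun h => ⟨X, h, rfl⟩

theorem startPt_deform_iff (hinj : Set.InjOn (movedVertex S v) (vertices S)) {i : ι} {X : Plane}
    (hX : X ∈ vertices S) :
    (deform S v i).startPt = some (movedVertex S v X) ↔ (S i).startPt = some X := by
  rw [startPt_deform, Option.map_eq_some_iff]
  constructor
  · rintro ⟨X', h1, h2⟩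
    rwa [← hinj (mem_vertices_of (Or.inl h1)) hX h2]
  · exact fun h => ⟨X, h, rfl⟩

theorem endPt_deform_iff (hS : IsSimple S) (hv : v ∈ heightSpace S)
    (hinj : Set.InjOn (movedVertex S v) (vertices S)) {i : ι} {X : Plane} (hX : X ∈ vertices S) :
    (deform S v i).endPt = some (movedVertex S v X) ↔ (S i).endPt = some X := by
  rw [endPt_deform hS hv, Option.map_eq_some_iff]
  constructor
  · rintro ⟨X', h1, h2⟩
    rwa [← hinj (mem_vertices_of (Or.inr h1)) hX h2]
  · exact fun h => ⟨X, h, rfl⟩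

theorem sgn_deform (hS : IsSimple S) (hv : v ∈ heightSpace S)
    (hinj : Set.InjOn (movedVertex S v) (vertices S)) {i : ι} {X : Plane} (hX : X ∈ vertices S) :
    (deform S v i).sgn (movedVertex S v X) = (S i).sgn X := by
  simp only [Piece.sgn, startPt_deform_iff hinj hX, endPt_deform_iff hS hv hinj hX]

theorem degree_deform (hS : IsSimple S) (hv : v ∈ heightSpace S)
    (hinj : Set.InjOn (movedVertex S v) (vertices S)) {X : Plane} (hX : X ∈ vertices S) :
    degree (deform S v) (movedVertex S v X) = degree S X := by
  simp only [degree, isEndpoint_deform_movedVertex hS hv hinj hX]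

theorem vertexValue_deform (hS : IsSimple S) (hv : v ∈ heightSpace S)
    (hinj : Set.InjOn (movedVertex S v) (vertices S)) {i : ι} {X : Plane} (hX : X ∈ vertices S) :
    vertexValue (deform S v) i (movedVertex S v X) = vertexValue S i X := by
  simp only [vertexValue, Piece.norAt, Piece.dirAt, sgn_deform hS hv hinj hX]
  rfl

theorem exists_of_mem_vertices_deform (hS : IsSimple S) (hv : v ∈ heightSpace S) {Y : Plane}
    (hY : Y ∈ vertices (deform S v)) : ∃ X ∈ vertices S, movedVertex S v X = Y := by
  obtain ⟨i, hi⟩ := mem_vertices.1 hY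
  obtain ⟨X, h1, h2⟩ := (isEndpoint_deform_iff hS hv).1 hi
  exact ⟨X, mem_vertices_of h1, h2⟩

theorem exists_of_degree_deform (hS : IsSimple S) (hv : v ∈ heightSpace S) {Y : Plane}
    (hY : degree (deform S v) Y ≠ 0) : ∃ X ∈ vertices S, movedVertex S v X = Y := by
  apply exists_of_mem_vertices_deform hS hv
  rw [mem_vertices]
  by_contra hne
  push Not at hne
  apply hY
  rw [degree, Set.ncard_eq_zero]
  ext i
  simp [hne i]

theorem nondegenerate_deform (hS : IsSimple S)
    (hlen : ∀ i, (S i).IsSegment → 0 < deformedLength S v i) (i : ι) :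
    (deform S v i).Nondegenerate := by
  refine ⟨(hS.nondegenerate i).1, fun L hL => ?_⟩
  have hseg : (S i).IsSegment := deform_isSegment_iff.1 ⟨L, hL⟩
  obtain ⟨L₀, hL₀⟩ := hseg
  rw [deform_segment hL₀ v] at hL
  cases hL
  exact hlen i ⟨L₀, hL₀⟩

theorem isNetwork_deform (hS : IsSimple S) (hv : v ∈ heightSpace S)
    (hlen : ∀ i, (S i).IsSegment → 0 < deformedLength S v i)
    (hinj : Set.InjOn (movedVertex S v) (vertices S))
    (hmeet : ∀ i j, i ≠ j → ∀ x ∈ (deform S v i).carrier ∩ (deform S v j).carrier,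
      (deform S v i).IsEndpoint x ∧ (deform S v j).IsEndpoint x) :
    IsNetwork (deform S v) := by
  refine ⟨hS.network.nonempty, nondegenerate_deform hS hlen, hmeet, ?_, ?_, ?_⟩
  · intro i Y hi
    obtain ⟨X, h1, rfl⟩ := (isEndpoint_deform_iff hS hv).1 hi
    obtain ⟨j, hj, hjX⟩ := hS.network.no_free_end i X h1
    exact ⟨j, hj, (isEndpoint_deform_iff hS hv).2 ⟨X, hjX, rfl⟩⟩
  · intro i j Y hij hi hj hdeg
    obtain ⟨X, h1, rfl⟩ := (isEndpoint_deform_iff hS hv).1 hi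
    have hX := mem_vertices_of h1
    rw [degree_deform hS hv hinj hX] at hdeg
    rw [isEndpoint_deform_movedVertex hS hv hinj hX] at hj
    rw [startPt_deform_iff hinj hX, endPt_deform_iff hS hv hinj hX]
    exact hS.network.oriented i j X hij h1 hj hdeg
  · intro i j
    refine Relation.ReflTransGen.mono ?_ i j (hS.network.connected i j)
    rintro a b ⟨X, ha, hb⟩
    exact ⟨movedVertex S v X, (isEndpoint_deform_iff hS hv).2 ⟨X, ha, rfl⟩,
      (isEndpoint_deform_iff hS hv).2 ⟨X, hb, rfl⟩⟩

theorem isSimple_deform (hS : IsSimple S) (hv : v ∈ heightSpace S)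
    (hinj : Set.InjOn (movedVertex S v) (vertices S)) (hnet : IsNetwork (deform S v)) :
    IsSimple (deform S v) := by
  have hangle : ∀ i j Y, i ≠ j → (deform S v i).IsEndpoint Y → (deform S v j).IsEndpoint Y →
      InnerProductGeometry.angle ((deform S v i).dirFrom Y) ((deform S v j).dirFrom Y) =
        2 * Real.pi / 3 := by
    intro i j Y hij hi hj
    obtain ⟨X, h1, rfl⟩ := (isEndpoint_deform_iff hS hv).1 hi
    have hX := mem_vertices_of h1
    have h2 := (isEndpoint_deform_movedVertex hS hv hinj hX).1 hj
    have e : ∀ k, (S k).IsEndpoint X → (deform S v k).dirFrom (movedVertex S v X) =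
        (S k).dirAt X := by
      intro k hk
      rw [(hnet.nondegenerate k).dirFrom_eq
        ((isEndpoint_deform_movedVertex hS hv hinj hX).2 hk), Piece.dirAt,
        sgn_deform hS hv hinj hX]
      rfl
    rw [e i h1, e j h2]
    exact angle_of_inner ((hS.nondegenerate i).norm_dirAt h1) ((hS.nondegenerate j).norm_dirAt h2)
      (hS.inner_dirAt hij h1 h2)
  refine ⟨⟨hnet, fun i => hS.admissible.parallel_facet i, fun i j X hij hi hj _ =>
    hangle i j X hij hi hj⟩, fun Y hY => ?_, fun i j X hij hi hj _ => hangle i j X hij hi hj⟩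
  obtain ⟨X, hX, rfl⟩ := exists_of_degree_deform hS hv (by omega : degree (deform S v) Y ≠ 0)
  rw [degree_deform hS hv hinj hX] at hY ⊢
  exact hS.triple X hY

end Regular

/-! ### The curvature as a function of the heights -/

section WeightedForm

variable {E : Type*} [NormedAddCommGroup E] [NormedSpace ℝ E]

/-- The bilinear form `∑ i, len i • φ i ⊗ φ i`. -/
def weightedForm (φ : ι → E →L[ℝ] ℝ) (len : ι → ℝ) : E →L[ℝ] E →L[ℝ] ℝ :=
  ∑ i, len i • (φ i).smulRight (φ i)

theorem weightedForm_apply (φ : ι → E →L[ℝ] ℝ) (len : ι → ℝ) (v w : E) :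
    weightedForm φ len v w = ∑ i, len i * (φ i v * φ i w) := by
  simp [weightedForm, sum_apply]

theorem isInvertible_weightedForm [FiniteDimensional ℝ E] {φ : ι → E →L[ℝ] ℝ} {len : ι → ℝ}
    (h : ∀ v, weightedForm φ len v = 0 → v = 0) : (weightedForm φ len).IsInvertible := by
  have hinj : Function.Injective (weightedForm φ len).toLinearMap := by
    rw [← LinearMap.ker_eq_bot, LinearMap.ker_eq_bot']
    exact h
  have hrank : Module.finrank ℝ E = Module.finrank ℝ (E →L[ℝ] ℝ) := by
    rw [← (LinearMap.toContinuousLinearMap (𝕜 := ℝ) (E := E) (F' := ℝ)).finrank_eq]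
    exact (Subspace.dual_finrank_eq (K := ℝ) (V := E)).symm
  let e := LinearEquiv.ofInjectiveOfFinrankEq (weightedForm φ len).toLinearMap hinj hrank
  refine ⟨e.toContinuousLinearEquiv, ?_⟩
  ext v w
  rfl

theorem contDiffAt_inverse_weightedForm [FiniteDimensional ℝ E] {φ : ι → E →L[ℝ] ℝ}
    {len : E → ι → ℝ} (hlen : ∀ i, ContDiff ℝ 1 fun v => len v i) {v : E}
    (h : (weightedForm φ (len v)).IsInvertible) (g : E →L[ℝ] ℝ) :
    ContDiffAt ℝ 1 (fun v => (weightedForm φ (len v)).inverse g) v := by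
  obtain ⟨e, he⟩ := h
  have h1 : ContDiff ℝ 1 fun v => weightedForm φ (len v) := by
    rw [contDiff_clm_apply_iff]
    intro x
    rw [contDiff_clm_apply_iff]
    intro y
    simp only [weightedForm_apply]
    exact ContDiff.sum fun i _ => (hlen i).mul contDiff_const
  have h2 : ContDiffAt ℝ 1 (ContinuousLinearMap.inverse :
      (E →L[ℝ] E →L[ℝ] ℝ) → _) (weightedForm φ (len v)) := by
    rw [← he]; exact contDiffAt_map_inverse e
  exact (h2.comp v h1.contDiffAt).clm_apply contDiffAt_const

end WeightedForm

/-- The height of the piece `i` as a functional. -/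
def coordForm (S : ι → Piece) (i : ι) : heightSpace S →L[ℝ] ℝ :=
  (ContinuousLinearMap.proj i).comp (heightSpace S).subtypeL

@[simp] theorem coordForm_apply (i : ι) (v : heightSpace S) : coordForm S i v = v.1 i := rfl

/-- Rate of decrease of the length of the network with respect to the heights. -/
def load (S : ι → Piece) (w : ι → ℝ) : ℝ :=
  ∑ i, w i * -∑ X ∈ vertices S, (S i).sgn X * vertexValue S i X

/-- The functional `load` on the space of heights. -/
def loadForm (S : ι → Piece) : heightSpace S →L[ℝ] ℝ :=
  ∑ i, (-∑ X ∈ vertices S, (S i).sgn X * vertexValue S i X) • coordForm S i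

theorem loadForm_apply (w : heightSpace S) : loadForm S w = load S w.1 := by
  simp only [loadForm, load, sum_apply, smul_apply,
    coordForm_apply, smul_eq_mul]
  exact Finset.sum_congr rfl fun i _ => mul_comm _ _

theorem isInvertible_coordForm {len : ι → ℝ} (hlen : ∀ i, (S i).IsSegment → 0 < len i) :
    (weightedForm (coordForm S) len).IsInvertible := by
  apply isInvertible_weightedForm
  intro v hv
  have h0 : ∑ i, len i * (v.1 i * v.1 i) = 0 := by
    have := weightedForm_apply (coordForm S) len v v
    rw [hv] at this
    exact this.symm
  have hnn : ∀ i ∈ Finset.univ, 0 ≤ len i * (v.1 i * v.1 i) := by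
    intro i _
    by_cases hi : (S i).IsSegment
    · exact mul_nonneg (hlen i hi).le (mul_self_nonneg _)
    · rw [v.2.1 i hi]; simp
  rw [Finset.sum_eq_zero_iff_of_nonneg hnn] at h0
  ext i
  by_cases hi : (S i).IsSegment
  · rcases mul_eq_zero.1 (h0 i (Finset.mem_univ i)) with h | h
    · exact absurd h (hlen i hi).ne'
    · exact mul_self_eq_zero.1 h
  · exact v.2.1 i hi

/-- The curvatures of the network with heights `v`. -/
def current (S : ι → Piece) (v : ι → ℝ) : heightSpace S :=
  (weightedForm (coordForm S) (deformedLength S v)).inverse (loadForm S)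

theorem sum_current {v : ι → ℝ} (hlen : ∀ i, (S i).IsSegment → 0 < deformedLength S v i)
    {w : ι → ℝ} (hw : w ∈ heightSpace S) :
    ∑ i, deformedLength S v i * ((current S v).1 i * w i) = load S w := by
  obtain ⟨e, he⟩ := isInvertible_coordForm hlen
  have h1 := weightedForm_apply (coordForm S) (deformedLength S v) (current S v) ⟨w, hw⟩
  simp only [coordForm_apply] at h1
  rw [← h1, ← loadForm_apply ⟨w, hw⟩, current, ← he, ContinuousLinearMap.inverse_equiv]
  change (e (e.symm (loadForm S))) _ = _
  rw [e.apply_symm_apply]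

theorem contDiff_vertexShift (S : ι → Piece) (X : Plane) :
    ContDiff ℝ 1 fun v => vertexShift S v X :=
  (LinearMap.toContinuousLinearMap (vertexShiftLin S X)).contDiff

theorem contDiff_deformedLength (S : ι → Piece) (i : ι) :
    ContDiff ℝ 1 fun v => deformedLength S v i := by
  by_cases h : (S i).IsSegment
  · obtain ⟨L, h⟩ := h
    simp only [deformedLength_segment h]
    exact contDiff_const.add
      (((contDiff_vertexShift S _).sub (contDiff_vertexShift S _)).inner ℝ contDiff_const)
  · simp only [deformedLength_halfLine h]; exact contDiff_const

theorem contDiffAt_current {v : heightSpace S}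
    (hlen : ∀ i, (S i).IsSegment → 0 < deformedLength S v.1 i) :
    ContDiffAt ℝ 1 (fun v : heightSpace S => current S v.1) v :=
  contDiffAt_inverse_weightedForm (φ := coordForm S) (len := fun v => deformedLength S v.1)
    (fun i => (contDiff_deformedLength S i).comp (heightSpace S).subtypeL.contDiff)
    (isInvertible_coordForm hlen) (loadForm S)

/-! ### Potentials -/

/-- `κ` is the family of currents with conductances `1 / len` driven by the potentials
`vertexValue S i X + α X`. -/
structure IsDriven (S : ι → Piece) (len κ : ι → ℝ) (α : Plane → ℝ) : Prop where
  mem : κ ∈ heightSpace S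
  pair : ∀ X, degree S X ≠ 3 → α X = 0
  bound : ∀ X, |α X| ≤ halfFacet
  drop : ∀ i, (S i).IsSegment →
    κ i * len i = -∑ X ∈ vertices S, (S i).sgn X • (vertexValue S i X + α X)

theorem sum_sgn_smul_eq_sub_of_segment {i : ι} {L : ℝ} (h : (S i).extent = .segment L)
    (f : Plane → ℝ) :
    -∑ X ∈ vertices S, (S i).sgn X • f X = f ((S i).point L) - f (S i).base := by
  rw [sum_sgn_smul_segment f h]; ring

theorem exists_potential {len κ : ι → ℝ} (hκ : ∀ w ∈ heightSpace S,
      ∑ i, len i * (κ i * w i) = load S w) :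
    ∃ α : Plane → ℝ, (∀ X, degree S X ≠ 3 → α X = 0) ∧ ∀ i, (S i).IsSegment →
      κ i * len i = -∑ X ∈ vertices S, (S i).sgn X • (vertexValue S i X + α X) := by
  classical
  let m : ι → ℝ := fun i => len i * κ i + ∑ X ∈ vertices S, (S i).sgn X * vertexValue S i X
  let K : (ι → ℝ) →ₗ[ℝ] ℝ := ∑ i, m i • LinearMap.proj i
  have hK : ∀ w, K w = ∑ i, m i * w i := fun w => by simp [K]
  let Λ : ι ⊕ vertices S → (ι → ℝ) →ₗ[ℝ] ℝ := Sum.elim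
    (fun i => if (S i).IsSegment then 0 else LinearMap.proj i)
    (fun X => if degree S X = 3 then ∑ i, (S i).sgn X • LinearMap.proj i else 0)
  have hker : ⨅ a, LinearMap.ker (Λ a) ≤ LinearMap.ker K := by
    intro w hw
    rw [Submodule.mem_iInf] at hw
    have hw' : w ∈ heightSpace S := by
      constructor
      · intro i hi
        have := hw (Sum.inl i)
        simpa [Λ, hi] using this
      · intro X hX
        by_cases hXv : X ∈ vertices S
        · have := hw (Sum.inr ⟨X, hXv⟩)
          simpa [Λ, hX] using this
        · apply Finset.sum_eq_zero
          intro i _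
          rw [Piece.sgn_eq_zero fun hi => hXv (mem_vertices_of hi), zero_mul]
    have h1 := hκ w hw'
    rw [LinearMap.mem_ker, hK]
    rw [load, ← sub_eq_zero, ← Finset.sum_sub_distrib] at h1
    rw [← h1]
    apply Finset.sum_congr rfl
    intro i _
    simp only [m]; ring
  have hspan := mem_span_of_iInf_ker_le_ker hker
  obtain ⟨c, hc⟩ := (Submodule.mem_span_range_iff_exists_fun ℝ).1 hspan
  rw [Fintype.sum_sum_type] at hc
  let α : Plane → ℝ := fun X => if hX : X ∈ vertices S then
    (if degree S X = 3 then -c (Sum.inr ⟨X, hX⟩) else 0) else 0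
  refine ⟨α, fun X hX => by simp [α, hX], fun i hi => ?_⟩
  have h1 := congrArg (fun f : (ι → ℝ) →ₗ[ℝ] ℝ => f (Pi.single i 1)) hc
  have h2 : K (Pi.single i 1) = m i := by
    rw [hK, Finset.sum_eq_single i] <;> simp +contextual
  have h3 : ∑ j, (c (Sum.inl j) • Λ (Sum.inl j)) (Pi.single i 1) = 0 := by
    apply Finset.sum_eq_zero
    intro j _
    by_cases hj : (S j).IsSegment
    · simp [Λ, hj]
    · have : j ≠ i := by rintro rfl; exact hj hi
      simp [Λ, hj, this]
  have h4 : ∑ X : vertices S, (c (Sum.inr X) • Λ (Sum.inr X)) (Pi.single i 1) =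
      -∑ X ∈ vertices S, (S i).sgn X * α X := by
    rw [← Finset.sum_coe_sort (vertices S), ← Finset.sum_neg_distrib]
    apply Finset.sum_congr rfl
    rintro ⟨X, hX⟩ _
    by_cases h : degree S X = 3
    · have : ∑ j, (S j).sgn X * (Pi.single i (1 : ℝ) : ι → ℝ) j = (S i).sgn X := by
        rw [Finset.sum_eq_single i] <;> simp +contextual
      simp only [Λ, α, h, hX, LinearMap.smul_apply, Sum.elim_inr, if_true, LinearMap.sum_apply,
        LinearMap.proj_apply, smul_eq_mul, this, dif_pos]
      ring
    · simp [Λ, α, h]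
  simp only [LinearMap.add_apply, LinearMap.sum_apply] at h1
  rw [h3, h4, h2, zero_add] at h1
  simp only [m] at h1
  simp only [smul_eq_mul, mul_add, Finset.sum_add_distrib]
  linarith

section Driven

variable {len κ : ι → ℝ} {α : Plane → ℝ}

/-- Testing the balance of the currents with a function of the potential. -/
theorem sum_mul_drop_comp (hS : IsSimple S) (hκ : κ ∈ heightSpace S)
    (hα : ∀ X, degree S X ≠ 3 → α X = 0) {g : ℝ → ℝ} (h1 : g halfFacet = 0)
    (h2 : g (-halfFacet) = 0) :
    ∑ i, κ i * -∑ X ∈ vertices S, (S i).sgn X • g (vertexValue S i X + α X) = 0 := by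
  have h := sum_mul_sum_sgn_eq_zero (β := fun X => if degree S X = 3 then g (α X) else 0) hκ.2
    (fun X _ hX => if_neg hX)
  rw [← neg_eq_zero, ← Finset.sum_neg_distrib] at h
  rw [← h]
  apply Finset.sum_congr rfl
  intro i _
  rw [mul_neg]
  congr 2
  apply Finset.sum_congr rfl
  intro X hX
  by_cases hi : (S i).IsEndpoint X
  · congr 1
    split_ifs with h3
    · rw [vertexValue_of_degree_three hS h3, zero_add]
    · have hd : degree S X = 2 := (hS.degree_eq hi).resolve_right h3
      rw [hα X h3, add_zero]
      rcases abs_eq_abs.1 ((abs_vertexValue_of_degree_two hS hd hi).trans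
        (abs_of_pos halfFacet_pos).symm) with h | h <;> rw [h] <;> assumption
  · rw [Piece.sgn_eq_zero hi, zero_smul, zero_smul]

theorem drop_comp_nonneg {i : ι} (hi : (S i).IsSegment) (hlen : 0 < len i)
    (h : κ i * len i = -∑ X ∈ vertices S, (S i).sgn X • (vertexValue S i X + α X)) {g : ℝ → ℝ}
    (hg : Monotone g) :
    0 ≤ κ i * -∑ X ∈ vertices S, (S i).sgn X • g (vertexValue S i X + α X) := by
  obtain ⟨L, hL⟩ := hi
  rw [sum_sgn_smul_eq_sub_of_segment hL fun X => vertexValue S i X + α X] at h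
  rw [sum_sgn_smul_eq_sub_of_segment hL fun X => g (vertexValue S i X + α X)]
  rcases le_total 0 (κ i) with hk | hk
  · apply mul_nonneg hk
    have := mul_nonneg hk hlen.le
    exact sub_nonneg.2 (hg (by linarith))
  · apply mul_nonneg_of_nonpos_of_nonpos hk
    have := mul_nonpos_of_nonpos_of_nonneg hk hlen.le
    exact sub_nonpos.2 (hg (by linarith))

/-- Clipping the potentials does not change the currents. -/
theorem exists_isDriven (hS : IsSimple S) (hlen : ∀ i, (S i).IsSegment → 0 < len i)
    (hκ : κ ∈ heightSpace S)
    (h : ∀ w ∈ heightSpace S, ∑ i, len i * (κ i * w i) = load S w) :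
    ∃ α, IsDriven S len κ α := by
  obtain ⟨α, hα, hd⟩ := exists_potential h
  let p : ℝ → ℝ := fun x => max (-halfFacet) (min x halfFacet)
  have hc := halfFacet_pos
  let g : ℝ → ℝ := fun x => x - p x
  have hg : Monotone g := by
    intro x y hxy
    simp only [g, p]
    rcases max_cases (-halfFacet) (min x halfFacet) with h1 | h1 <;>
    rcases min_cases x halfFacet with h2 | h2 <;>
    rcases max_cases (-halfFacet) (min y halfFacet) with h3 | h3 <;>
    rcases min_cases y halfFacet with h4 | h4 <;> linarith
  have hgc : g halfFacet = 0 := by simp [g, p, hc.le]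
  have hgc' : g (-halfFacet) = 0 := by simp [g, p, hc.le]
  have hsum := sum_mul_drop_comp hS hκ hα hgc hgc'
  have hnn : ∀ i ∈ Finset.univ,
      0 ≤ κ i * -∑ X ∈ vertices S, (S i).sgn X • g (vertexValue S i X + α X) := by
    intro i _
    by_cases hi : (S i).IsSegment
    · exact drop_comp_nonneg hi (hlen i hi) (hd i hi) hg
    · rw [hκ.1 i hi, zero_mul]
  rw [Finset.sum_eq_zero_iff_of_nonneg hnn] at hsum
  refine ⟨fun X => p (α X), hκ, fun X hX => ?_, fun X => ?_, fun i hi => ?_⟩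
  · simp [p, hα X hX, hc.le]
  · rw [abs_le]
    exact ⟨le_max_left _ _, max_le (by linarith) (min_le_right _ _)⟩
  · have hpi : ∀ X, (S i).IsEndpoint X →
        vertexValue S i X + p (α X) = p (vertexValue S i X + α X) := by
      intro X hX
      rcases hS.degree_eq hX with h2 | h3
      · rw [hα X (by omega), add_zero]
        have := (abs_vertexValue_of_degree_two hS h2 hX).le
        rw [abs_le] at this
        simp [p, hc.le, this.1, this.2]
      · rw [vertexValue_of_degree_three hS h3, zero_add, zero_add]
    have h0 := hsum i (Finset.mem_univ i)
    have hdi := hd i hi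
    have hl := hlen i hi
    obtain ⟨L, hL⟩ := hi
    rw [sum_sgn_smul_eq_sub_of_segment hL fun X => vertexValue S i X + p (α X),
      hpi _ (Piece.isEndpoint_point hL), hpi _ (S i).isEndpoint_base]
    rw [sum_sgn_smul_eq_sub_of_segment hL fun X => vertexValue S i X + α X] at hdi
    rw [sum_sgn_smul_eq_sub_of_segment hL fun X => g (vertexValue S i X + α X)] at h0
    rcases mul_eq_zero.1 h0 with h0 | h0
    · have : vertexValue S i ((S i).point L) + α ((S i).point L) =
          vertexValue S i (S i).base + α (S i).base := by rw [h0] at hdi; linarith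
      rw [this, h0]; ring
    · simp only [g] at h0; linarith

namespace IsDriven

theorem abs_potential_le (hS : IsSimple S) (h : IsDriven S len κ α) {i : ι} {X : Plane}
    (hi : (S i).IsEndpoint X) : |vertexValue S i X + α X| ≤ halfFacet := by
  rcases hS.degree_eq hi with h2 | h3
  · rw [h.pair X (by omega), add_zero]; exact abs_vertexValue_le hS hi
  · rw [vertexValue_of_degree_three hS h3, zero_add]; exact h.bound X

theorem segment (h : IsDriven S len κ α) {i : ι} {L : ℝ} (hL : (S i).extent = .segment L) :
    κ i * len i = (vertexValue S i ((S i).point L) + α ((S i).point L)) -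
      (vertexValue S i (S i).base + α (S i).base) := by
  rw [h.drop i ⟨L, hL⟩, sum_sgn_smul_eq_sub_of_segment hL fun X => vertexValue S i X + α X]

/-- A current is controlled by the dissipated energy. -/
theorem abs_current_le (hS : IsSimple S) (hlen : ∀ i, (S i).IsSegment → 0 < len i)
    (h : IsDriven S len κ α) (i : ι) :
    2 * halfFacet * |κ i| ≤ ∑ j, len j * (κ j * κ j) := by
  have hc := halfFacet_pos
  have hE : 0 ≤ ∑ j, len j * (κ j * κ j) := by
    apply Finset.sum_nonneg
    intro j _
    by_cases hj : (S j).IsSegment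
    · exact mul_nonneg (hlen j hj).le (mul_self_nonneg _)
    · rw [h.mem.1 j hj]; simp
  rcases eq_or_ne (κ i) 0 with h0 | h0
  · rw [h0, abs_zero, mul_zero]; exact hE
  have hi : (S i).IsSegment := by by_contra hi; exact h0 (h.mem.1 i hi)
  have hli := hlen i hi
  obtain ⟨L, hL⟩ := hi
  set p : ι → Plane → ℝ := fun i X => vertexValue S i X + α X with hp
  set top := max (p i ((S i).point L)) (p i (S i).base) with htop
  have hsegi : κ i * len i = p i ((S i).point L) - p i (S i).base := h.segment hL
  have hb1 := abs_le.1 (h.abs_potential_le hS (Piece.isEndpoint_point hL))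
  have hb2 := abs_le.1 (h.abs_potential_le hS (S i).isEndpoint_base)
  let χ : ℝ → ℝ := fun x => if top ≤ x then 1 else 0
  have hχ : Monotone χ := by
    intro x y hxy
    simp only [χ]
    split_ifs with h1 h2
    · exact le_rfl
    · exact absurd (h1.trans hxy) h2
    · exact zero_le_one
    · exact le_rfl
  have htop1 : top ≤ halfFacet := max_le hb1.2 hb2.2
  have htop2 : -halfFacet < top := by
    rcases lt_or_gt_of_ne h0 with hneg | hpos
    · have := mul_neg_of_neg_of_pos hneg hli
      exact lt_of_le_of_lt hb1.1 (lt_of_lt_of_le (by simp only [hp] at hsegi ⊢; linarith)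
        (le_max_right _ _))
    · have := mul_pos hpos hli
      exact lt_of_le_of_lt hb2.1 (lt_of_lt_of_le (by simp only [hp] at hsegi ⊢; linarith)
        (le_max_left _ _))
  have hsum := sum_mul_drop_comp (g := fun x => χ x - (x + halfFacet) / (2 * halfFacet)) hS h.mem
    h.pair (by simp only [χ, htop1, if_true]; field_simp; ring) (by simp [χ, htop2])
  have hsplit : ∀ j, κ j * -∑ X ∈ vertices S, (S j).sgn X •
      (χ (vertexValue S j X + α X) - (vertexValue S j X + α X + halfFacet) / (2 * halfFacet)) =
      κ j * -∑ X ∈ vertices S, (S j).sgn X • χ (vertexValue S j X + α X) -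
        len j * (κ j * κ j) / (2 * halfFacet) := by
    intro j
    by_cases hj : (S j).IsSegment
    · obtain ⟨M, hM⟩ := hj
      rw [sum_sgn_smul_eq_sub_of_segment hM, sum_sgn_smul_eq_sub_of_segment hM]
      have := h.segment hM
      field_simp
      linear_combination κ j * this
    · simp [h.mem.1 j hj]
  simp only [hsplit, Finset.sum_sub_distrib, ← Finset.sum_div] at hsum
  have hone : |κ i| ≤ ∑ j, κ j * -∑ X ∈ vertices S, (S j).sgn X • χ (vertexValue S j X + α X) := by
    refine le_trans ?_ (Finset.single_le_sum (fun j _ => ?_) (Finset.mem_univ i))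
    · rw [sum_sgn_smul_eq_sub_of_segment hL fun X => χ (vertexValue S i X + α X)]
      change |κ i| ≤ κ i * (χ (p i _) - χ (p i _))
      rcases lt_or_gt_of_ne h0 with hneg | hpos
      · have := mul_neg_of_neg_of_pos hneg hli
        have e : top = p i (S i).base := max_eq_right (by linarith)
        have e2 : χ (p i ((S i).point L)) = 0 := if_neg (by linarith)
        have e3 : χ (p i (S i).base) = 1 := if_pos e.le
        rw [e2, e3, abs_of_neg hneg]; linarith
      · have := mul_pos hpos hli
        have e : top = p i ((S i).point L) := max_eq_left (by linarith)
        have e2 : χ (p i ((S i).point L)) = 1 := if_pos e.le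
        have e3 : χ (p i (S i).base) = 0 := if_neg (by linarith)
        rw [e2, e3, abs_of_pos hpos]; linarith
    · by_cases hj : (S j).IsSegment
      · exact drop_comp_nonneg hj (hlen j hj) (h.drop j hj) hχ
      · rw [h.mem.1 j hj, zero_mul]
  have : (∑ j, len j * (κ j * κ j)) / (2 * halfFacet) * (2 * halfFacet) =
    ∑ j, len j * (κ j * κ j) := by field_simp
  nlinarith [abs_nonneg (κ i)]

theorem abs_current_mul_len_le (hS : IsSimple S) (h : IsDriven S len κ α) {i : ι}
    (hi : (S i).IsSegment) : |κ i * len i| ≤ 2 * halfFacet := by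
  obtain ⟨L, hL⟩ := hi
  rw [h.segment hL]
  have hb1 := abs_le.1 (h.abs_potential_le hS (Piece.isEndpoint_point hL))
  have hb2 := abs_le.1 (h.abs_potential_le hS (S i).isEndpoint_base)
  rw [abs_le]
  constructor <;> linarith

/-- A segment moves towards the side of its simple neighbour. -/
theorem inner_normal_dirAt_nonneg (hS : IsSimple S) (h : IsDriven S len κ α) {i j : ι} {X : Plane}
    (hi : (S i).IsSegment) (hlen : 0 < len i) (hX : IsPair S X i j) :
    0 ≤ -κ i * (inner ℝ (S i).normal ((S j).dirAt X) : ℝ) := by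
  obtain ⟨L, hL⟩ := hi
  have h1 := h.segment hL
  have hb1 := abs_le.1 (h.abs_potential_le hS (Piece.isEndpoint_point hL))
  have hb2 := abs_le.1 (h.abs_potential_le hS (S i).isEndpoint_base)
  have hα : α X = 0 := h.pair X (by have := hX.degree; omega)
  have hv := hX.vertexValue_left
  have habs := abs_vertexValue_of_degree_two hS hX.degree hX.left
  rw [Piece.norAt, real_inner_smul_left] at hv
  set r := (inner ℝ (S i).normal ((S j).dirAt X) : ℝ)
  rcases hX.left with hs | he
  · have hX' : X = (S i).base := by
      rw [Piece.startPt_segment hL] at hs; exact (Option.some_inj.1 hs).symm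
    rw [(hS.nondegenerate i).sgn_start hs, one_mul] at hv
    rw [← hX', hα, add_zero] at h1
    rcases abs_cases (vertexValue S i X) with hc | hc
    · have : κ i ≤ 0 := by
        by_contra hk; push Not at hk
        have := mul_pos hk hlen; linarith
      have hr : 0 ≤ r := by linarith [halfFacet_pos]
      exact mul_nonneg (by linarith) hr
    · have : 0 ≤ κ i := by
        by_contra hk; push Not at hk
        have := mul_neg_of_neg_of_pos hk hlen; linarith
      have hr : r ≤ 0 := by linarith [halfFacet_pos]
      exact mul_nonneg_of_nonpos_of_nonpos (by linarith) hr
  · have hX' : X = (S i).point L := by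
      rw [Piece.endPt_segment hL] at he; exact (Option.some_inj.1 he).symm
    rw [(hS.nondegenerate i).sgn_end he] at hv
    rw [← hX', hα, add_zero] at h1
    rcases abs_cases (vertexValue S i X) with hc | hc
    · have : 0 ≤ κ i := by
        by_contra hk; push Not at hk
        have := mul_neg_of_neg_of_pos hk hlen; linarith
      have hr : r ≤ 0 := by linarith [halfFacet_pos]
      exact mul_nonneg_of_nonpos_of_nonpos (by linarith) hr
    · have : κ i ≤ 0 := by
        by_contra hk; push Not at hk
        have := mul_pos hk hlen; linarith
      have hr : 0 ≤ r := by linarith [halfFacet_pos]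
      exact mul_nonneg (by linarith) hr

end IsDriven

theorem exists_isDriven_current (hS : IsSimple S) {v : ι → ℝ}
    (hlen : ∀ i, (S i).IsSegment → 0 < deformedLength S v i) :
    ∃ α, IsDriven S (deformedLength S v) (current S v).1 α :=
  exists_isDriven hS hlen (current S v).2 fun _ hw => sum_current hlen hw

/-- The curvatures of a deformed network. -/
theorem IsDriven.isEquilibrium (hS : IsSimple S) {v : ι → ℝ} (hv : v ∈ heightSpace S)
    (hinj : Set.InjOn (movedVertex S v) (vertices S))
    (h : IsDriven S (deformedLength S v) κ α) :
    ∃ a, IsEquilibrium (deform S v) κ a := by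
  classical
  let back : Plane → Plane := Function.invFunOn (movedVertex S v) (vertices S)
  have hback : ∀ X ∈ vertices S, back (movedVertex S v X) = X := fun X hX =>
    hinj.leftInvOn_invFunOn hX
  refine ⟨fun i Y => vertexValue S i (back Y) + α (back Y), fun i hi => h.mem.1 i
    fun hi' => hi (deform_isSegment_iff.2 hi'), ?_, ?_, ?_, ?_⟩
  · intro i L' hL'
    obtain ⟨L, hL⟩ := deform_isSegment_iff.1 ⟨L', hL'⟩
    rw [deform_segment hL v] at hL'
    cases hL'
    rw [deform_point hS hv hL]
    change _ = _ - (vertexValue S i (back (movedVertex S v (S i).base)) + _)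
    rw [hback _ (mem_vertices_of (Piece.isEndpoint_point hL))]
    change _ = _ - (_ + α (back (movedVertex S v (S i).base)))
    rw [hback _ (mem_vertices_of (S i).isEndpoint_base)]
    exact h.segment hL
  · intro i Y hi
    obtain ⟨X, hX, rfl⟩ := (isEndpoint_deform_iff hS hv).1 hi
    simp only [hback X (mem_vertices_of hX)]
    exact h.abs_potential_le hS hX
  · intro Y hY
    obtain ⟨X, hX, rfl⟩ := exists_of_mem_vertices_deform hS hv hY
    refine ⟨α X, ?_, ?_⟩
    · intro h2
      rw [degree_deform hS hv hinj hX] at h2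
      exact h.pair X (by omega)
    · intro i _
      simp only [hback X hX, vertexValue_deform hS hv hinj hX]
  · intro Y hY
    obtain ⟨X, hX, rfl⟩ := exists_of_degree_deform hS hv (by omega : degree (deform S v) Y ≠ 0)
    rw [degree_deform hS hv hinj hX] at hY
    simp only [sgn_deform hS hv hinj hX]
    exact h.mem.2 X hY

end Driven

/-! ### Autonomous differential equations on extended intervals -/

section ODE

/-- The interval `[0, T)`. -/
abbrev timeInterval (T : EReal) : Set ℝ := {t : ℝ | 0 ≤ t ∧ (t : EReal) < T}

theorem timeInterval_mem_nhdsGT {T : EReal} {x : ℝ} (hx : x ∈ timeInterval T) :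
    timeInterval T ∈ 𝓝[>] x := by
  obtain ⟨y, hxy, hyT⟩ := EReal.lt_iff_exists_real_btwn.1 hx.2
  filter_upwards [Ioo_mem_nhdsGT (EReal.coe_lt_coe_iff.1 hxy)] with t ht
  exact ⟨hx.1.trans ht.1.le, (EReal.coe_lt_coe_iff.2 ht.2).trans hyT⟩

theorem timeInterval_mem_nhds {T : EReal} {x : ℝ} (h0 : 0 < x) (hx : (x : EReal) < T) :
    timeInterval T ∈ 𝓝 x := by
  obtain ⟨y, hxy, hyT⟩ := EReal.lt_iff_exists_real_btwn.1 hx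
  filter_upwards [Ioo_mem_nhds h0 (EReal.coe_lt_coe_iff.1 hxy)] with t ht
  exact ⟨ht.1.le, (EReal.coe_lt_coe_iff.2 ht.2).trans hyT⟩

theorem continuousWithinAt_Ici_of_timeInterval {E : Type*} [TopologicalSpace E] {T : EReal}
    {h : ℝ → E} (hc : ContinuousOn h (timeInterval T)) {x : ℝ} (hx : x ∈ timeInterval T) :
    ContinuousWithinAt h (Ici x) x := by
  rw [← continuousWithinAt_Ioi_iff_Ici]
  exact (hc x hx).mono_of_mem_nhdsWithin (timeInterval_mem_nhdsGT hx)

theorem continuousAt_of_timeInterval {E : Type*} [TopologicalSpace E] {T : EReal}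
    {h : ℝ → E} (hc : ContinuousOn h (timeInterval T)) {x : ℝ} (h0 : 0 < x)
    (hx : (x : EReal) < T) : ContinuousAt h x :=
  (hc x ⟨h0.le, hx⟩).continuousAt (timeInterval_mem_nhds h0 hx)

theorem eq_of_eventually_right {E : Type*} [TopologicalSpace E] [T2Space E] {T : EReal}
    {h₁ h₂ : ℝ → E} (c₁ : ContinuousOn h₁ (timeInterval T)) (c₂ : ContinuousOn h₂ (timeInterval T))
    (h0 : h₁ 0 = h₂ 0)
    (step : ∀ x ∈ timeInterval T, h₁ x = h₂ x → ∀ᶠ t in 𝓝[>] x, h₁ t = h₂ t) :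
    ∀ t ∈ timeInterval T, h₁ t = h₂ t := by
  intro t ht
  have hsub : Icc 0 t ⊆ timeInterval T := fun s hs =>
    ⟨hs.1, (EReal.coe_le_coe_iff.2 hs.2).trans_lt ht.2⟩
  have hclosed : IsClosed ({s | h₁ s = h₂ s} ∩ Icc 0 t) := by
    rw [inter_comm]
    exact ((c₁.mono hsub).prodMk (c₂.mono hsub)).preimage_isClosed_of_isClosed isClosed_Icc
      isClosed_diagonal
  exact IsClosed.Icc_subset_of_forall_mem_nhdsWithin hclosed h0
    (fun x hx => step x (hsub (Ico_subset_Icc_self hx.2)) hx.1) ⟨ht.1, le_rfl⟩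

variable {E : Type*} [NormedAddCommGroup E] [NormedSpace ℝ E] {f : E → E}

theorem hasDerivWithinAt_Ici_of_ode {h : ℝ → E} {x : ℝ}
    (hf : ContinuousAt f (h x)) (hc : ContinuousWithinAt h (Ici x) x)
    (hd : ∀ᶠ t in 𝓝[>] x, HasDerivAt h (f (h t)) t) :
    HasDerivWithinAt h (f (h x)) (Ici x) x := by
  apply hasDerivWithinAt_Ici_of_tendsto_deriv (s := {t | HasDerivAt h (f (h t)) t} ∩ Ioi x)
  · exact fun t ht => ht.1.differentiableAt.differentiableWithinAt
  · exact hc.mono fun t ht => mem_Ici.2 (le_of_lt ht.2)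
  · exact inter_mem hd self_mem_nhdsWithin
  · have h1 : Tendsto (fun t => f (h t)) (𝓝[>] x) (𝓝 (f (h x))) :=
      hf.tendsto.comp (hc.mono Ioi_subset_Ici_self)
    refine h1.congr' ?_
    filter_upwards [hd] with t ht
    exact ht.deriv.symm

theorem hasDerivWithinAt_Iic_of_ode {h : ℝ → E} {x : ℝ}
    (hf : ContinuousAt f (h x)) (hc : ContinuousWithinAt h (Iic x) x)
    (hd : ∀ᶠ t in 𝓝[<] x, HasDerivAt h (f (h t)) t) :
    HasDerivWithinAt h (f (h x)) (Iic x) x := by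
  apply hasDerivWithinAt_Iic_of_tendsto_deriv (s := {t | HasDerivAt h (f (h t)) t} ∩ Iio x)
  · exact fun t ht => ht.1.differentiableAt.differentiableWithinAt
  · exact hc.mono fun t ht => mem_Iic.2 (le_of_lt ht.2)
  · exact inter_mem hd self_mem_nhdsWithin
  · have h1 : Tendsto (fun t => f (h t)) (𝓝[<] x) (𝓝 (f (h x))) :=
      hf.tendsto.comp (hc.mono Iio_subset_Iic_self)
    refine h1.congr' ?_
    filter_upwards [hd] with t ht
    exact ht.deriv.symm

theorem ode_eventually_eq_right {h₁ h₂ : ℝ → E} {x : ℝ} (hf : ContDiffAt ℝ 1 f (h₁ x))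
    (hx : h₁ x = h₂ x) (c₁ : ContinuousWithinAt h₁ (Ici x) x)
    (c₂ : ContinuousWithinAt h₂ (Ici x) x)
    (d₁ : ∀ᶠ t in 𝓝[>] x, HasDerivAt h₁ (f (h₁ t)) t)
    (d₂ : ∀ᶠ t in 𝓝[>] x, HasDerivAt h₂ (f (h₂ t)) t) :
    ∀ᶠ t in 𝓝[>] x, h₁ t = h₂ t := by
  obtain ⟨K, W, hW, hK⟩ := hf.exists_lipschitzOnWith
  have e₁ := hasDerivWithinAt_Ici_of_ode hf.continuousAt c₁ d₁
  have e₂ := hasDerivWithinAt_Ici_of_ode (hx ▸ hf.continuousAt) c₂ d₂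
  have w₁ : ∀ᶠ t in 𝓝[>] x, h₁ t ∈ W := (c₁.mono Ioi_subset_Ici_self).eventually hW
  have w₂ : ∀ᶠ t in 𝓝[>] x, h₂ t ∈ W := (c₂.mono Ioi_subset_Ici_self).eventually (hx ▸ hW)
  obtain ⟨y, hxy, hy⟩ := mem_nhdsGT_iff_exists_Ioo_subset.1 (d₁.and (d₂.and (w₁.and w₂)))
  rw [mem_Ioi] at hxy
  obtain ⟨z, hxz, hzy⟩ := exists_between hxy
  have key : ∀ {h : ℝ → E}, ContinuousWithinAt h (Ici x) x →
      (∀ t ∈ Ioo x y, HasDerivAt h (f (h t)) t) → ContinuousOn h (Icc x z) := by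
    intro h hc hd t ht
    rcases ht.1.eq_or_lt with rfl | hlt
    · exact hc.mono Icc_subset_Ici_self
    · exact (hd t ⟨hlt, ht.2.trans_lt hzy⟩).continuousAt.continuousWithinAt
  have hEq : EqOn h₁ h₂ (Icc x z) := by
    refine ODE_solution_unique_of_mem_Icc_right (v := fun _ => f) (s := fun _ => W) (K := K)
      (fun t _ => hK) (key c₁ fun t ht => (hy ht).1) ?_ ?_ (key c₂ fun t ht => (hy ht).2.1) ?_ ?_ hx
    · intro t ht
      rcases ht.1.eq_or_lt with rfl | hlt
      · exact e₁
      · exact (hy ⟨hlt, ht.2.trans hzy⟩).1.hasDerivWithinAt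
    · intro t ht
      rcases ht.1.eq_or_lt with rfl | hlt
      · exact mem_of_mem_nhds hW
      · exact (hy ⟨hlt, ht.2.trans hzy⟩).2.2.1
    · intro t ht
      rcases ht.1.eq_or_lt with rfl | hlt
      · exact e₂
      · exact (hy ⟨hlt, ht.2.trans hzy⟩).2.1.hasDerivWithinAt
    · intro t ht
      rcases ht.1.eq_or_lt with rfl | hlt
      · exact mem_of_mem_nhds (hx ▸ hW)
      · exact (hy ⟨hlt, ht.2.trans hzy⟩).2.2.2
  filter_upwards [Ioo_mem_nhdsGT hxz] with t ht
  exact hEq (Ioo_subset_Icc_self ht)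

/-- `h` solves `h' = f h` on `[0, T)` with values in `U`, starting at `x₀`. -/
structure IsSolution (f : E → E) (U : Set E) (x₀ : E) (T : EReal) (h : ℝ → E) : Prop where
  init : h 0 = x₀
  mem : ∀ t ∈ timeInterval T, h t ∈ U
  cont : ContinuousOn h (timeInterval T)
  deriv : ∀ t : ℝ, 0 < t → (t : EReal) < T → HasDerivAt h (f (h t)) t

namespace IsSolution

variable {U : Set E} {x₀ : E} {T T₁ T₂ : EReal} {h h₁ h₂ : ℝ → E}

theorem eventually_hasDerivAt (hs : IsSolution f U x₀ T h) {x : ℝ} (hx : x ∈ timeInterval T) :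
    ∀ᶠ t in 𝓝[>] x, HasDerivAt h (f (h t)) t := by
  filter_upwards [timeInterval_mem_nhdsGT hx, self_mem_nhdsWithin] with t ht hxt
  exact hs.deriv t (hx.1.trans_lt hxt) ht.2

theorem hasDerivWithinAt_Ici (hs : IsSolution f U x₀ T h) (hf : ∀ x ∈ U, ContDiffAt ℝ 1 f x)
    {x : ℝ} (hx : x ∈ timeInterval T) : HasDerivWithinAt h (f (h x)) (Ici x) x :=
  hasDerivWithinAt_Ici_of_ode (hf _ (hs.mem x hx)).continuousAt
    (continuousWithinAt_Ici_of_timeInterval hs.cont hx) (hs.eventually_hasDerivAt hx)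

theorem mono (hs : IsSolution f U x₀ T₂ h) (hT : T₁ ≤ T₂) : IsSolution f U x₀ T₁ h :=
  have hsub : timeInterval T₁ ⊆ timeInterval T₂ := fun _ ht => ⟨ht.1, ht.2.trans_le hT⟩
  ⟨hs.init, fun t ht => hs.mem t (hsub ht), hs.cont.mono hsub,
    fun t h0 ht => hs.deriv t h0 (ht.trans_le hT)⟩

theorem unique (hf : ∀ x ∈ U, ContDiffAt ℝ 1 f x) (hs₁ : IsSolution f U x₀ T h₁)
    (hs₂ : IsSolution f U x₀ T h₂) : ∀ t ∈ timeInterval T, h₁ t = h₂ t :=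
  eq_of_eventually_right hs₁.cont hs₂.cont (hs₁.init.trans hs₂.init.symm) fun x hx hxx =>
    ode_eventually_eq_right (hf _ (hs₁.mem x hx)) hxx
      (continuousWithinAt_Ici_of_timeInterval hs₁.cont hx)
      (continuousWithinAt_Ici_of_timeInterval hs₂.cont hx)
      (hs₁.eventually_hasDerivAt hx) (hs₂.eventually_hasDerivAt hx)

theorem exists_local [CompleteSpace E] (hU : IsOpen U) (hf : ∀ x ∈ U, ContDiffAt ℝ 1 f x)
    (hx₀ : x₀ ∈ U) : ∃ ε : ℝ, 0 < ε ∧ ∃ h, IsSolution f U x₀ ε h := by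
  obtain ⟨h, h0, ε, hε, hd⟩ :=
    (hf x₀ hx₀).exists_forall_mem_closedBall_exists_eq_forall_mem_Ioo_hasDerivAt₀ 0
  rw [zero_sub, zero_add] at hd
  have hc : ContinuousAt h 0 := (hd 0 ⟨by linarith, hε⟩).continuousAt
  have hev : ∀ᶠ t in 𝓝 (0 : ℝ), h t ∈ U := hc.eventually (hU.mem_nhds (h0 ▸ hx₀))
  obtain ⟨δ, hδ, hδU⟩ := Metric.eventually_nhds_iff.1 hev
  refine ⟨min ε δ, lt_min hε hδ, h, h0, fun t ht => hδU ?_, fun t ht => ?_, fun t ht0 ht => ?_⟩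
  · rw [Real.dist_eq, sub_zero, abs_of_nonneg ht.1]
    exact (EReal.coe_lt_coe_iff.1 ht.2).trans_le (min_le_right _ _)
  · exact (hd t ⟨by linarith [ht.1], (EReal.coe_lt_coe_iff.1 ht.2).trans_le
      (min_le_left _ _)⟩).continuousAt.continuousWithinAt
  · exact hd t ⟨by linarith, (EReal.coe_lt_coe_iff.1 ht).trans_le (min_le_left _ _)⟩

/-- Prolongation through a limit in `U`. -/
theorem extend [CompleteSpace E] (hU : IsOpen U) (hf : ∀ x ∈ U, ContDiffAt ℝ 1 f x) {τ : ℝ}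
    (hτ : 0 < τ) (hs : IsSolution f U x₀ τ h) {y : E} (hy : y ∈ U)
    (hlim : Tendsto h (𝓝[<] τ) (𝓝 y)) :
    ∃ T : ℝ, τ < T ∧ ∃ k, IsSolution f U x₀ T k := by
  obtain ⟨ε, hε, g, hg⟩ := exists_local hU hf hy
  let k : ℝ → E := fun t => if t < τ then h t else g (t - τ)
  have hkl : ∀ t, t < τ → k t = h t := fun t ht => if_pos ht
  have hkr : ∀ t, τ ≤ t → k t = g (t - τ) := fun t ht => if_neg (not_lt.2 ht)
  have hkτ : k τ = y := by rw [hkr τ le_rfl, sub_self, hg.init]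
  have hgs : ∀ t, τ ≤ t → t < τ + ε → t - τ ∈ timeInterval (ε : EReal) := fun t h1 h2 =>
    ⟨sub_nonneg.2 h1, EReal.coe_lt_coe_iff.2 (by linarith)⟩
  have hdl : ∀ t, 0 < t → t < τ → HasDerivAt k (f (k t)) t := by
    intro t h0 ht
    rw [hkl t ht]
    refine (hs.deriv t h0 (EReal.coe_lt_coe_iff.2 ht)).congr_of_eventuallyEq ?_
    filter_upwards [Iio_mem_nhds ht] with s hs
    exact hkl s hs
  have hdr : ∀ t, τ < t → t < τ + ε → HasDerivAt k (f (k t)) t := by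
    intro t h1 h2
    rw [hkr t h1.le]
    have := (hg.deriv (t - τ) (sub_pos.2 h1) (hgs t h1.le h2).2).comp_sub_const t τ
    refine this.congr_of_eventuallyEq ?_
    filter_upwards [Ioi_mem_nhds h1] with s hs
    exact hkr s (le_of_lt hs)
  have hcr : ContinuousWithinAt k (Ici τ) τ := by
    have h1 := continuousWithinAt_Ici_of_timeInterval hg.cont
      (show (0 : ℝ) ∈ timeInterval (ε : EReal) from ⟨le_rfl, EReal.coe_lt_coe_iff.2 hε⟩)
    have h2 : ContinuousWithinAt (fun t => g (t - τ)) (Ici τ) τ := by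
      have h3 : ContinuousWithinAt (fun t : ℝ => t - τ) (Ici τ) τ := by fun_prop
      refine ContinuousWithinAt.comp (t := Ici 0) (by rwa [sub_self]) h3 ?_
      intro t ht
      exact sub_nonneg.2 (mem_Ici.1 ht)
    exact h2.congr (fun t ht => hkr t ht) (hkr τ le_rfl)
  have hcl : ContinuousWithinAt k (Iic τ) τ := by
    rw [← continuousWithinAt_Iio_iff_Iic, ContinuousWithinAt, hkτ]
    refine hlim.congr' ?_
    filter_upwards [self_mem_nhdsWithin] with t ht
    exact (hkl t ht).symm
  have hfy : ContinuousAt f (k τ) := by rw [hkτ]; exact (hf y hy).continuousAt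
  have hdτ : HasDerivAt k (f (k τ)) τ := by
    have e1 := hasDerivWithinAt_Ici_of_ode hfy hcr (by
      filter_upwards [Ioo_mem_nhdsGT (show τ < τ + ε by linarith)] with t ht
      exact hdr t ht.1 ht.2)
    have e2 := hasDerivWithinAt_Iic_of_ode hfy hcl (by
      filter_upwards [Ioo_mem_nhdsLT hτ] with t ht
      exact hdl t ht.1 ht.2)
    have := e2.union e1
    rwa [Iic_union_Ici, hasDerivWithinAt_univ] at this
  have hd : ∀ t : ℝ, 0 < t → (t : EReal) < ((τ + ε : ℝ) : EReal) → HasDerivAt k (f (k t)) t := by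
    intro t h0 ht
    rcases lt_trichotomy t τ with h | rfl | h
    · exact hdl t h0 h
    · exact hdτ
    · exact hdr t h (EReal.coe_lt_coe_iff.1 ht)
  refine ⟨τ + ε, by linarith, k, by rw [hkl 0 hτ, hs.init], fun t ht => ?_, fun t ht => ?_, hd⟩
  · rcases lt_or_ge t τ with h | h
    · rw [hkl t h]; exact hs.mem t ⟨ht.1, EReal.coe_lt_coe_iff.2 h⟩
    · rw [hkr t h]; exact hg.mem _ (hgs t h (EReal.coe_lt_coe_iff.1 ht.2))
  · rcases ht.1.eq_or_lt with rfl | h0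
    · have h1 := continuousWithinAt_Ici_of_timeInterval hs.cont
        (show (0 : ℝ) ∈ timeInterval (τ : EReal) from ⟨le_rfl, EReal.coe_lt_coe_iff.2 hτ⟩)
      refine (h1.congr_of_eventuallyEq ?_ (hkl 0 hτ)).mono fun s hs => hs.1
      exact mem_nhdsWithin_of_mem_nhds (by filter_upwards [Iio_mem_nhds hτ] with s hs using hkl s hs)
    · exact (hd t h0 ht.2).continuousAt.continuousWithinAt

/-- The maximal solution. -/
theorem exists_maximal [CompleteSpace E] (hU : IsOpen U) (hf : ∀ x ∈ U, ContDiffAt ℝ 1 f x)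
    (hx₀ : x₀ ∈ U) : ∃ (T : EReal) (h : ℝ → E), 0 < T ∧ IsSolution f U x₀ T h ∧
      ∀ τ : ℝ, T = τ → ∀ y ∈ U, ¬ Tendsto h (𝓝[<] τ) (𝓝 y) := by
  classical
  let times : Set ℝ := {s | 0 < s ∧ ∃ h, IsSolution f U x₀ s h}
  let T : EReal := ⨆ s ∈ times, (s : EReal)
  have hle : ∀ s ∈ times, (s : EReal) ≤ T := fun s hs =>
    le_iSup₂ (f := fun (s : ℝ) (_ : s ∈ times) => (s : EReal)) s hs
  have hlt : ∀ t : ℝ, (t : EReal) < T → ∃ s ∈ times, t < s := by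
    intro t ht
    obtain ⟨s, hs⟩ := lt_iSup_iff.1 ht
    obtain ⟨h1, h2⟩ := lt_iSup_iff.1 hs
    exact ⟨s, h1, EReal.coe_lt_coe_iff.1 h2⟩
  let sol : ℝ → ℝ → E := fun s => if hs : s ∈ times then hs.2.choose else fun _ => x₀
  have hsol : ∀ s ∈ times, IsSolution f U x₀ s (sol s) := by
    intro s hs
    simp only [sol, hs, dif_pos]
    exact hs.2.choose_spec
  let pick : ℝ → ℝ := fun t => if ht : (t : EReal) < T then (hlt t ht).choose else 0
  have hpick : ∀ t : ℝ, (t : EReal) < T → pick t ∈ times ∧ t < pick t := by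
    intro t ht
    simp only [pick, ht, dif_pos]
    exact (hlt t ht).choose_spec
  let h : ℝ → E := fun t => sol (pick t) t
  have hagree : ∀ s ∈ times, ∀ t : ℝ, 0 ≤ t → t < s → h t = sol s t := by
    intro s hs t h0 ht
    have hp := hpick t ((EReal.coe_lt_coe_iff.2 ht).trans_le (hle s hs))
    apply unique (T := ((min (pick t) s : ℝ) : EReal)) hf ((hsol _ hp.1).mono ?_)
      ((hsol s hs).mono ?_) t ⟨h0, EReal.coe_lt_coe_iff.2 (lt_min hp.2 ht)⟩
    · exact EReal.coe_le_coe_iff.2 (min_le_left _ _)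
    · exact EReal.coe_le_coe_iff.2 (min_le_right _ _)
  obtain ⟨ε, hε, g, hg⟩ := exists_local hU hf hx₀
  have hεt : ε ∈ times := ⟨hε, g, hg⟩
  have hT : 0 < T := (EReal.coe_lt_coe_iff.2 hε).trans_le (hle ε hεt)
  have hmain : IsSolution f U x₀ T h := by
    have hev : ∀ s ∈ times, ∀ t : ℝ, 0 < t → t < s → h =ᶠ[𝓝 t] sol s := by
      intro s hs t h0 ht
      filter_upwards [Ioo_mem_nhds h0 ht] with r hr
      exact hagree s hs r hr.1.le hr.2
    have hd : ∀ t : ℝ, 0 < t → (t : EReal) < T → HasDerivAt h (f (h t)) t := by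
      intro t h0 ht
      obtain ⟨s, hs, hts⟩ := hlt t ht
      rw [hagree s hs t h0.le hts]
      exact ((hsol s hs).deriv t h0 (EReal.coe_lt_coe_iff.2 hts)).congr_of_eventuallyEq
        (hev s hs t h0 hts)
    refine ⟨by rw [hagree ε hεt 0 le_rfl hε, (hsol ε hεt).init], fun t ht => ?_, fun t ht => ?_, hd⟩
    · obtain ⟨s, hs, hts⟩ := hlt t ht.2
      rw [hagree s hs t ht.1 hts]
      exact (hsol s hs).mem t ⟨ht.1, EReal.coe_lt_coe_iff.2 hts⟩
    · rcases ht.1.eq_or_lt with rfl | h0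
      · have h1 := continuousWithinAt_Ici_of_timeInterval (hsol ε hεt).cont
          (show (0 : ℝ) ∈ timeInterval (ε : EReal) from ⟨le_rfl, EReal.coe_lt_coe_iff.2 hε⟩)
        refine (h1.congr_of_eventuallyEq ?_ (hagree ε hεt 0 le_rfl hε)).mono fun s hs => hs.1
        filter_upwards [self_mem_nhdsWithin, mem_nhdsWithin_of_mem_nhds (Iio_mem_nhds hε)]
          with s h1 h2
        exact hagree ε hεt s h1 h2
      · exact (hd t h0 ht.2).continuousAt.continuousWithinAt
  refine ⟨T, h, hT, hmain, ?_⟩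
  intro τ hτ y hy hlim
  rw [hτ] at hmain hT
  obtain ⟨T', hT', k, hk⟩ := hmain.extend hU hf (EReal.coe_pos.1 hT) hy hlim
  have := hle T' ⟨(EReal.coe_pos.1 hT).trans hT', k, hk⟩
  rw [hτ, EReal.coe_le_coe_iff] at this
  linarith

end IsSolution

end ODE

/-! ### Closest pairs of pieces without common endpoint -/

theorem eq_zero_of_inner_two {u v w : Plane} (hu : ‖u‖ = 1) (hv : ‖v‖ = 1)
    (huv : (inner ℝ u v : ℝ) = -1 / 2) (h1 : (inner ℝ w u : ℝ) = 0) (h2 : (inner ℝ w v : ℝ) = 0) :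
    w = 0 := by
  rw [← inner_self_eq_zero (𝕜 := ℝ)]
  nth_rewrite 2 [decomp_two hu hv huv w]
  rw [inner_add_right, real_inner_smul_right, real_inner_smul_right, h1, h2, mul_zero, mul_zero,
    add_zero]

/-- The two endpoints of a segment. -/
theorem exists_other_end (hS : IsSimple S) {i : ι} {X : Plane} (hi : (S i).IsSegment)
    (hX : (S i).IsEndpoint X) :
    ∃ X', (S i).IsEndpoint X' ∧ X' ≠ X ∧ (∀ Y, (S i).IsEndpoint Y → Y = X ∨ Y = X') ∧
      (S i).dirAt X' = -(S i).dirAt X ∧ (S i).sgn X' = -(S i).sgn X ∧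
      (∀ v ∈ heightSpace S,
        movedVertex S v X' = movedVertex S v X + deformedLength S v i • (S i).dirAt X) ∧
      ∀ f : Plane → ℝ,
        ∑ Y ∈ vertices S, (S i).sgn Y • f Y = (S i).sgn X * f X + (S i).sgn X' * f X' := by
  obtain ⟨L, hL⟩ := hi
  have hLpos := (hS.nondegenerate i).2 L hL
  have hne : (S i).point L ≠ (S i).base := by
    intro h
    have := Piece.dist_point (hS.nondegenerate i) L 0
    rw [h, Piece.point_zero, dist_self, Real.dist_eq, sub_zero, abs_of_pos hLpos] at this
    linarith
  have s0 := (hS.nondegenerate i).sgn_start (Piece.startPt_segment hL)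
  have s1 := (hS.nondegenerate i).sgn_end (Piece.endPt_segment hL)
  have hmove : ∀ v ∈ heightSpace S, movedVertex S v ((S i).point L) =
      movedVertex S v (S i).base + deformedLength S v i • (S i).tangent := by
    intro v hv
    rw [← deform_point hS hv hL]; rfl
  rcases (Piece.isEndpoint_segment_iff hL).1 hX with rfl | rfl
  · refine ⟨_, Piece.isEndpoint_point hL, hne, fun Y hY => (Piece.isEndpoint_segment_iff hL).1 hY,
      ?_, by rw [s0, s1], fun v hv => ?_, fun f => ?_⟩
    · rw [Piece.dirAt, Piece.dirAt, s0, s1]; simp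
    · rw [Piece.dirAt, s0, one_smul, hmove v hv]
    · rw [sum_sgn_smul_segment f hL, s0, s1]; ring
  · refine ⟨_, (S i).isEndpoint_base, hne.symm,
      fun Y hY => ((Piece.isEndpoint_segment_iff hL).1 hY).symm, ?_, by rw [s0, s1]; simp,
      fun v hv => ?_, fun f => ?_⟩
    · rw [Piece.dirAt, Piece.dirAt, s0, s1]; simp
    · rw [Piece.dirAt, s1, hmove v hv]; module
    · rw [sum_sgn_smul_segment f hL, s0, s1]; ring

/-- The direction of the piece `i` at its base. -/
def rootDir (S : ι → Piece) (i : ι) : Plane := (S i).dirAt (S i).base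

theorem norm_rootDir (hS : IsSimple S) (i : ι) : ‖rootDir S i‖ = 1 :=
  (hS.nondegenerate i).norm_dirAt (S i).isEndpoint_base

open Classical in
/-- Length of the piece `i`, half-lines being truncated at distance `R` from the original base. -/
def reach (S : ι → Piece) (R : ℝ) (v : ι → ℝ) (i : ι) : ℝ :=
  if (S i).IsSegment then deformedLength S v i
  else R - inner ℝ (vertexShift S v (S i).base) (rootDir S i)

theorem reach_segment {i : ι} (h : (S i).IsSegment) (R : ℝ) (v : ι → ℝ) :
    reach S R v i = deformedLength S v i := if_pos h

theorem reach_halfLine {i : ι} (h : ¬ (S i).IsSegment) (R : ℝ) (v : ι → ℝ) :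
    reach S R v i = R - inner ℝ (vertexShift S v (S i).base) (rootDir S i) := if_neg h

/-- The truncated piece `i` of the network with heights `v`. -/
def body (S : ι → Piece) (R : ℝ) (v : ι → ℝ) (i : ι) : Set Plane :=
  {x | ∃ s, 0 ≤ s ∧ s ≤ reach S R v i ∧ x = movedVertex S v (S i).base + s • rootDir S i}

/-- The pieces `i` and `j` have no common endpoint. -/
def Apart (S : ι → Piece) (i j : ι) : Prop := ∀ X, ¬ ((S i).IsEndpoint X ∧ (S j).IsEndpoint X)

theorem Apart.symm {i j : ι} (h : Apart S i j) : Apart S j i := fun X hX => h X hX.symm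

structure IsClosestPair (S : ι → Piece) (R : ℝ) (v : ι → ℝ) (i j : ι) (x y : Plane) : Prop where
  apart : Apart S i j
  left : x ∈ body S R v i
  right : y ∈ body S R v j
  le : ∀ i' j', Apart S i' j' → ∀ x' ∈ body S R v i', ∀ y' ∈ body S R v j', ‖y - x‖ ≤ ‖y' - x'‖

theorem IsClosestPair.symm {R : ℝ} {v : ι → ℝ} {i j : ι} {x y : Plane}
    (h : IsClosestPair S R v i j x y) : IsClosestPair S R v j i y x :=
  ⟨h.apart.symm, h.right, h.left, fun i' j' hij x' hx y' hy => by
    rw [norm_sub_rev]; exact (h.le i' j' hij x' hx y' hy)⟩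

section Closest

variable {R ℓ : ℝ} {v κ : ι → ℝ} {α : Plane → ℝ} {i j : ι} {x y : Plane}

theorem mem_body_iff (hS : IsSimple S) (hv : v ∈ heightSpace S) {X : Plane}
    (hX : (S i).IsEndpoint X) : x ∈ body S R v i ↔
      ∃ s, 0 ≤ s ∧ s ≤ reach S R v i ∧ x = movedVertex S v X + s • (S i).dirAt X := by
  by_cases hi : (S i).IsSegment
  · obtain ⟨X', hX', hne, honly, hdir, -, hmove, -⟩ := exists_other_end hS hi hX
    rcases honly _ (S i).isEndpoint_base with h | h
    · subst h; rfl
    · subst h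
      rw [body, mem_ofPred_eq, rootDir, hdir, hmove v hv, reach_segment hi]
      constructor
      · rintro ⟨s, h0, h1, rfl⟩
        exact ⟨deformedLength S v i - s, by linarith, by linarith, by module⟩
      · rintro ⟨s, h0, h1, rfl⟩
        exact ⟨deformedLength S v i - s, by linarith, by linarith, by module⟩
  · rw [(Piece.isEndpoint_halfLine_iff hi).1 hX]; rfl

theorem IsClosestPair.inner_dirAt_nonpos (hS : IsSimple S) (hv : v ∈ heightSpace S)
    (hreach : ∀ i, 0 < reach S R v i) (hℓ : ∀ i, (S i).IsSegment → ℓ ≤ deformedLength S v i)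
    (h : IsClosestPair S R v i j x y) (hlt : ‖y - x‖ < ℓ) {X : Plane} (hX : (S i).IsEndpoint X)
    (hx : x = movedVertex S v X) {k : ι} (hk : (S k).IsEndpoint X) :
    (inner ℝ (y - x) ((S k).dirAt X) : ℝ) ≤ 0 := by
  by_cases hkj : Apart S k j
  · by_contra hpos
    push Not at hpos
    set d := (S k).dirAt X
    set r := (inner ℝ (y - x) d : ℝ)
    have hd : ‖d‖ = 1 := (hS.nondegenerate k).norm_dirAt hk
    have hs : 0 < min (reach S R v k) r := lt_min (hreach k) hpos
    set s := min (reach S R v k) r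
    have hmem : x + s • d ∈ body S R v k :=
      (mem_body_iff hS hv hk).2 ⟨s, hs.le, min_le_left _ _, by rw [hx]⟩
    have h1 := h.le k j hkj _ hmem y h.right
    have h2 : ‖y - (x + s • d)‖ ^ 2 = ‖y - x‖ ^ 2 - 2 * (s * r) + s ^ 2 := by
      rw [← sub_sub, norm_sub_sq_real, real_inner_smul_right, norm_smul, hd, mul_one,
        Real.norm_eq_abs, sq_abs]
    have h3 : ‖y - x‖ ^ 2 ≤ ‖y - (x + s • d)‖ ^ 2 := pow_le_pow_left₀ (norm_nonneg _) h1 2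
    have h4 : s ≤ r := min_le_right _ _
    nlinarith
  · exfalso
    simp only [Apart, not_forall, not_not] at hkj
    obtain ⟨Z, hZk, hZj⟩ := hkj
    have hZX : X ≠ Z := by rintro rfl; exact h.apart X ⟨hX, hZj⟩
    have hkseg : (S k).IsSegment := by
      by_contra hk'
      exact hZX (((Piece.isEndpoint_halfLine_iff hk').1 hk).trans
        ((Piece.isEndpoint_halfLine_iff hk').1 hZk).symm)
    obtain ⟨Z', -, -, honly, -, -, hmove, -⟩ := exists_other_end hS hkseg hZk
    have hXZ' := (honly X hk).resolve_left hZX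
    subst hXZ'
    have hkj' : j ≠ k := by rintro rfl; exact h.apart X ⟨hX, hk⟩
    obtain ⟨s, hs0, -, hy⟩ := (mem_body_iff hS hv hZj).1 h.right
    have hin := hS.inner_dirAt hkj' hZj hZk
    have hdj := (hS.nondegenerate j).norm_dirAt hZj
    have hdk := (hS.nondegenerate k).norm_dirAt hZk
    have hlen := hℓ k hkseg
    rw [hmove v hv] at hx
    set l := deformedLength S v k
    have h2 : ‖y - x‖ ^ 2 = s ^ 2 + s * l + l ^ 2 := by
      rw [hy, hx, add_sub_add_left_eq_sub, norm_sub_sq_real, real_inner_smul_left,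
        real_inner_smul_right, hin, norm_smul, norm_smul, hdj, hdk, mul_one, mul_one,
        Real.norm_eq_abs, Real.norm_eq_abs, sq_abs, sq_abs]
      ring
    have hl : 0 < l := lt_of_lt_of_le (lt_of_le_of_lt (norm_nonneg _) hlt) hlen
    have : ‖y - x‖ ^ 2 < l ^ 2 :=
      pow_lt_pow_left₀ (hlt.trans_le hlen) (norm_nonneg _) two_ne_zero
    nlinarith [mul_nonneg hs0 hl.le]

theorem IsClosestPair.exists_isPair (hS : IsSimple S) (hv : v ∈ heightSpace S)
    (hreach : ∀ i, 0 < reach S R v i) (hℓ : ∀ i, (S i).IsSegment → ℓ ≤ deformedLength S v i)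
    (h : IsClosestPair S R v i j x y) (hlt : ‖y - x‖ < ℓ) (hne : y - x ≠ 0) {X : Plane}
    (hX : (S i).IsEndpoint X) (hx : x = movedVertex S v X) :
    ∃ i', IsPair S X i i' ∧ (inner ℝ (y - x) ((S i).dirAt X) : ℝ) ≤ 0 ∧
      (inner ℝ (y - x) ((S i').dirAt X) : ℝ) ≤ 0 := by
  have key : ∀ {k}, (S k).IsEndpoint X → (inner ℝ (y - x) ((S k).dirAt X) : ℝ) ≤ 0 := fun hk =>
    h.inner_dirAt_nonpos hS hv hreach hℓ hlt hX hx hk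
  rcases hS.degree_eq hX with hd | hd
  · obtain ⟨i', hp⟩ := hS.exists_pair hX hd
    exact ⟨i', hp, key hX, key hp.right⟩
  · exfalso
    obtain ⟨k, l, ht⟩ := hS.exists_triple hX hd
    have hsum := ht.sum_dirAt hS
    rw [ht.sum_eq fun m hm => dirAt_eq_zero hm] at hsum
    have h0 : (inner ℝ (y - x) ((S i).dirAt X + (S k).dirAt X + (S l).dirAt X) : ℝ) = 0 := by
      rw [hsum, inner_zero_right]
    rw [inner_add_right, inner_add_right] at h0
    have h1 := key ht.first
    have h2 := key ht.second
    have h3 := key ht.third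
    exact hne (eq_zero_of_inner_two ((hS.nondegenerate i).norm_dirAt ht.first)
      ((hS.nondegenerate k).norm_dirAt ht.second) ht.inner_ij (by linarith) (by linarith))

/-- A simple vertex moves into the cone spanned by its two pieces. -/
theorem IsDriven.exists_cone {len : ι → ℝ} (hS : IsSimple S)
    (hlen : ∀ i, (S i).IsSegment → 0 < len i)
    (h : IsDriven S len κ α) {X : Plane} {i i' : ι} (hp : IsPair S X i i') :
    ∃ a b : ℝ, 0 ≤ a ∧ 0 ≤ b ∧
      vertexShift S (-κ) X = a • (S i).dirAt X + b • (S i').dirAt X := by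
  have hmem : -κ ∈ heightSpace S := neg_mem h.mem
  have key : ∀ {k l}, IsPair S X k l → 0 ≤ (4 / 3) * ((inner ℝ (rot ((S k).dirAt X))
      ((S l).dirAt X) : ℝ) * inner ℝ (rot ((S k).dirAt X)) (vertexShift S (-κ) X)) := by
    intro k l hkl
    have e := inner_vertexShift_of_mem hS hmem hkl.left
    rw [Pi.neg_apply] at e
    rw [← Piece.norAt_eq_rot, Piece.norAt, real_inner_smul_left, real_inner_smul_left,
      real_inner_comm (vertexShift S (-κ) X) (S k).normal, e]
    have hs := (hS.nondegenerate k).sgn_mul_self hkl.left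
    have hsign : 0 ≤ -κ k * (inner ℝ (S k).normal ((S l).dirAt X) : ℝ) := by
      by_cases hk : (S k).IsSegment
      · exact h.inner_normal_dirAt_nonneg hS hk (hlen k hk) hkl
      · rw [h.mem.1 k hk]; simp
    nlinarith
  refine ⟨_, _, key hp.symm, key hp, ?_⟩
  exact decomp_two ((hS.nondegenerate i).norm_dirAt hp.left)
    ((hS.nondegenerate i').norm_dirAt hp.right) hp.inner_eq _

theorem IsClosestPair.inner_vertexShift_nonpos (hS : IsSimple S) (hv : v ∈ heightSpace S)
    (hreach : ∀ i, 0 < reach S R v i) (hℓ : ∀ i, (S i).IsSegment → ℓ ≤ deformedLength S v i)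
    (hdr : IsDriven S (deformedLength S v) κ α)
    (h : IsClosestPair S R v i j x y) (hlt : ‖y - x‖ < ℓ) (hne : y - x ≠ 0) {X : Plane}
    (hX : (S i).IsEndpoint X) (hx : x = movedVertex S v X) :
    (inner ℝ (y - x) (vertexShift S (-κ) X) : ℝ) ≤ 0 := by
  have hℓpos : 0 < ℓ := (norm_nonneg _).trans_lt hlt
  obtain ⟨i', hp, h1, h2⟩ := h.exists_isPair hS hv hreach hℓ hlt hne hX hx
  obtain ⟨a, b, ha, hb, hab⟩ := hdr.exists_cone hS (fun i hi => hℓpos.trans_le (hℓ i hi)) hp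
  rw [hab, inner_add_right, real_inner_smul_right, real_inner_smul_right]
  nlinarith

theorem sq_inner_normal {w : Plane} (hS : IsSimple S)
    (hw : (inner ℝ w (S i).tangent : ℝ) = 0) :
    (inner ℝ w (S i).normal : ℝ) ^ 2 = ‖w‖ ^ 2 ∧ w = (inner ℝ w (S i).normal : ℝ) • (S i).normal := by
  have hu := (hS.nondegenerate i).1
  have h1 := plane_decomp hu w
  rw [hw, zero_smul, zero_add] at h1
  refine ⟨?_, h1⟩
  have h2 := inner_decomp hu w w
  rw [hw, mul_zero, zero_add, real_inner_self_eq_norm_sq] at h2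
  rw [h2, sq]; rfl

/-- At an end of a segment facing another piece, the network bends away. -/
theorem IsClosestPair.bend (hS : IsSimple S) (hv : v ∈ heightSpace S)
    (hreach : ∀ i, 0 < reach S R v i) (hℓ : ∀ i, (S i).IsSegment → ℓ ≤ deformedLength S v i)
    (hα : ∀ X, degree S X ≠ 3 → α X = 0)
    (h : IsClosestPair S R v i j x y) (hlt : ‖y - x‖ < ℓ) (hne : y - x ≠ 0) {X : Plane}
    (hX : (S i).IsEndpoint X) (hx : x = movedVertex S v X)
    (hperp : (inner ℝ (y - x) (S i).tangent : ℝ) = 0) :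
    (S i).sgn X * (vertexValue S i X + α X) * inner ℝ (y - x) (S i).normal =
      -(halfFacet * ‖y - x‖) := by
  obtain ⟨i', hp, -, h2⟩ := h.exists_isPair hS hv hreach hℓ hlt hne hX hx
  obtain ⟨hA, hw⟩ := sq_inner_normal hS hperp
  have hsq := hp.norAt_inner_sq hS
  have hs := (hS.nondegenerate i).sgn_mul_self hX
  rw [hα X (by have := hp.degree; omega), add_zero, hp.vertexValue_left]
  rw [hw, real_inner_smul_left] at h2
  rw [Piece.norAt, real_inner_smul_left] at hsq ⊢
  set A := (inner ℝ (y - x) (S i).normal : ℝ)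
  set B := (inner ℝ (S i).normal ((S i').dirAt X) : ℝ)
  set σ := (S i).sgn X
  have hB : B ^ 2 = 3 / 4 := by
    have : (σ * B) ^ 2 = (σ * σ) * B ^ 2 := by ring
    rw [this, hs, one_mul] at hsq
    exact hsq
  have hAB : (-(A * B)) = 3 / 2 * halfFacet * ‖y - x‖ := by
    have h3 : (-(A * B)) ^ 2 = (3 / 2 * halfFacet * ‖y - x‖) ^ 2 := by
      have := halfFacet_sq
      rw [neg_sq, mul_pow, hA, hB]
      linear_combination (-9 / 4 * ‖y - x‖ ^ 2) * this
    refine (sq_eq_sq₀ (by linarith) ?_).1 h3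
    have := halfFacet_pos
    positivity
  linear_combination (2 / 3 * A * B) * hs - 2 / 3 * hAB

theorem abs_sgn_potential_mul_le (hS : IsSimple S) {len : ι → ℝ} (hdr : IsDriven S len κ α)
    {X w : Plane} (hX : (S i).IsEndpoint X) :
    |(S i).sgn X * (vertexValue S i X + α X) * inner ℝ w (S i).normal| ≤ halfFacet * ‖w‖ := by
  have h1 : |(S i).sgn X| = 1 := by
    rcases (hS.nondegenerate i).sgn_eq hX with h | h <;> rw [h] <;> simp
  rw [abs_mul, abs_mul, h1, one_mul]
  have h2 : |(inner ℝ w (S i).normal : ℝ)| ≤ ‖w‖ :=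
    abs_inner_unit_le (by rw [Piece.normal, norm_rot]; exact (hS.nondegenerate i).1) w
  exact mul_le_mul (hdr.abs_potential_le hS hX) h2 (abs_nonneg _) halfFacet_pos.le

/-- Coordinates on a truncated piece, seen from one of its points. -/
theorem exists_coords (hS : IsSimple S) (hv : v ∈ heightSpace S) (hx : x ∈ body S R v i)
    {u : Plane} (hu : u = rootDir S i ∨ u = -rootDir S i) :
    ∃ a b : ℝ, a ≤ 0 ∧ 0 ≤ b ∧ b - a = reach S R v i ∧
      (∀ s, a ≤ s → s ≤ b → x + s • u ∈ body S R v i) ∧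
      ((S i).IsSegment → ∃ X X', (S i).IsEndpoint X ∧ (S i).IsEndpoint X' ∧
        x + b • u = movedVertex S v X ∧ x + a • u = movedVertex S v X' ∧
        ∀ f : Plane → ℝ,
          ∑ Y ∈ vertices S, (S i).sgn Y • f Y = (S i).sgn X * f X + (S i).sgn X' * f X') ∧
      (u = rootDir S i →
        x + b • u = movedVertex S v (S i).base + reach S R v i • rootDir S i) := by
  obtain ⟨s, h0, h1, rfl⟩ := hx
  have hends : (S i).IsSegment → ∃ X', (S i).IsEndpoint X' ∧
      movedVertex S v X' = movedVertex S v (S i).base + reach S R v i • rootDir S i ∧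
      ∀ f : Plane → ℝ, ∑ Y ∈ vertices S, (S i).sgn Y • f Y =
        (S i).sgn (S i).base * f (S i).base + (S i).sgn X' * f X' := by
    intro hi
    obtain ⟨X', hX', -, -, -, -, hm, hf⟩ := exists_other_end hS hi (S i).isEndpoint_base
    exact ⟨X', hX', by rw [hm v hv, reach_segment hi]; rfl, hf⟩
  rcases hu with rfl | rfl
  · refine ⟨-s, reach S R v i - s, by linarith, by linarith, by ring, ?_, ?_, ?_⟩
    · intro r hr1 hr2
      exact ⟨s + r, by linarith, by linarith, by module⟩
    · intro hi
      obtain ⟨X', hX', hm, hf⟩ := hends hi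
      refine ⟨X', _, hX', (S i).isEndpoint_base, by rw [hm]; module, by module, fun f => ?_⟩
      rw [hf, add_comm]
    · intro _; module
  · refine ⟨-(reach S R v i - s), s, by linarith, by linarith, by ring, ?_, ?_, ?_⟩
    · intro r hr1 hr2
      exact ⟨s - r, by linarith, by linarith, by module⟩
    · intro hi
      obtain ⟨X', hX', hm, hf⟩ := hends hi
      exact ⟨_, X', (S i).isEndpoint_base, hX', by module, by rw [hm]; module, hf⟩
    · intro hu
      have h2 : rootDir S i = 0 := by
        have := congrArg (fun z => (1 / 2 : ℝ) • (rootDir S i - z)) hu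
        simp only [sub_self, smul_zero, sub_neg_eq_add] at this
        rw [← this]; module
      have := norm_rootDir hS i
      rw [h2, norm_zero] at this
      norm_num at this

theorem rootDir_eq_or (hS : IsSimple S) (i : ι) :
    rootDir S i = (S i).tangent ∨ rootDir S i = -(S i).tangent := by
  rw [rootDir, Piece.dirAt]
  rcases (hS.nondegenerate i).sgn_eq (S i).isEndpoint_base with h | h <;> rw [h]
  · left; simp
  · right; simp

theorem eq_or_eq_neg_of_inner_zero {w u u' : Plane} (hu : ‖u‖ = 1) (hu' : ‖u'‖ = 1) (hw : w ≠ 0)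
    (h : (inner ℝ w u : ℝ) = 0) (h' : (inner ℝ w u' : ℝ) = 0) : u = u' ∨ u = -u' := by
  have h1 := plane_decomp hu' u
  have h2 : (inner ℝ u (rot u') : ℝ) = 0 := by
    have h3 := inner_decomp hu' w u
    rw [h, h', zero_mul, zero_add] at h3
    rcases mul_eq_zero.1 h3.symm with h4 | h4
    · exact absurd (plane_ext_inner hu' (by rw [h', inner_zero_left])
        (by rw [h4, inner_zero_left])) hw
    · exact h4
  rw [h2, zero_smul, add_zero] at h1
  have h5 : (inner ℝ u u' : ℝ) ^ 2 = 1 := by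
    have := congrArg norm h1
    rw [hu, norm_smul, hu', mul_one, Real.norm_eq_abs] at this
    rw [← sq_abs, ← this, one_pow]
  rcases eq_one_or_neg_one_of_sq h5 with h6 | h6
  · left; rw [h1, h6, one_smul]
  · right; rw [h1, h6, neg_one_smul]

theorem inner_rootDir_of_tangent (hS : IsSimple S) {w : Plane}
    (hw : (inner ℝ w (S i).tangent : ℝ) = 0) : (inner ℝ w (rootDir S i) : ℝ) = 0 := by
  rcases rootDir_eq_or hS i with h | h <;> simp [h, hw]

/-- Two closest parallel pieces do not approach each other. -/
theorem IsClosestPair.parallel (hS : IsSimple S) (hv : v ∈ heightSpace S)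
    (hreach : ∀ i, 0 < reach S R v i) (hℓ : ∀ i, (S i).IsSegment → ℓ ≤ deformedLength S v i)
    (hfar : ∀ i j, ¬ (S i).IsSegment → (S j).IsSegment → ∀ z ∈ body S R v j,
      ℓ ≤ ‖z - (movedVertex S v (S i).base + reach S R v i • rootDir S i)‖)
    (hdr : IsDriven S (deformedLength S v) κ α)
    (h : IsClosestPair S R v i j x y) (hlt : ‖y - x‖ < ℓ) (hne : y - x ≠ 0)
    (hi : (inner ℝ (y - x) (S i).tangent : ℝ) = 0) (hj : (inner ℝ (y - x) (S j).tangent : ℝ) = 0) :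
    κ j * inner ℝ (y - x) (S j).normal ≤ κ i * inner ℝ (y - x) (S i).normal := by
  have hℓpos : 0 < ℓ := (norm_nonneg _).trans_lt hlt
  have hlen : ∀ i, (S i).IsSegment → 0 < deformedLength S v i := fun i hi =>
    hℓpos.trans_le (hℓ i hi)
  have hparaj := eq_or_eq_neg_of_inner_zero (norm_rootDir hS i) (norm_rootDir hS j) hne
    (inner_rootDir_of_tangent hS hi) (inner_rootDir_of_tangent hS hj)
  have hpari := eq_or_eq_neg_of_inner_zero (norm_rootDir hS j) (norm_rootDir hS i) hne
    (inner_rootDir_of_tangent hS hj) (inner_rootDir_of_tangent hS hi)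
  -- moving both points along the common direction
  have shift : ∀ {z : Plane}, x + z ∈ body S R v i → y + z ∈ body S R v j →
      IsClosestPair S R v i j (x + z) (y + z) := fun h1 h2 =>
    ⟨h.apart, h1, h2, fun i' j' hij x' hx y' hy => by
      rw [add_sub_add_right_eq_sub]; exact h.le i' j' hij x' hx y' hy⟩
  have hwz : ∀ z : Plane, y + z - (x + z) = y - x := fun z => add_sub_add_right_eq_sub _ _ _
  have hwz' : ∀ z : Plane, x + z - (y + z) = x - y := fun z => add_sub_add_right_eq_sub _ _ _
  have hneg : x - y = -(y - x) := (neg_sub _ _).symm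
  have bendi : ∀ {z X : Plane}, x + z ∈ body S R v i → y + z ∈ body S R v j →
      (S i).IsEndpoint X → x + z = movedVertex S v X →
      (S i).sgn X * (vertexValue S i X + α X) * inner ℝ (y - x) (S i).normal =
        -(halfFacet * ‖y - x‖) := by
    intro z X h1 h2 hX hx
    have := (shift h1 h2).bend hS hv hreach hℓ hdr.pair (by rwa [hwz]) (by rwa [hwz]) hX hx
      (by rwa [hwz])
    rwa [hwz] at this
  have bendj : ∀ {z X : Plane}, x + z ∈ body S R v i → y + z ∈ body S R v j →
      (S j).IsEndpoint X → y + z = movedVertex S v X →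
      (S j).sgn X * (vertexValue S j X + α X) * inner ℝ (y - x) (S j).normal =
        halfFacet * ‖y - x‖ := by
    intro z X h1 h2 hX hx
    have := (shift h1 h2).symm.bend hS hv hreach hℓ hdr.pair
      (by rw [hwz', norm_sub_rev]; exact hlt) (by rw [hwz', hneg]; exact neg_ne_zero.2 hne) hX hx
      (by rw [hwz', hneg, inner_neg_left, hj, neg_zero])
    rw [hwz', hneg, inner_neg_left, norm_neg] at this
    linarith
  have hW : 0 < ‖y - x‖ := norm_pos_iff.2 hne
  have hcW := mul_pos halfFacet_pos hW
  by_cases hsi : (S i).IsSegment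
  · by_cases hsj : (S j).IsSegment
    · obtain ⟨a, b, ha, hb, hab, hmemi, hvi, -⟩ := exists_coords hS hv h.left (Or.inl rfl)
      obtain ⟨a', b', ha', hb', hab', hmemj, hvj, -⟩ := exists_coords hS hv h.right hparaj
      obtain ⟨X, X', hX, hX', hxb, hxa, hfi⟩ := hvi hsi
      obtain ⟨Y, Y', hY, hY', hyb, hya, hfj⟩ := hvj hsj
      rw [reach_segment hsi] at hab
      rw [reach_segment hsj] at hab'
      have hli := hlen i hsi
      have hlj := hlen j hsj
      have di := hdr.drop i hsi
      have dj := hdr.drop j hsj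
      rw [hfi fun X => vertexValue S i X + α X] at di
      rw [hfj fun X => vertexValue S j X + α X] at dj
      set A := (inner ℝ (y - x) (S i).normal : ℝ)
      set B := (inner ℝ (y - x) (S j).normal : ℝ)
      have di' : κ i * A * (b - a) =
          -((S i).sgn X * (vertexValue S i X + α X) * A) -
            (S i).sgn X' * (vertexValue S i X' + α X') * A := by
        rw [hab]; linear_combination A * di
      have dj' : κ j * B * (b' - a') =
          -((S j).sgn Y * (vertexValue S j Y + α Y) * B) -
            (S j).sgn Y' * (vertexValue S j Y' + α Y') * B := by
        rw [hab']; linear_combination B * dj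
      have bX := abs_le.1 (abs_sgn_potential_mul_le hS hdr (w := y - x) hX)
      have bX' := abs_le.1 (abs_sgn_potential_mul_le hS hdr (w := y - x) hX')
      have bY := abs_le.1 (abs_sgn_potential_mul_le hS hdr (w := y - x) hY)
      have bY' := abs_le.1 (abs_sgn_potential_mul_le hS hdr (w := y - x) hY')
      have hright : b ≤ b' → (S i).sgn X * (vertexValue S i X + α X) * A =
          -(halfFacet * ‖y - x‖) := fun hbb =>
        bendi (hmemi b (by linarith) le_rfl) (hmemj b (by linarith) hbb) hX hxb
      have hright' : b' ≤ b → (S j).sgn Y * (vertexValue S j Y + α Y) * B =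
          halfFacet * ‖y - x‖ := fun hbb =>
        bendj (hmemi b' (by linarith) hbb) (hmemj b' (by linarith) le_rfl) hY hyb
      have hleft : a' ≤ a → (S i).sgn X' * (vertexValue S i X' + α X') * A =
          -(halfFacet * ‖y - x‖) := fun haa =>
        bendi (hmemi a le_rfl (by linarith)) (hmemj a haa (by linarith)) hX' hxa
      have hleft' : a ≤ a' → (S j).sgn Y' * (vertexValue S j Y' + α Y') * B =
          halfFacet * ‖y - x‖ := fun haa =>
        bendj (hmemi a' haa (by linarith)) (hmemj a' le_rfl (by linarith)) hY' hya
      have hbi : 0 < b - a := by linarith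
      have hbj : 0 < b' - a' := by linarith
      rcases le_total b b' with hbb | hbb <;> rcases le_total a a' with haa | haa
      · have e1 := hright hbb
        have e2 := hleft' haa
        have p1 : 0 ≤ κ i * A * (b - a) := by linarith [bX'.2]
        have p2 : κ j * B * (b' - a') ≤ 0 := by linarith [bY.1]
        have q1 := nonneg_of_mul_nonneg_left p1 hbi
        have q2 := nonpos_of_mul_nonpos_left p2 hbj
        linarith
      · have e1 := hright hbb
        have e2 := hleft haa
        have p1 : κ i * A * (b - a) = 2 * (halfFacet * ‖y - x‖) := by linarith
        have p2 : κ j * B * (b' - a') ≤ 2 * (halfFacet * ‖y - x‖) := by linarith [bY.1, bY'.1]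
        by_contra hcon
        push Not at hcon
        have : 0 < κ i * A := by
          by_contra hc; push Not at hc
          have := mul_nonpos_of_nonpos_of_nonneg hc hbi.le
          linarith
        have l1 : κ i * A * (b - a) ≤ κ i * A * (b' - a') :=
          mul_le_mul_of_nonneg_left (by linarith) this.le
        have l2 : κ i * A * (b' - a') < κ j * B * (b' - a') := mul_lt_mul_of_pos_right hcon hbj
        linarith
      · have e1 := hright' hbb
        have e2 := hleft' haa
        have p1 : κ j * B * (b' - a') = -2 * (halfFacet * ‖y - x‖) := by linarith
        have p2 : -2 * (halfFacet * ‖y - x‖) ≤ κ i * A * (b - a) := by linarith [bX.2, bX'.2]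
        by_contra hcon
        push Not at hcon
        have : κ j * B < 0 := by
          by_contra hc; push Not at hc
          have := mul_nonneg hc hbj.le
          linarith
        have l1 : κ j * B * (b - a) ≤ κ j * B * (b' - a') :=
          mul_le_mul_of_nonpos_left (by linarith) this.le
        have l2 : κ i * A * (b - a) < κ j * B * (b - a) := mul_lt_mul_of_pos_right hcon hbi
        linarith
      · have e1 := hright' hbb
        have e2 := hleft haa
        have p1 : 0 ≤ κ i * A * (b - a) := by linarith [bX.2]
        have p2 : κ j * B * (b' - a') ≤ 0 := by linarith [bY'.1]
        have q1 := nonneg_of_mul_nonneg_left p1 hbi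
        have q2 := nonpos_of_mul_nonpos_left p2 hbj
        linarith
    · rw [hdr.mem.1 j hsj, zero_mul]
      obtain ⟨a, b, ha, hb, hab, hmemi, hvi, -⟩ := exists_coords hS hv h.left hpari
      obtain ⟨a', b', ha', hb', hab', hmemj, -, htip⟩ := exists_coords hS hv h.right (Or.inl rfl)
      obtain ⟨X, X', hX, hX', hxb, hxa, hfi⟩ := hvi hsi
      have hbb : b ≤ b' := by
        by_contra hbb
        push Not at hbb
        have h1 := hfar j i hsj hsi _ (hmemi b' (by linarith) hbb.le)
        rw [← htip rfl, add_sub_add_right_eq_sub, norm_sub_rev] at h1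
        linarith
      have e1 := bendi (hmemi b (by linarith) le_rfl) (hmemj b (by linarith) hbb) hX hxb
      have di := hdr.drop i hsi
      rw [hfi fun X => vertexValue S i X + α X] at di
      have bX' := abs_le.1 (abs_sgn_potential_mul_le hS hdr (w := y - x) hX')
      have p1 : 0 ≤ κ i * inner ℝ (y - x) (S i).normal * deformedLength S v i := by
        have : κ i * inner ℝ (y - x) (S i).normal * deformedLength S v i =
          -((S i).sgn X * (vertexValue S i X + α X) * inner ℝ (y - x) (S i).normal) -
            (S i).sgn X' * (vertexValue S i X' + α X') * inner ℝ (y - x) (S i).normal := by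
          linear_combination (inner ℝ (y - x) (S i).normal : ℝ) * di
        linarith [bX'.2]
      exact nonneg_of_mul_nonneg_left p1 (hlen i hsi)
  · rw [hdr.mem.1 i hsi, zero_mul]
    by_cases hsj : (S j).IsSegment
    · obtain ⟨a, b, ha, hb, hab, hmemi, -, htip⟩ := exists_coords hS hv h.left (Or.inl rfl)
      obtain ⟨a', b', ha', hb', hab', hmemj, hvj, -⟩ := exists_coords hS hv h.right hparaj
      obtain ⟨Y, Y', hY, hY', hyb, hya, hfj⟩ := hvj hsj
      have hbb : b' ≤ b := by
        by_contra hbb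
        push Not at hbb
        have h1 := hfar i j hsi hsj _ (hmemj b (by linarith) hbb.le)
        rw [← htip rfl, add_sub_add_right_eq_sub] at h1
        linarith
      have e1 := bendj (hmemi b' (by linarith) hbb) (hmemj b' (by linarith) le_rfl) hY hyb
      have dj := hdr.drop j hsj
      rw [hfj fun X => vertexValue S j X + α X] at dj
      have bY' := abs_le.1 (abs_sgn_potential_mul_le hS hdr (w := y - x) hY')
      have p1 : κ j * inner ℝ (y - x) (S j).normal * deformedLength S v j ≤ 0 := by
        have : κ j * inner ℝ (y - x) (S j).normal * deformedLength S v j =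
          -((S j).sgn Y * (vertexValue S j Y + α Y) * inner ℝ (y - x) (S j).normal) -
            (S j).sgn Y' * (vertexValue S j Y' + α Y') * inner ℝ (y - x) (S j).normal := by
          linear_combination (inner ℝ (y - x) (S j).normal : ℝ) * dj
        linarith [bY'.1]
      exact nonpos_of_mul_nonpos_left p1 (hlen j hsj)
    · rw [hdr.mem.1 j hsj, zero_mul]

end Closest

/-! ### Variation of the distance of closest pieces -/

open Classical in
/-- Linear part of `reach`. -/
def reachLin (S : ι → Piece) (i : ι) : (ι → ℝ) →ₗ[ℝ] ℝ :=
  if h : ∃ L, (S i).extent = .segment L then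
    (innerₛₗ ℝ (S i).tangent) ∘ₗ
      (vertexShiftLin S ((S i).point h.choose) - vertexShiftLin S (S i).base)
  else -((innerₛₗ ℝ (rootDir S i)) ∘ₗ vertexShiftLin S (S i).base)

theorem reachLin_segment {i : ι} {L : ℝ} (h : (S i).extent = .segment L) (w : ι → ℝ) :
    reachLin S i w = inner ℝ (vertexShift S w ((S i).point L) - vertexShift S w (S i).base)
      (S i).tangent := by
  have h' : ∃ L, (S i).extent = .segment L := ⟨L, h⟩
  have hL : h'.choose = L := Extent.segment.inj (h'.choose_spec.symm.trans h)
  rw [reachLin, dif_pos h', hL, real_inner_comm]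
  rfl

theorem reachLin_halfLine {i : ι} (h : ¬ (S i).IsSegment) (w : ι → ℝ) :
    reachLin S i w = -inner ℝ (vertexShift S w (S i).base) (rootDir S i) := by
  have h' : ¬ ∃ L, (S i).extent = .segment L := h
  simp only [reachLin, h', dif_neg, not_false_eq_true]
  rw [real_inner_comm]
  rfl

theorem reach_eq (S : ι → Piece) (R : ℝ) (v : ι → ℝ) (i : ι) :
    reach S R v i = reach S R 0 i + reachLin S i v := by
  by_cases h : (S i).IsSegment
  · obtain ⟨L, hL⟩ := h
    rw [reach_segment ⟨L, hL⟩, reach_segment ⟨L, hL⟩, deformedLength_segment hL,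
      deformedLength_segment hL, reachLin_segment hL, vertexShift_zero, vertexShift_zero, sub_zero,
      inner_zero_left, add_zero]
  · rw [reach_halfLine h, reach_halfLine h, reachLin_halfLine h, vertexShift_zero, inner_zero_left]
    ring

theorem continuous_reach (S : ι → Piece) (R : ℝ) (i : ι) : Continuous fun v => reach S R v i := by
  have h : Continuous (reachLin S i) := (reachLin S i).continuous_of_finiteDimensional
  rw [show (fun v => reach S R v i) = fun v => reach S R 0 i + reachLin S i v from
    funext fun v => reach_eq S R v i]
  exact continuous_const.add h

/-- Affine parametrization of the truncated piece `i`. -/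
def bodyPoint (S : ι → Piece) (R : ℝ) (v : ι → ℝ) (i : ι) (r : ℝ) : Plane :=
  movedVertex S v (S i).base + (r * reach S R v i) • rootDir S i

/-- Velocity of `bodyPoint` when the heights have velocity `w`. -/
def bodyVel (S : ι → Piece) (w : ι → ℝ) (i : ι) (r : ℝ) : Plane :=
  vertexShift S w (S i).base + (r * reachLin S i w) • rootDir S i

theorem hasDerivAt_movedVertex {h : ℝ → ι → ℝ} {w : ι → ℝ} {t : ℝ} (hd : HasDerivAt h w t)
    (X : Plane) : HasDerivAt (fun s => movedVertex S (h s) X) (vertexShift S w X) t :=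
  ((LinearMap.toContinuousLinearMap (vertexShiftLin S X)).hasFDerivAt.comp_hasDerivAt t
    hd).const_add X

theorem hasDerivAt_bodyPoint {h : ℝ → ι → ℝ} {w : ι → ℝ} {t : ℝ} (hd : HasDerivAt h w t)
    (R : ℝ) (i : ι) (r : ℝ) :
    HasDerivAt (fun s => bodyPoint S R (h s) i r) (bodyVel S w i r) t := by
  have h2 : HasDerivAt (fun s => reach S R (h s) i) (reachLin S i w) t := by
    rw [show (fun s => reach S R (h s) i) = fun s => reach S R 0 i + reachLin S i (h s) from
      funext fun s => reach_eq S R (h s) i]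
    exact ((LinearMap.toContinuousLinearMap (reachLin S i)).hasFDerivAt.comp_hasDerivAt t
      hd).const_add _
  exact (hasDerivAt_movedVertex hd _).add ((h2.const_mul r).smul_const _)

theorem mem_body_iff_bodyPoint {R : ℝ} {v : ι → ℝ} {i : ι} (hreach : 0 < reach S R v i)
    {x : Plane} : x ∈ body S R v i ↔ ∃ r, 0 ≤ r ∧ r ≤ 1 ∧ x = bodyPoint S R v i r := by
  constructor
  · rintro ⟨s, h0, h1, rfl⟩
    refine ⟨s / reach S R v i, div_nonneg h0 hreach.le, (div_le_one hreach).2 h1, ?_⟩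
    rw [bodyPoint, div_mul_cancel₀ _ hreach.ne']
  · rintro ⟨r, h0, h1, rfl⟩
    exact ⟨_, mul_nonneg h0 hreach.le, mul_le_of_le_one_left hreach.le h1, rfl⟩

theorem bodyPoint_cases (hS : IsSimple S) {R : ℝ} {v w : ι → ℝ} (hv : v ∈ heightSpace S)
    (hw : w ∈ heightSpace S) {i : ι} {r : ℝ} (h0 : 0 ≤ r) (h1 : r ≤ 1) :
    (0 < r ∧ r < 1) ∨
    (∃ X, (S i).IsEndpoint X ∧ bodyPoint S R v i r = movedVertex S v X ∧
      bodyVel S w i r = vertexShift S w X) ∨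
    (¬ (S i).IsSegment ∧ r = 1 ∧ bodyVel S w i r = 0) := by
  rcases h0.eq_or_lt with rfl | h0
  · right; left
    exact ⟨_, (S i).isEndpoint_base, by simp [bodyPoint], by simp [bodyVel]⟩
  rcases h1.eq_or_lt with rfl | h1
  · right
    by_cases hi : (S i).IsSegment
    · left
      obtain ⟨X', hX', -, -, -, -, hm, -⟩ := exists_other_end hS hi (S i).isEndpoint_base
      refine ⟨X', hX', ?_, ?_⟩
      · rw [bodyPoint, hm v hv, reach_segment hi, one_mul]; rfl
      · have e1 := hm w hw
        have e0 := hm 0 (zero_mem _)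
        rw [← reach_segment hi 0, reach_eq] at e1
        rw [← reach_segment hi 0] at e0
        rw [movedVertex, movedVertex, vertexShift_zero, vertexShift_zero, add_zero, add_zero] at e0
        rw [movedVertex, movedVertex] at e1
        rw [bodyVel, one_mul]
        change _ + reachLin S i w • (S i).dirAt (S i).base = _
        have e2 : vertexShift S w X' = X' + vertexShift S w X' - X' := by abel
        rw [e1] at e2
        rw [e2, e0]; module
    · right
      refine ⟨hi, rfl, ?_⟩
      rw [bodyVel, one_mul, reachLin_halfLine hi]
      have hn := inner_vertexShift_of_mem hS hw (S i).isEndpoint_base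
      rw [hw.1 i hi] at hn
      have hd := plane_decomp (norm_rootDir hS i) (vertexShift S w (S i).base)
      have h3 : (inner ℝ (vertexShift S w (S i).base) (rot (rootDir S i)) : ℝ) = 0 := by
        rw [rootDir, ← Piece.norAt_eq_rot, Piece.norAt, real_inner_smul_right, hn, mul_zero]
      rw [h3, zero_smul, add_zero] at hd
      rw [neg_smul, ← hd, add_neg_cancel]
  · exact Or.inl ⟨h0, h1⟩

theorem inner_bodyVel (hS : IsSimple S) {w : ι → ℝ} (hw : w ∈ heightSpace S) {i : ι} (r : ℝ)
    {z : Plane} (hz : (inner ℝ z (S i).tangent : ℝ) = 0) :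
    (inner ℝ z (bodyVel S w i r) : ℝ) = w i * inner ℝ z (S i).normal := by
  rw [bodyVel, inner_add_right, real_inner_smul_right, inner_rootDir_of_tangent hS hz, mul_zero,
    add_zero]
  nth_rewrite 1 [(sq_inner_normal hS hz).2]
  rw [real_inner_smul_left, real_inner_comm (vertexShift S w (S i).base),
    inner_vertexShift_of_mem hS hw (S i).isEndpoint_base]
  ring

section Closest

variable {R ℓ : ℝ} {v κ : ι → ℝ} {α : Plane → ℝ} {i j : ι} {x y : Plane}

theorem IsClosestPair.inner_tangent_eq_zero (hS : IsSimple S) (hreach : ∀ i, 0 < reach S R v i)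
    (h : IsClosestPair S R v i j x y) {r : ℝ} (h0 : 0 < r) (h1 : r < 1)
    (hx : x = bodyPoint S R v i r) : (inner ℝ (y - x) (S i).tangent : ℝ) = 0 := by
  have hρ := hreach i
  have key : ∀ d : Plane, ‖d‖ = 1 → ∀ ε : ℝ, 0 < ε →
      (∀ s, 0 ≤ s → s ≤ ε → x + s • d ∈ body S R v i) → (inner ℝ (y - x) d : ℝ) ≤ 0 := by
    intro d hd ε hε hmem
    by_contra hpos
    push Not at hpos
    set p := (inner ℝ (y - x) d : ℝ)
    have hs : 0 < min ε p := lt_min hε hpos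
    set s := min ε p
    have h1 := h.le i j h.apart _ (hmem s hs.le (min_le_left _ _)) y h.right
    have h2 : ‖y - (x + s • d)‖ ^ 2 = ‖y - x‖ ^ 2 - 2 * (s * p) + s ^ 2 := by
      rw [← sub_sub, norm_sub_sq_real, real_inner_smul_right, norm_smul, hd, mul_one,
        Real.norm_eq_abs, sq_abs]
    have h3 : ‖y - x‖ ^ 2 ≤ ‖y - (x + s • d)‖ ^ 2 := pow_le_pow_left₀ (norm_nonneg _) h1 2
    have h4 : s ≤ p := min_le_right _ _
    nlinarith
  have hd := norm_rootDir hS i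
  have k1 := key (rootDir S i) hd ((1 - r) * reach S R v i) (mul_pos (by linarith) hρ) (by
    intro s hs0 hs1
    refine ⟨r * reach S R v i + s, by positivity, by linarith, ?_⟩
    rw [hx, bodyPoint]; module)
  have k2 := key (-rootDir S i) (by rw [norm_neg, hd]) (r * reach S R v i) (mul_pos h0 hρ) (by
    intro s hs0 hs1
    refine ⟨r * reach S R v i - s, by linarith, by nlinarith, ?_⟩
    rw [hx, bodyPoint]; module)
  rw [inner_neg_right] at k2
  have k3 : (inner ℝ (y - x) (rootDir S i) : ℝ) = 0 := by linarith
  rcases rootDir_eq_or hS i with e | e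
  · rwa [e] at k3
  · rw [e, inner_neg_right] at k3; linarith

theorem inner_dir_eq_zero_of_cap {u d d' w : Plane} (hu : IsHexDir u) (hd : IsHexDir d)
    (hd' : IsHexDir d') (hdd : (inner ℝ d d' : ℝ) = -1 / 2) (hw : (inner ℝ w u : ℝ) = 0)
    (h : (inner ℝ w d : ℝ) ≤ 0) (h' : (inner ℝ w d' : ℝ) ≤ 0) :
    (inner ℝ w d : ℝ) = 0 ∨ (inner ℝ w d' : ℝ) = 0 := by
  have e1 := inner_decomp hu.1 w d
  have e2 := inner_decomp hu.1 w d'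
  have e3 := inner_decomp hu.1 d d'
  rw [hw, zero_mul, zero_add] at e1 e2
  by_contra hcon
  push Not at hcon
  have l1 := lt_of_le_of_ne h hcon.1
  have l2 := lt_of_le_of_ne h' hcon.2
  have hs3 := sqrt_three_pos
  have hs3' := sqrt_three_sq
  rw [e1] at l1
  rw [e2] at l2
  rcases hu.relative hd with ⟨p, -⟩ | ⟨p, q⟩
  · rw [p, mul_zero] at l1; exact lt_irrefl _ l1
  rcases hu.relative hd' with ⟨p', -⟩ | ⟨p', q'⟩
  · rw [p', mul_zero] at l2; exact lt_irrefl _ l2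
  rw [hdd] at e3
  rcases p with p | p <;> rcases p' with p' | p' <;> rw [p] at l1 e3 <;> rw [p'] at l2 e3
  · rcases q with q | q <;> rcases q' with q' | q' <;> rw [q, q'] at e3 <;> nlinarith
  · nlinarith
  · nlinarith
  · rcases q with q | q <;> rcases q' with q' | q' <;> rw [q, q'] at e3 <;> nlinarith

theorem inner_dirAt_of_tangent {X w : Plane} (hw : (inner ℝ w (S i).tangent : ℝ) = 0) :
    (inner ℝ w ((S i).dirAt X) : ℝ) = 0 := by
  rw [Piece.dirAt, real_inner_smul_right, hw, mul_zero]

/-- A piece facing a vertex in its interior does not approach it. -/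
theorem IsClosestPair.inner_vertexShift_of_perp (hS : IsSimple S) (hv : v ∈ heightSpace S)
    (hreach : ∀ i, 0 < reach S R v i) (hℓ : ∀ i, (S i).IsSegment → ℓ ≤ deformedLength S v i)
    (hfar : ∀ i j, ¬ (S i).IsSegment → (S j).IsSegment → ∀ z ∈ body S R v j,
      ℓ ≤ ‖z - (movedVertex S v (S i).base + reach S R v i • rootDir S i)‖)
    (hdr : IsDriven S (deformedLength S v) κ α)
    (h : IsClosestPair S R v i j x y) (hlt : ‖y - x‖ < ℓ) (hne : y - x ≠ 0)
    (hi : (inner ℝ (y - x) (S i).tangent : ℝ) = 0) {Y : Plane} (hY : (S j).IsEndpoint Y)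
    (hy : y = movedVertex S v Y) :
    -κ i * inner ℝ (y - x) (S i).normal ≤ (inner ℝ (y - x) (vertexShift S (-κ) Y) : ℝ) := by
  have hnegw : x - y = -(y - x) := (neg_sub _ _).symm
  obtain ⟨j', hp, c1, c2⟩ := h.symm.exists_isPair hS hv hreach hℓ (by rwa [norm_sub_rev])
    (by rw [hnegw]; exact neg_ne_zero.2 hne) hY hy
  have hk : ∃ k, (S k).IsEndpoint Y ∧ (inner ℝ (y - x) ((S k).dirAt Y) : ℝ) = 0 := by
    have := inner_dir_eq_zero_of_cap (hS.isHexDir i) (hS.isHexDir_dirAt hY)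
      (hS.isHexDir_dirAt hp.right) hp.inner_eq (w := x - y)
      (by rw [hnegw, inner_neg_left, hi, neg_zero]) c1 c2
    rw [hnegw, inner_neg_left, inner_neg_left, neg_eq_zero, neg_eq_zero] at this
    rcases this with h | h
    · exact ⟨j, hY, h⟩
    · exact ⟨j', hp.right, h⟩
  obtain ⟨k, hkY, hk0⟩ := hk
  have hkt : (inner ℝ (y - x) (S k).tangent : ℝ) = 0 := by
    rw [Piece.dirAt, real_inner_smul_right] at hk0
    rcases (hS.nondegenerate k).sgn_eq hkY with e | e <;> rw [e] at hk0 <;> linarith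
  have hap : Apart S i k := by
    rintro Z ⟨hZi, hZk⟩
    by_cases hik : i = k
    · subst hik; exact h.apart Y ⟨hkY, hY⟩
    · have e := hS.inner_dirAt hik hZi hZk
      have ni := (hS.nondegenerate i).norm_dirAt hZi
      have nk := (hS.nondegenerate k).norm_dirAt hZk
      rcases eq_or_eq_neg_of_inner_zero ni nk hne (inner_dirAt_of_tangent hi)
        (inner_dirAt_of_tangent hkt) with e' | e' <;> rw [e'] at e
      · rw [inner_self_unit nk] at e; norm_num at e
      · rw [inner_neg_left, inner_self_unit nk] at e; norm_num at e
  have hcl : IsClosestPair S R v i k x y :=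
    ⟨hap, h.left, (mem_body_iff hS hv hkY).2 ⟨0, le_rfl, (hreach k).le, by rw [hy]; simp⟩, h.le⟩
  have hpar := hcl.parallel hS hv hreach hℓ hfar hdr hlt hne hi hkt
  have hval : (inner ℝ (y - x) (vertexShift S (-κ) Y) : ℝ) = -κ k * inner ℝ (y - x) (S k).normal := by
    nth_rewrite 1 [(sq_inner_normal hS hkt).2]
    rw [real_inner_smul_left, real_inner_comm (vertexShift S (-κ) Y),
      inner_vertexShift_of_mem hS (neg_mem hdr.mem) hkY, Pi.neg_apply]
    ring
  rw [hval]
  linarith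

theorem IsClosestPair.inner_vel_nonneg (hS : IsSimple S) (hv : v ∈ heightSpace S)
    (hreach : ∀ i, 0 < reach S R v i) (hℓ : ∀ i, (S i).IsSegment → ℓ ≤ deformedLength S v i)
    (hfar : ∀ i j, ¬ (S i).IsSegment → (S j).IsSegment → ∀ z ∈ body S R v j,
      ℓ ≤ ‖z - (movedVertex S v (S i).base + reach S R v i • rootDir S i)‖)
    (hdr : IsDriven S (deformedLength S v) κ α)
    (h : IsClosestPair S R v i j x y) (hlt : ‖y - x‖ < ℓ) (hne : y - x ≠ 0) {r s : ℝ}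
    (hr0 : 0 ≤ r) (hr1 : r ≤ 1) (hs0 : 0 ≤ s) (hs1 : s ≤ 1) (hx : x = bodyPoint S R v i r)
    (hy : y = bodyPoint S R v j s) :
    0 ≤ (inner ℝ (y - x) (bodyVel S (-κ) j s - bodyVel S (-κ) i r) : ℝ) := by
  have hmem : -κ ∈ heightSpace S := neg_mem hdr.mem
  have hnegw : x - y = -(y - x) := (neg_sub _ _).symm
  have hlt' : ‖x - y‖ < ℓ := by rwa [norm_sub_rev]
  have hne' : x - y ≠ 0 := by rw [hnegw]; exact neg_ne_zero.2 hne
  have hfar' : ∀ {i j : ι} {x y : Plane}, IsClosestPair S R v i j x y → ‖y - x‖ < ℓ →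
      ¬ (S i).IsSegment → x = bodyPoint S R v i 1 → ¬ (S j).IsSegment := by
    intro i j x y h hlt hi hx hj
    have := hfar i j hi hj y h.right
    rw [hx, bodyPoint, one_mul] at hlt
    linarith
  rw [inner_sub_right, sub_nonneg]
  rcases bodyPoint_cases (R := R) hS hv hmem (i := i) hr0 hr1 with
    ⟨hr0', hr1'⟩ | ⟨X, hX, hxX, hvX⟩ | ⟨hni, rfl, hvi⟩ <;>
  rcases bodyPoint_cases (R := R) hS hv hmem (i := j) hs0 hs1 with
    ⟨hs0', hs1'⟩ | ⟨Y, hY, hyY, hvY⟩ | ⟨hnj, rfl, hvj⟩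
  · have ti := h.inner_tangent_eq_zero hS hreach hr0' hr1' hx
    have tj := h.symm.inner_tangent_eq_zero hS hreach hs0' hs1' hy
    rw [hnegw, inner_neg_left, neg_eq_zero] at tj
    rw [inner_bodyVel hS hmem r ti, inner_bodyVel hS hmem s tj]
    have := h.parallel hS hv hreach hℓ hfar hdr hlt hne ti tj
    simp only [Pi.neg_apply]; linarith
  · have ti := h.inner_tangent_eq_zero hS hreach hr0' hr1' hx
    rw [inner_bodyVel hS hmem r ti, hvY]
    exact h.inner_vertexShift_of_perp hS hv hreach hℓ hfar hdr hlt hne ti hY (hy.trans hyY)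
  · have ti := h.inner_tangent_eq_zero hS hreach hr0' hr1' hx
    have := hfar' h.symm hlt' hnj hy
    rw [inner_bodyVel hS hmem r ti, hvj, inner_zero_right, Pi.neg_apply, hdr.mem.1 i this]
    simp
  · have tj := h.symm.inner_tangent_eq_zero hS hreach hs0' hs1' hy
    have := h.symm.inner_vertexShift_of_perp hS hv hreach hℓ hfar hdr hlt' hne' tj hX (hx.trans hxX)
    rw [hnegw, inner_neg_left, inner_neg_left] at this
    rw [hnegw, inner_neg_left, neg_eq_zero] at tj
    rw [inner_bodyVel hS hmem s tj, hvX, Pi.neg_apply]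
    linarith
  · have k1 := h.inner_vertexShift_nonpos hS hv hreach hℓ hdr hlt hne hX (hx.trans hxX)
    have k2 := h.symm.inner_vertexShift_nonpos hS hv hreach hℓ hdr hlt' hne' hY (hy.trans hyY)
    rw [hnegw, inner_neg_left] at k2
    rw [hvX, hvY]
    linarith
  · have k1 := h.inner_vertexShift_nonpos hS hv hreach hℓ hdr hlt hne hX (hx.trans hxX)
    rw [hvX, hvj, inner_zero_right]
    exact k1
  · have tj := h.symm.inner_tangent_eq_zero hS hreach hs0' hs1' hy
    rw [hnegw, inner_neg_left, neg_eq_zero] at tj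
    have := hfar' h hlt hni hx
    rw [inner_bodyVel hS hmem s tj, hvi, inner_zero_right, Pi.neg_apply, hdr.mem.1 j this]
    simp
  · have k2 := h.symm.inner_vertexShift_nonpos hS hv hreach hℓ hdr hlt' hne' hY (hy.trans hyY)
    rw [hnegw, inner_neg_left] at k2
    rw [hvi, hvY, inner_zero_right]
    linarith
  · rw [hvi, hvj]

end Closest

/-! ### A minimum principle -/

theorem exists_pos_forall_le {A K : Type*} [Finite A] [TopologicalSpace K] [CompactSpace K]
    {f : A → K → ℝ} (hf : ∀ a, Continuous (f a)) (hpos : ∀ a k, 0 < f a k) :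
    ∃ m, 0 < m ∧ ∀ a k, m ≤ f a k := by
  rcases isEmpty_or_nonempty K with hK | hK
  · exact ⟨1, one_pos, fun a k => (hK.false k).elim⟩
  rcases isEmpty_or_nonempty A with hA | hA
  · exact ⟨1, one_pos, fun a => (hA.false a).elim⟩
  have hmin : ∀ a, ∃ k, ∀ l, f a k ≤ f a l := fun a => by
    obtain ⟨k, -, hk⟩ := isCompact_univ.exists_isMinOn univ_nonempty (hf a).continuousOn
    exact ⟨k, fun l => hk (mem_univ l)⟩
  choose k hk using hmin
  obtain ⟨a₀, ha₀⟩ := Finite.exists_min fun a => f a (k a)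
  exact ⟨f a₀ (k a₀), hpos _ _, fun a l => (ha₀ a).trans (hk a l)⟩

theorem pos_of_nonneg_deriv_of_isMin {A K : Type*} [Finite A] [TopologicalSpace K] [CompactSpace K]
    {q q' : A → K → ℝ → ℝ} {T m : ℝ} (hm : 0 < m)
    (hc : ∀ a, ContinuousOn (fun p : K × ℝ => q a p.1 p.2) (univ ×ˢ Icc 0 T))
    (h0 : ∀ a k, m ≤ q a k 0)
    (hd : ∀ a k t, 0 < t → t ≤ T → HasDerivAt (q a k) (q' a k t) t)
    (hmin : ∀ a k t, 0 < t → t ≤ T → (∀ b l, q a k t ≤ q b l t) → 0 < q a k t → q a k t ≤ m →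
      0 ≤ q' a k t) :
    ∀ a k t, 0 ≤ t → t ≤ T → 0 < q a k t := by
  by_contra! hcon
  obtain ⟨a₀, k₀, t₀, ht0, htT, hq₀⟩ := hcon
  have hT : 0 ≤ T := ht0.trans htT
  set η := m / (2 * (1 + T)) with hη
  have hηpos : 0 < η := by positivity
  have hηT : η * (1 + T) = m / 2 := by rw [hη]; field_simp
  have hg : ∀ t, t ≤ T → m / 2 ≤ m - η * (1 + t) := fun t ht => by nlinarith
  let B : A → Set ℝ := fun a => {t | t ∈ Icc 0 T ∧ ∃ k, q a k t ≤ m - η * (1 + t)}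
  have hB : ∀ a, IsCompact (B a) := by
    intro a
    have h1 : IsClosed ((univ ×ˢ Icc 0 T) ∩
        (fun p : K × ℝ => q a p.1 p.2 - (m - η * (1 + p.2))) ⁻¹' Iic 0) := by
      apply ContinuousOn.preimage_isClosed_of_isClosed _ (isClosed_univ.prod isClosed_Icc)
        isClosed_Iic
      exact (hc a).sub (by fun_prop)
    have h2 : IsCompact ((univ ×ˢ Icc 0 T) ∩
        (fun p : K × ℝ => q a p.1 p.2 - (m - η * (1 + p.2))) ⁻¹' Iic 0) :=
      (isCompact_univ.prod isCompact_Icc).of_isClosed_subset h1 inter_subset_left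
    convert h2.image continuous_snd using 1
    ext t
    constructor
    · rintro ⟨ht, k, hk⟩
      exact ⟨(k, t), ⟨⟨mem_univ _, ht⟩, by simp only [mem_preimage, mem_Iic]; linarith⟩, rfl⟩
    · rintro ⟨⟨k, t'⟩, ⟨⟨-, ht⟩, hk⟩, rfl⟩
      simp only [mem_preimage, mem_Iic] at hk
      exact ⟨ht, k, by linarith⟩
  have hBu : IsCompact (⋃ a, B a) := isCompact_iUnion hB
  obtain ⟨τ, hτ, hτmin⟩ := hBu.exists_isLeast ⟨t₀, mem_iUnion.2 ⟨a₀, ⟨ht0, htT⟩, k₀, by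
    linarith [hg t₀ htT]⟩⟩
  obtain ⟨a, ⟨hτ0, hτT⟩, k, hk⟩ := mem_iUnion.1 hτ
  have hτpos : 0 < τ := by
    rcases hτ0.eq_or_lt with rfl | h
    · have := h0 a k; nlinarith
    · exact h
  have hbefore : ∀ b l t, 0 ≤ t → t < τ → m - η * (1 + t) < q b l t := by
    intro b l t h1 h2
    by_contra hle
    push Not at hle
    have := hτmin (mem_iUnion.2 ⟨b, ⟨h1, h2.le.trans hτT⟩, l, hle⟩)
    linarith
  have hτge : ∀ b l, m - η * (1 + τ) ≤ q b l τ := by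
    intro b l
    have hcont : Tendsto (q b l) (𝓝[<] τ) (𝓝 (q b l τ)) :=
      (hd b l τ hτpos hτT).continuousAt.tendsto.mono_left nhdsWithin_le_nhds
    have hcont2 : Tendsto (fun t => m - η * (1 + t)) (𝓝[<] τ) (𝓝 (m - η * (1 + τ))) := by
      have : Continuous fun t : ℝ => m - η * (1 + t) := by fun_prop
      exact this.continuousAt.tendsto.mono_left nhdsWithin_le_nhds
    apply le_of_tendsto_of_tendsto hcont2 hcont
    filter_upwards [Ioo_mem_nhdsLT hτpos] with t ht
    exact (hbefore b l t ht.1.le ht.2).le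
  have heq : q a k τ = m - η * (1 + τ) := le_antisymm hk (hτge a k)
  have hq' := hmin a k τ hτpos hτT (fun b l => heq ▸ hτge b l)
    (by rw [heq]; linarith [hg τ hτT]) (by rw [heq]; nlinarith)
  have hder : HasDerivAt (fun t => q a k t - (m - η * (1 + t))) (q' a k τ + η) τ := by
    have h1 : HasDerivAt (fun t : ℝ => m - η * (1 + t)) (-(η * 1)) τ :=
      (((hasDerivAt_id τ).const_add 1).const_mul η).const_sub m
    have h2 := (hd a k τ hτpos hτT).sub h1
    rwa [mul_one, sub_neg_eq_add] at h2
  have hslope := (hasDerivWithinAt_iff_tendsto_slope' (self_notMem_Iio (a := τ))).1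
    (hder.hasDerivWithinAt (s := Iio τ))
  have : q' a k τ + η ≤ 0 := by
    apply le_of_tendsto hslope
    filter_upwards [Ioo_mem_nhdsLT hτpos] with t ht
    rw [slope_def_field]
    apply div_nonpos_of_nonneg_of_nonpos
    · have := hbefore a k t ht.1.le ht.2
      rw [heq]; linarith
    · linarith [ht.2]
  linarith

/-! ### The evolution of the heights and the persistence of embeddedness -/

/-- Heights for which no segment has degenerated. -/
def regularHeights (S : ι → Piece) : Set (heightSpace S) :=
  {v | ∀ i, (S i).IsSegment → 0 < deformedLength S v.1 i}

theorem isOpen_regularHeights (S : ι → Piece) : IsOpen (regularHeights S) := by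
  have : regularHeights S = ⋂ i, ⋂ (_ : (S i).IsSegment), {v | 0 < deformedLength S v.1 i} := by
    ext v; simp [regularHeights]
  rw [this]
  refine isOpen_iInter_of_finite fun i => isOpen_iInter_of_finite fun _ => ?_
  exact isOpen_lt continuous_const ((continuous_deformedLength S i).comp continuous_subtype_val)

/-- Velocity of the heights under the curvature flow. -/
def velocity (S : ι → Piece) (v : heightSpace S) : heightSpace S := -current S v.1

theorem contDiffAt_velocity {v : heightSpace S} (hv : v ∈ regularHeights S) :
    ContDiffAt ℝ 1 (velocity S) v :=
  (contDiffAt_current hv).neg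

theorem deformedLength_zero {i : ι} {L : ℝ} (h : (S i).extent = .segment L) :
    deformedLength S 0 i = L := by
  rw [deformedLength_segment h, vertexShift_zero, vertexShift_zero, sub_zero, inner_zero_left,
    add_zero]

theorem zero_mem_regularHeights (hS : IsSimple S) : (0 : heightSpace S) ∈ regularHeights S := by
  rintro i ⟨L, hL⟩
  change 0 < deformedLength S 0 i
  rw [deformedLength_zero hL]
  exact (hS.nondegenerate i).2 L hL

theorem hasDerivAt_coe {h : ℝ → heightSpace S} {t : ℝ} {w : heightSpace S} (hd : HasDerivAt h w t) :
    HasDerivAt (fun s => (h s).1) w.1 t :=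
  (heightSpace S).subtypeL.hasFDerivAt.comp_hasDerivAt t hd

theorem body_subset_carrier (hS : IsSimple S) {R : ℝ} {v : ι → ℝ} (i : ι) :
    body S R v i ⊆ (deform S v i).carrier := by
  rintro x ⟨s, h0, h1, rfl⟩
  rcases (S i).extent_cases with ⟨L, h⟩ | h | h
  · refine ⟨s, ?_, ?_⟩
    · rw [Piece.dom_segment (deform_segment h v)]
      exact ⟨h0, by rwa [reach_segment ⟨L, h⟩] at h1⟩
    · rw [rootDir, Piece.dirAt, (hS.nondegenerate i).sgn_start (Piece.startPt_segment h), one_smul]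
      rfl
  · refine ⟨s, ?_, ?_⟩
    · rw [Piece.dom_outgoing (deform_outgoing h v)]; exact h0
    · rw [rootDir, Piece.dirAt, (hS.nondegenerate i).sgn_start (Piece.startPt_outgoing h), one_smul]
      rfl
  · refine ⟨-s, ?_, ?_⟩
    · rw [Piece.dom_incoming (deform_incoming h v), mem_Iic]; linarith
    · rw [rootDir, Piece.dirAt, (hS.nondegenerate i).sgn_end (Piece.endPt_incoming h), neg_one_smul,
        smul_neg, ← neg_smul]
      rfl

theorem exists_mem_body (hS : IsSimple S) {v : ι → ℝ} {i : ι} {x : Plane}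
    (hx : x ∈ (deform S v i).carrier) : ∃ B, ∀ R, B ≤ R → x ∈ body S R v i := by
  obtain ⟨s, hs, rfl⟩ := hx
  rcases (S i).extent_cases with ⟨L, h⟩ | h | h
  · rw [Piece.dom_segment (deform_segment h v)] at hs
    refine ⟨0, fun R _ => ⟨s, hs.1, by rw [reach_segment ⟨L, h⟩]; exact hs.2, ?_⟩⟩
    rw [rootDir, Piece.dirAt, (hS.nondegenerate i).sgn_start (Piece.startPt_segment h), one_smul]
    rfl
  · rw [Piece.dom_outgoing (deform_outgoing h v)] at hs
    have hn : ¬ (S i).IsSegment := by rintro ⟨L, hL⟩; rw [h] at hL; cases hL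
    refine ⟨s + inner ℝ (vertexShift S v (S i).base) (rootDir S i), fun R hR => ⟨s, hs, ?_, ?_⟩⟩
    · rw [reach_halfLine hn]; linarith
    · rw [rootDir, Piece.dirAt, (hS.nondegenerate i).sgn_start (Piece.startPt_outgoing h), one_smul]
      rfl
  · rw [Piece.dom_incoming (deform_incoming h v), mem_Iic] at hs
    have hn : ¬ (S i).IsSegment := by rintro ⟨L, hL⟩; rw [h] at hL; cases hL
    refine ⟨-s + inner ℝ (vertexShift S v (S i).base) (rootDir S i),
      fun R hR => ⟨-s, by linarith, ?_, ?_⟩⟩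
    · rw [reach_halfLine hn]; linarith
    · rw [rootDir, Piece.dirAt, (hS.nondegenerate i).sgn_end (Piece.endPt_incoming h), neg_one_smul,
        smul_neg, neg_smul, neg_neg]
      rfl

section Embedded

variable {T : EReal} {h : ℝ → heightSpace S}

/-- Uniform bounds on a compact time interval, and a truncation of the half-lines far away. -/
theorem IsSolution.exists_truncation (hS : IsSimple S)
    (hsol : IsSolution (velocity S) (regularHeights S) 0 T h) {t₁ : ℝ} (ht₁ : t₁ ∈ timeInterval T)
    (B : ℝ) : ∃ ℓ R, 0 < ℓ ∧ B ≤ R ∧ ∀ t ∈ Icc 0 t₁, (∀ i, 0 < reach S R (h t).1 i) ∧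
      (∀ i, (S i).IsSegment → ℓ ≤ deformedLength S (h t).1 i) ∧
      ∀ i j, ¬ (S i).IsSegment → (S j).IsSegment → ∀ z ∈ body S R (h t).1 j,
        ℓ ≤ ‖z - (movedVertex S (h t).1 (S i).base + reach S R (h t).1 i • rootDir S i)‖ := by
  have hsub : Icc 0 t₁ ⊆ timeInterval T := fun s hs =>
    ⟨hs.1, (EReal.coe_le_coe_iff.2 hs.2).trans_lt ht₁.2⟩
  have hvc : ContinuousOn (fun t => (h t).1) (Icc 0 t₁) :=
    continuous_subtype_val.comp_continuousOn (hsol.cont.mono hsub)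
  obtain ⟨ℓ, hℓ0, hℓ⟩ := exists_pos_forall_le (A := {i // (S i).IsSegment}) (K := Icc 0 t₁)
    (f := fun i t => deformedLength S (h t.1).1 i.1)
    (fun i => (continuous_deformedLength S i.1).comp hvc.domRestrict)
    (fun i t => hsol.mem t.1 (hsub t.2) i.1 i.2)
  obtain ⟨C, hC⟩ := isCompact_Icc.exists_bound_of_continuousOn
    (f := fun t => ∑ i, (‖movedVertex S (h t).1 (S i).base‖ + |deformedLength S (h t).1 i| +
      ‖vertexShift S (h t).1 (S i).base‖)) (s := Icc 0 t₁) (by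
      apply ContinuousOn.comp (g := fun v : ι → ℝ => ∑ i, (‖movedVertex S v (S i).base‖ +
        |deformedLength S v i| + ‖vertexShift S v (S i).base‖)) (t := univ) _ hvc (mapsTo_univ _ _)
      apply Continuous.continuousOn
      refine continuous_finsetSum _ fun i _ => ?_
      exact ((continuous_movedVertex S _).norm.add (continuous_deformedLength S i).abs).add
        (continuous_vertexShift S _).norm)
  have hC' : ∀ t ∈ Icc 0 t₁, ∀ i, ‖movedVertex S (h t).1 (S i).base‖ + |deformedLength S (h t).1 i| +
      ‖vertexShift S (h t).1 (S i).base‖ ≤ C := by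
    intro t ht i
    refine le_trans ?_ ((le_abs_self _).trans (hC t ht))
    exact Finset.single_le_sum (f := fun i => ‖movedVertex S (h t).1 (S i).base‖ +
      |deformedLength S (h t).1 i| + ‖vertexShift S (h t).1 (S i).base‖)
      (fun i _ => by positivity) (Finset.mem_univ i)
  set R := max B (3 * C + ℓ) with hR
  have hRC : 3 * C + ℓ ≤ R := le_max_right _ _
  have hreachHalf : ∀ t ∈ Icc 0 t₁, ∀ i, ¬ (S i).IsSegment → 2 * C + ℓ ≤ reach S R (h t).1 i := by
    intro t ht i hi
    rw [reach_halfLine hi]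
    have h1 := (abs_le.1 (abs_inner_unit_le (norm_rootDir hS i)
      (vertexShift S (h t).1 (S i).base))).2
    have h2 := hC' t ht i
    have h3 := norm_nonneg (movedVertex S (h t).1 (S i).base)
    have h4 := abs_nonneg (deformedLength S (h t).1 i)
    linarith
  have hreach : ∀ t ∈ Icc 0 t₁, ∀ i, 0 < reach S R (h t).1 i := by
    intro t ht i
    by_cases hi : (S i).IsSegment
    · rw [reach_segment hi]; exact hsol.mem t (hsub ht) i hi
    · have h1 := hreachHalf t ht i hi
      have h2 := hC' t ht i
      have h3 : 0 ≤ C := le_trans (by positivity) h2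
      linarith
  have hfar : ∀ t ∈ Icc 0 t₁, ∀ i j, ¬ (S i).IsSegment → (S j).IsSegment →
      ∀ z ∈ body S R (h t).1 j,
      ℓ ≤ ‖z - (movedVertex S (h t).1 (S i).base + reach S R (h t).1 i • rootDir S i)‖ := by
    rintro t ht i j hi hj z ⟨s, hs0, hs1, rfl⟩
    have h1 := hreachHalf t ht i hi
    have h2 := hC' t ht i
    have h3 := hC' t ht j
    have e1 : ‖reach S R (h t).1 i • rootDir S i‖ = reach S R (h t).1 i := by
      rw [norm_smul, norm_rootDir hS, mul_one, Real.norm_eq_abs, abs_of_pos (hreach t ht i)]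
    have e2 : ‖s • rootDir S j‖ = s := by
      rw [norm_smul, norm_rootDir hS, mul_one, Real.norm_eq_abs, abs_of_nonneg hs0]
    rw [reach_segment hj] at hs1
    have h4 := le_abs_self (deformedLength S (h t).1 j)
    set p := movedVertex S (h t).1 (S j).base
    set p' := movedVertex S (h t).1 (S i).base
    have h5 : ‖reach S R (h t).1 i • rootDir S i‖ ≤
        ‖p + s • rootDir S j - (p' + reach S R (h t).1 i • rootDir S i)‖ + (‖p‖ + ‖s • rootDir S j‖) +
          ‖p'‖ := by
      have : reach S R (h t).1 i • rootDir S i =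
          -(p + s • rootDir S j - (p' + reach S R (h t).1 i • rootDir S i)) +
            (p + s • rootDir S j) - p' := by abel
      calc _ = ‖-(p + s • rootDir S j - (p' + reach S R (h t).1 i • rootDir S i)) +
            (p + s • rootDir S j) - p'‖ := by rw [← this]
        _ ≤ _ := norm_sub_le _ _
        _ ≤ _ := by
          gcongr
          refine (norm_add_le _ _).trans ?_
          rw [norm_neg]
          gcongr
          exact norm_add_le _ _
    rw [e1, e2] at h5
    have h6 := norm_nonneg (vertexShift S (h t).1 (S i).base)
    have h7 := norm_nonneg (vertexShift S (h t).1 (S j).base)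
    have h8 := abs_nonneg (deformedLength S (h t).1 i)
    have h9 := norm_nonneg p
    linarith
  exact ⟨ℓ, R, hℓ0, le_max_left _ _, fun t ht => ⟨hreach t ht, fun i hi => hℓ ⟨i, hi⟩ ⟨t, ht⟩,
    hfar t ht⟩⟩

/-- Squared distance between points of two truncated pieces. -/
def gap (S : ι → Piece) (R : ℝ) (v : ι → ℝ) (i j : ι) (r s : ℝ) : ℝ :=
  ‖bodyPoint S R v j s - bodyPoint S R v i r‖ ^ 2

/-- Rate of change of `gap`. -/
def gapVel (S : ι → Piece) (R : ℝ) (v w : ι → ℝ) (i j : ι) (r s : ℝ) : ℝ :=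
  2 * inner ℝ (bodyPoint S R v j s - bodyPoint S R v i r) (bodyVel S w j s - bodyVel S w i r)

theorem continuousOn_gap {v : ℝ → ι → ℝ} {t₁ : ℝ} (hv : ContinuousOn v (Icc 0 t₁)) (R : ℝ)
    (i j : ι) : ContinuousOn (fun p : (unitInterval × unitInterval) × ℝ =>
      gap S R (v p.2) i j p.1.1 p.1.2) (univ ×ˢ Icc 0 t₁) := by
  have hbp : ∀ i : ι, ∀ f : unitInterval × unitInterval → ℝ, Continuous f →
      ContinuousOn (fun p : (unitInterval × unitInterval) × ℝ => bodyPoint S R (v p.2) i (f p.1))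
        (univ ×ˢ Icc 0 t₁) := by
    intro i f hf
    have h2 : ContinuousOn (fun p : (unitInterval × unitInterval) × ℝ => v p.2)
        (univ ×ˢ Icc 0 t₁) := hv.comp continuousOn_snd fun p hp => hp.2
    have h3 := (continuous_movedVertex S (S i).base).comp_continuousOn h2
    have h4 := (continuous_reach S R i).comp_continuousOn h2
    have h5 : ContinuousOn (fun p : (unitInterval × unitInterval) × ℝ => f p.1)
        (univ ×ˢ Icc 0 t₁) := (hf.comp continuous_fst).continuousOn
    exact h3.add ((h5.mul h4).smul continuousOn_const)
  exact ((hbp j (fun k => k.2) (by fun_prop)).sub (hbp i (fun k => k.1) (by fun_prop))).norm.pow 2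

theorem hasDerivAt_gap {v : ℝ → ι → ℝ} {w : ι → ℝ} {t : ℝ} (hd : HasDerivAt v w t) (R : ℝ)
    (i j : ι) (r s : ℝ) :
    HasDerivAt (fun t => gap S R (v t) i j r s) (gapVel S R (v t) w i j r s) t :=
  ((hasDerivAt_bodyPoint hd R j s).sub (hasDerivAt_bodyPoint hd R i r)).norm_sq

theorem gap_pos_of_isSimple (hS : IsSimple S) {R : ℝ} (hreach : ∀ i, 0 < reach S R 0 i) {i j : ι}
    (hij : Apart S i j) (r s : unitInterval) : 0 < gap S R 0 i j r s := by
  apply pow_pos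
  rw [norm_pos_iff, sub_ne_zero]
  intro heq
  have m1 := body_subset_carrier hS _
    ((mem_body_iff_bodyPoint (hreach i)).2 ⟨r, r.2.1, r.2.2, rfl⟩)
  have m2 := body_subset_carrier hS _
    ((mem_body_iff_bodyPoint (hreach j)).2 ⟨s, s.2.1, s.2.2, rfl⟩)
  rw [heq] at m2
  rw [deform_zero] at m1 m2
  have hne : i ≠ j := fun e => hij (S i).base
    ⟨(S i).isEndpoint_base, e ▸ (S i).isEndpoint_base⟩
  exact hij _ (hS.network.meet _ _ hne _ ⟨m1, m2⟩)

theorem gapVel_nonneg (hS : IsSimple S) {v : heightSpace S} {R ℓ : ℝ} (hℓ0 : 0 < ℓ)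
    (hreach : ∀ i, 0 < reach S R v.1 i)
    (hℓ : ∀ i, (S i).IsSegment → ℓ ≤ deformedLength S v.1 i)
    (hfar : ∀ i j, ¬ (S i).IsSegment → (S j).IsSegment → ∀ z ∈ body S R v.1 j,
      ℓ ≤ ‖z - (movedVertex S v.1 (S i).base + reach S R v.1 i • rootDir S i)‖)
    {i j : ι} (hij : Apart S i j) (r s : unitInterval)
    (hmin : ∀ i' j', Apart S i' j' → ∀ r' s' : unitInterval,
      gap S R v.1 i j r s ≤ gap S R v.1 i' j' r' s')
    (hpos : 0 < gap S R v.1 i j r s) (hlt : gap S R v.1 i j r s < ℓ ^ 2) :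
    0 ≤ gapVel S R v.1 (-(current S v.1).1) i j r s := by
  obtain ⟨α, hdr⟩ := exists_isDriven_current hS fun i hi => hℓ0.trans_le (hℓ i hi)
  have hcl : IsClosestPair S R v.1 i j (bodyPoint S R v.1 i r) (bodyPoint S R v.1 j s) := by
    refine ⟨hij, (mem_body_iff_bodyPoint (hreach i)).2 ⟨r, r.2.1, r.2.2, rfl⟩,
      (mem_body_iff_bodyPoint (hreach j)).2 ⟨s, s.2.1, s.2.2, rfl⟩, ?_⟩
    intro i' j' hij x' hx' y' hy'
    obtain ⟨r', hr0, hr1, rfl⟩ := (mem_body_iff_bodyPoint (hreach i')).1 hx'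
    obtain ⟨s', hs0, hs1, rfl⟩ := (mem_body_iff_bodyPoint (hreach j')).1 hy'
    exact (sq_le_sq₀ (norm_nonneg _) (norm_nonneg _)).1
      (hmin i' j' hij ⟨r', hr0, hr1⟩ ⟨s', hs0, hs1⟩)
  have hne : bodyPoint S R v.1 j s - bodyPoint S R v.1 i r ≠ 0 := by
    intro e
    rw [gap, e, norm_zero] at hpos
    norm_num at hpos
  exact mul_nonneg zero_le_two (hcl.inner_vel_nonneg hS v.2 hreach hℓ hfar hdr
    (lt_of_pow_lt_pow_left₀ 2 hℓ0.le hlt) hne r.2.1 r.2.2 s.2.1 s.2.2 rfl rfl)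

theorem IsSolution.gap_pos (hS : IsSimple S)
    (hsol : IsSolution (velocity S) (regularHeights S) 0 T h) {t₁ : ℝ} (ht₁ : t₁ ∈ timeInterval T)
    {ℓ R : ℝ} (hℓ0 : 0 < ℓ) (hall : ∀ t ∈ Icc 0 t₁, (∀ i, 0 < reach S R (h t).1 i) ∧
      (∀ i, (S i).IsSegment → ℓ ≤ deformedLength S (h t).1 i) ∧
      ∀ i j, ¬ (S i).IsSegment → (S j).IsSegment → ∀ z ∈ body S R (h t).1 j,
        ℓ ≤ ‖z - (movedVertex S (h t).1 (S i).base + reach S R (h t).1 i • rootDir S i)‖)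
    {i j : ι} (hij : Apart S i j) (r s : unitInterval) : 0 < gap S R (h t₁).1 i j r s := by
  have hsub : Icc 0 t₁ ⊆ timeInterval T := fun s hs =>
    ⟨hs.1, (EReal.coe_le_coe_iff.2 hs.2).trans_lt ht₁.2⟩
  have hvc : ContinuousOn (fun t => (h t).1) (Icc 0 t₁) :=
    continuous_subtype_val.comp_continuousOn (hsol.cont.mono hsub)
  have h0mem : (0 : ℝ) ∈ Icc 0 t₁ := ⟨le_rfl, ht₁.1⟩
  have hinit : (h 0).1 = 0 := by rw [hsol.init]; rfl
  have hc0 : ∀ a : {p : ι × ι // Apart S p.1 p.2}, Continuous fun k : unitInterval × unitInterval =>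
      gap S R (h 0).1 a.1.1 a.1.2 k.1 k.2 := fun a => by
    have := (continuousOn_gap (S := S) hvc R a.1.1 a.1.2).comp (s := univ)
      (f := fun k : unitInterval × unitInterval => (k, (0 : ℝ))) (by fun_prop)
      fun k _ => ⟨mem_univ _, h0mem⟩
    exact continuousOn_univ.1 this
  have hp0 : ∀ (a : {p : ι × ι // Apart S p.1 p.2}) (k : unitInterval × unitInterval),
      0 < gap S R (h 0).1 a.1.1 a.1.2 k.1 k.2 := fun a k => by
    have := (hall 0 h0mem).1
    rw [hinit] at this ⊢
    exact gap_pos_of_isSimple hS this a.2 k.1 k.2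
  obtain ⟨m₀, hm₀, hm₀'⟩ := exists_pos_forall_le hc0 hp0
  have hℓ2 := pow_pos hℓ0 2
  exact pos_of_nonneg_deriv_of_isMin (A := {p : ι × ι // Apart S p.1 p.2})
    (K := unitInterval × unitInterval) (T := t₁)
    (q := fun a k t => gap S R (h t).1 a.1.1 a.1.2 k.1 k.2)
    (q' := fun a k t => gapVel S R (h t).1 (-(current S (h t).1).1) a.1.1 a.1.2 k.1 k.2)
    (m := min m₀ (ℓ ^ 2 / 2)) (lt_min hm₀ (by positivity))
    (fun a => continuousOn_gap hvc R a.1.1 a.1.2)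
    (fun a k => (min_le_left _ _).trans (hm₀' a k))
    (fun a k t h0 h1 =>
      hasDerivAt_gap (hasDerivAt_coe (hsol.deriv t h0 (hsub ⟨h0.le, h1⟩).2)) R _ _ _ _)
    (fun a k t h0 h1 hmin hq0 hqm => by
      obtain ⟨b1, b2, b3⟩ := hall t ⟨h0.le, h1⟩
      exact gapVel_nonneg hS hℓ0 b1 b2 b3 a.2 k.1 k.2
        (fun i' j' hij' r' s' => hmin ⟨(i', j'), hij'⟩ (r', s')) hq0
        (lt_of_le_of_lt (hqm.trans (min_le_right _ _)) (by linarith)))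
    ⟨(i, j), hij⟩ (r, s) t₁ ht₁.1 le_rfl

theorem IsSolution.disjoint_body (hS : IsSimple S)
    (hsol : IsSolution (velocity S) (regularHeights S) 0 T h) {t₁ : ℝ} (ht₁ : t₁ ∈ timeInterval T)
    (B : ℝ) : ∃ R, B ≤ R ∧ (∀ i, 0 < reach S R (h t₁).1 i) ∧ ∀ i j, Apart S i j →
      Disjoint (body S R (h t₁).1 i) (body S R (h t₁).1 j) := by
  obtain ⟨ℓ, R, hℓ0, hRB, hall⟩ := hsol.exists_truncation hS ht₁ B
  have hreach := (hall t₁ ⟨ht₁.1, le_rfl⟩).1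
  refine ⟨R, hRB, hreach, fun i j hij => ?_⟩
  rw [Set.disjoint_left]
  intro x hx hy
  obtain ⟨r, hr0, hr1, hxr⟩ := (mem_body_iff_bodyPoint (hreach i)).1 hx
  obtain ⟨s, hs0, hs1, hys⟩ := (mem_body_iff_bodyPoint (hreach j)).1 hy
  have := hsol.gap_pos hS ht₁ hℓ0 hall hij ⟨r, hr0, hr1⟩ ⟨s, hs0, hs1⟩
  rw [gap, ← hxr, ← hys, sub_self, norm_zero] at this
  norm_num at this

theorem eq_movedVertex_of_mem_body (hS : IsSimple S) {R : ℝ} {v : ι → ℝ} (hv : v ∈ heightSpace S)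
    {i j : ι} (hij : i ≠ j) {X x : Plane} (hi : (S i).IsEndpoint X) (hj : (S j).IsEndpoint X)
    (hxi : x ∈ body S R v i) (hxj : x ∈ body S R v j) : x = movedVertex S v X := by
  obtain ⟨s, -, -, rfl⟩ := (mem_body_iff hS hv hi).1 hxi
  obtain ⟨r, -, -, hr⟩ := (mem_body_iff hS hv hj).1 hxj
  have h0 : s • (S i).dirAt X + (-r) • (S j).dirAt X = 0 := by
    rw [neg_smul, ← sub_eq_add_neg, sub_eq_zero]
    exact add_left_cancel hr
  have := (coeff_eq_zero_two ((hS.nondegenerate i).norm_dirAt hi)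
    ((hS.nondegenerate j).norm_dirAt hj) (hS.inner_dirAt hij hi hj) h0).1
  rw [this, zero_smul, add_zero]

theorem movedVertex_mem_body (hS : IsSimple S) {R : ℝ} {v : ι → ℝ} (hv : v ∈ heightSpace S) {i : ι}
    (hreach : 0 < reach S R v i) {X : Plane} (hX : (S i).IsEndpoint X) :
    movedVertex S v X ∈ body S R v i :=
  (mem_body_iff hS hv hX).2 ⟨0, le_rfl, hreach.le, by simp⟩

theorem movedVertex_ne_of_segment (hS : IsSimple S) {v : ι → ℝ} (hv : v ∈ heightSpace S) {i : ι}
    (hlen : ∀ i, (S i).IsSegment → 0 < deformedLength S v i) {X Y : Plane}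
    (hX : (S i).IsEndpoint X) (hY : (S i).IsEndpoint Y) (hXY : X ≠ Y) :
    movedVertex S v X ≠ movedVertex S v Y := by
  have hi : (S i).IsSegment := by
    by_contra hi
    exact hXY (((Piece.isEndpoint_halfLine_iff hi).1 hX).trans
      ((Piece.isEndpoint_halfLine_iff hi).1 hY).symm)
  obtain ⟨X', -, -, honly, -, -, hm, -⟩ := exists_other_end hS hi hX
  have := (honly Y hY).resolve_left hXY.symm
  subst this
  rw [hm v hv]
  intro h0
  rw [left_eq_add] at h0
  have := congrArg norm h0
  rw [norm_smul, (hS.nondegenerate i).norm_dirAt hX, mul_one, norm_zero, norm_eq_zero] at this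
  exact (hlen i hi).ne' this

theorem IsSolution.injOn_movedVertex (hS : IsSimple S)
    (hsol : IsSolution (velocity S) (regularHeights S) 0 T h) {t : ℝ} (ht : t ∈ timeInterval T) :
    Set.InjOn (movedVertex S (h t).1) (vertices S) := by
  intro X hX Y hY hXY
  by_contra hne
  obtain ⟨i, hi⟩ := mem_vertices.1 hX
  obtain ⟨j, hj⟩ := mem_vertices.1 hY
  obtain ⟨R, -, hreach, hdisj⟩ := hsol.disjoint_body hS ht 0
  have hlen := hsol.mem t ht
  have m1 := movedVertex_mem_body hS (h t).2 (hreach i) hi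
  have m2 := movedVertex_mem_body hS (h t).2 (hreach j) hj
  rw [← hXY] at m2
  by_cases hap : Apart S i j
  · exact Set.disjoint_left.1 (hdisj i j hap) m1 m2
  · simp only [Apart, not_forall, not_not] at hap
    obtain ⟨W, hWi, hWj⟩ := hap
    by_cases hij : i = j
    · subst hij
      exact movedVertex_ne_of_segment hS (h t).2 hlen hi hj hne hXY
    · have e := eq_movedVertex_of_mem_body hS (h t).2 hij hWi hWj m1 m2
      by_cases hWX : X = W
      · subst hWX
        exact movedVertex_ne_of_segment hS (h t).2 hlen hWj hj hne hXY
      · exact movedVertex_ne_of_segment hS (h t).2 hlen hi hWi hWX e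

theorem IsSolution.isNetwork_deform (hS : IsSimple S)
    (hsol : IsSolution (velocity S) (regularHeights S) 0 T h) {t : ℝ} (ht : t ∈ timeInterval T) :
    IsNetwork (deform S (h t).1) := by
  have hv := (h t).2
  refine HexNetwork.isNetwork_deform hS hv (hsol.mem t ht) (hsol.injOn_movedVertex hS ht) ?_
  rintro i j hij x ⟨hxi, hxj⟩
  obtain ⟨B₁, h₁⟩ := exists_mem_body hS hxi
  obtain ⟨B₂, h₂⟩ := exists_mem_body hS hxj
  obtain ⟨R, hR, hreach, hdisj⟩ := hsol.disjoint_body hS ht (max B₁ B₂)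
  have m1 := h₁ R ((le_max_left _ _).trans hR)
  have m2 := h₂ R ((le_max_right _ _).trans hR)
  by_cases hap : Apart S i j
  · exact absurd m2 (Set.disjoint_left.1 (hdisj i j hap) m1)
  · simp only [Apart, not_forall, not_not] at hap
    obtain ⟨W, hWi, hWj⟩ := hap
    have e := eq_movedVertex_of_mem_body hS hv hij hWi hWj m1 m2
    exact ⟨(isEndpoint_deform_iff hS hv).2 ⟨W, hWi, e.symm⟩,
      (isEndpoint_deform_iff hS hv).2 ⟨W, hWj, e.symm⟩⟩

theorem IsSolution.isSimple_deform (hS : IsSimple S)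
    (hsol : IsSolution (velocity S) (regularHeights S) 0 T h) {t : ℝ} (ht : t ∈ timeInterval T) :
    IsSimple (deform S (h t).1) :=
  HexNetwork.isSimple_deform hS (h t).2 (hsol.injOn_movedVertex hS ht) (hsol.isNetwork_deform hS ht)

end Embedded

theorem hasPhiCurvature_current (hS : IsSimple S) {v : heightSpace S} (hv : v ∈ regularHeights S)
    (hinj : Set.InjOn (movedVertex S v.1) (vertices S)) (hsimple : IsSimple (deform S v.1)) (i : ι) :
    HasPhiCurvature (deform S v.1) i ((current S v.1).1 i) := by
  obtain ⟨α, hdr⟩ := exists_isDriven_current hS hv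
  obtain ⟨a, ha⟩ := hdr.isEquilibrium hS v.2 hinj
  exact ha.hasPhiCurvature hsimple i

/-! ### Barriers: the endpoints of the half-lines do not escape to infinity -/

/-- Position of the half-line `j` in the direction orthogonal to it. -/
def offset (S : ι → Piece) (j : ι) : ℝ := inner ℝ (S j).base (rot (rootDir S j))

open Classical in
/-- Truncated distance to the offset of a half-line of direction `d`. -/
def notchTerm (S : ι → Piece) (b : ℝ) (d : Plane) (s : ℝ) : Option ι → ℝ
  | none => b
  | some j => if ¬ (S j).IsSegment ∧ rootDir S j = d then |s - offset S j| else b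

/-- Distance to the offsets of the half-lines of direction `d`, truncated at `b`. -/
def notch (S : ι → Piece) (b : ℝ) (d : Plane) (s : ℝ) : ℝ :=
  Finset.univ.inf' ⟨none, Finset.mem_univ _⟩ (notchTerm S b d s)

theorem notch_le (S : ι → Piece) (b : ℝ) (d : Plane) (s : ℝ) : notch S b d s ≤ b :=
  Finset.inf'_le (notchTerm S b d s) (Finset.mem_univ none)

theorem notch_le_abs {j : ι} (hj : ¬ (S j).IsSegment) {d : Plane} (hd : rootDir S j = d) (b s : ℝ) :
    notch S b d s ≤ |s - offset S j| := by
  have e : notchTerm S b d s (some j) = |s - offset S j| := by simp [notchTerm, hj, hd]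
  exact (Finset.inf'_le (notchTerm S b d s) (Finset.mem_univ (some j))).trans_eq e

theorem notch_eq (S : ι → Piece) (b : ℝ) (d : Plane) (s : ℝ) : notch S b d s = b ∨
    ∃ j, ¬ (S j).IsSegment ∧ rootDir S j = d ∧ notch S b d s = |s - offset S j| := by
  obtain ⟨o, -, ho⟩ := Finset.exists_mem_eq_inf' (s := (Finset.univ : Finset (Option ι)))
    ⟨none, Finset.mem_univ _⟩ (notchTerm S b d s)
  change notch S b d s = _ at ho
  cases o with
  | none => exact Or.inl ho
  | some j =>
    by_cases hj : ¬ (S j).IsSegment ∧ rootDir S j = d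
    · right
      refine ⟨j, hj.1, hj.2, ?_⟩
      rw [ho]; simp [notchTerm, hj]
    · left
      rw [ho]; simp only [notchTerm, hj, if_false]

theorem notch_nonneg {b : ℝ} (hb : 0 ≤ b) (d : Plane) (s : ℝ) : 0 ≤ notch S b d s := by
  rcases notch_eq S b d s with h | ⟨j, -, -, h⟩ <;> rw [h]
  · exact hb
  · exact abs_nonneg _

theorem notch_le_add (S : ι → Piece) (b : ℝ) (d : Plane) (s s' : ℝ) :
    notch S b d s ≤ notch S b d s' + |s - s'| := by
  rcases notch_eq S b d s' with h | ⟨j, h1, h2, h⟩ <;> rw [h]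
  · linarith [notch_le S b d s, abs_nonneg (s - s')]
  · refine (notch_le_abs h1 h2 b s).trans ?_
    have := abs_add_le (s' - offset S j) (s - s')
    rwa [show s' - offset S j + (s - s') = s - offset S j by ring] at this

/-- The half-lines of equal direction on different lines are more than `2 b` apart. -/
def Separated (S : ι → Piece) (b : ℝ) : Prop :=
  ∀ j k, ¬ (S j).IsSegment → ¬ (S k).IsSegment → rootDir S j = rootDir S k →
    offset S j ≠ offset S k → 2 * b < |offset S j - offset S k|

theorem exists_separated (S : ι → Piece) : ∃ b, 0 < b ∧ Separated S b := by
  classical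
  obtain ⟨m, hm, hle⟩ := exists_pos_forall_le (A := ι × ι) (K := Unit)
    (f := fun p _ => if offset S p.1 = offset S p.2 then 1 else |offset S p.1 - offset S p.2|)
    (fun _ => continuous_const) (fun p _ => by
      split_ifs with h
      · exact one_pos
      · exact abs_pos.2 (sub_ne_zero.2 h))
  refine ⟨m / 3, by positivity, fun j k _ _ _ hne => ?_⟩
  have := hle (j, k) ()
  simp only [hne, if_false] at this
  linarith

theorem notch_offset_add {b : ℝ} (hsep : Separated S b) {j : ι}
    (hj : ¬ (S j).IsSegment) {σ : ℝ} (hσ : |σ| ≤ b) :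
    notch S b (rootDir S j) (offset S j + σ) = |σ| := by
  apply le_antisymm
  · have := notch_le_abs hj rfl b (offset S j + σ)
    rwa [add_sub_cancel_left] at this
  · rcases notch_eq S b (rootDir S j) (offset S j + σ) with h | ⟨k, hk, hd, h⟩ <;> rw [h]
    · exact hσ
    · by_cases he : offset S j = offset S k
      · rw [he, add_sub_cancel_left]
      · have h1 := hsep j k hj hk hd.symm he
        have h2 := abs_sub_abs_le_abs_sub (offset S j - offset S k) (-σ)
        rw [abs_neg, sub_neg_eq_add] at h2
        rw [show offset S j + σ - offset S k = offset S j - offset S k + σ by ring]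
        linarith

/-- The barrier in direction `d`. -/
def barrier (S : ι → Piece) (b : ℝ) (d x : Plane) : ℝ :=
  inner ℝ x d + halfFacet * notch S b d (inner ℝ x (rot d))

/-- The largest value of the barriers is attained at the vertex `X` in the direction of the
half-line `j`. -/
structure IsPeak (S : ι → Piece) (b : ℝ) (v : ι → ℝ) (j : ι) (X : Plane) : Prop where
  halfLine : ¬ (S j).IsSegment
  mem : X ∈ vertices S
  le : ∀ k, ¬ (S k).IsSegment → ∀ Y ∈ vertices S,
    barrier S b (rootDir S k) (movedVertex S v Y) ≤ barrier S b (rootDir S j) (movedVertex S v X)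

section Peak

variable {b : ℝ} {v κ : ι → ℝ} {α : Plane → ℝ} {i j : ι} {X : Plane}

theorem isHexDir_rootDir (hS : IsSimple S) (i : ι) : IsHexDir (rootDir S i) :=
  hS.isHexDir_dirAt (S i).isEndpoint_base

theorem IsPeak.side (hS : IsSimple S) (hv : v ∈ heightSpace S)
    (hlen : ∀ i, (S i).IsSegment → 0 < deformedLength S v i) (hp : IsPeak S b v j X)
    (hi : (S i).IsSegment) (hX : (S i).IsEndpoint X) {ε : ℝ} (hε : ε = 1 ∨ ε = -1)
    (h1 : (inner ℝ ((S i).dirAt X) (rootDir S j) : ℝ) = 1 / 2)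
    (h2 : (inner ℝ ((S i).dirAt X) (rot (rootDir S j)) : ℝ) = ε * (Real.sqrt 3 / 2)) :
    ∃ k, ¬ (S k).IsSegment ∧ rootDir S k = rootDir S j ∧
      notch S b (rootDir S j) (inner ℝ (movedVertex S v X) (rot (rootDir S j))) =
        ε * (offset S k - inner ℝ (movedVertex S v X) (rot (rootDir S j))) ∧
      0 < ε * (offset S k - inner ℝ (movedVertex S v X) (rot (rootDir S j))) := by
  obtain ⟨Z, hZ, -, -, -, -, hm, -⟩ := exists_other_end hS hi hX
  have hle := hp.le j hp.halfLine Z (mem_vertices_of hZ)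
  have hl := hlen i hi
  set l := deformedLength S v i
  set d := rootDir S j
  have hc := halfFacet_pos
  have hcc := halfFacet_sq
  rw [barrier, barrier, hm v hv, inner_add_left, inner_add_left, real_inner_smul_left,
    real_inner_smul_left, h1, h2, sqrt_three_eq] at hle
  set s := (inner ℝ (movedVertex S v X) (rot d) : ℝ)
  set σ := 3 / 2 * halfFacet * l with hσ
  have hσpos : 0 < σ := by positivity
  have e1 : s + l * (ε * (3 * halfFacet / 2)) = s + ε * σ := by rw [hσ]; ring
  rw [e1] at hle
  have e2 : halfFacet * σ = l / 2 := by rw [hσ]; linear_combination (3 / 2 * l) * hcc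
  have hdrop : notch S b d (s + ε * σ) ≤ notch S b d s - σ := by
    by_contra hcon
    push Not at hcon
    have := mul_lt_mul_of_pos_left hcon hc
    rw [mul_sub, e2] at this
    linarith
  have hεε : ε * ε = 1 := by rcases hε with rfl | rfl <;> norm_num
  rcases notch_eq S b d (s + ε * σ) with h | ⟨k, hk, hkd, h⟩
  · have := notch_le S b d s
    linarith
  · have hn := notch_le_abs hk hkd b s
    have ha : |s - offset S k| = |ε * (offset S k - s)| := by
      rw [abs_mul, show |ε| = 1 by rcases hε with rfl | rfl <;> simp, one_mul, abs_sub_comm]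
    have ha' : |s + ε * σ - offset S k| = |ε * (offset S k - s) - σ| := by
      rw [← one_mul |s + ε * σ - offset S k|, show (1 : ℝ) = |ε| by
        rcases hε with rfl | rfl <;> simp, ← abs_mul, ← abs_neg]
      congr 1
      linear_combination (-σ) * hεε
    rw [ha'] at h
    rw [ha] at hn
    set y := ε * (offset S k - s)
    refine ⟨k, hk, hkd, ?_⟩
    rcases abs_cases (y - σ) with ⟨c1, c2⟩ | ⟨c1, c2⟩ <;>
    rcases abs_cases y with ⟨c3, c4⟩ | ⟨c3, c4⟩ <;>
    constructor <;> linarith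

theorem inner_movedVertex_base (hS : IsSimple S) (hv : v ∈ heightSpace S) (hi : ¬ (S i).IsSegment) :
    (inner ℝ (movedVertex S v (S i).base) (rot (rootDir S i)) : ℝ) = offset S i := by
  have hn := inner_vertexShift_of_mem hS hv (S i).isEndpoint_base
  rw [hv.1 i hi] at hn
  rw [movedVertex, inner_add_left, offset, rootDir, ← Piece.norAt_eq_rot, Piece.norAt,
    real_inner_smul_right, real_inner_smul_right, hn, mul_zero, add_zero]

theorem vertexShift_base (hS : IsSimple S) (hv : v ∈ heightSpace S) (hi : ¬ (S i).IsSegment) :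
    vertexShift S v (S i).base =
      (inner ℝ (vertexShift S v (S i).base) (rootDir S i) : ℝ) • rootDir S i := by
  have hn := inner_vertexShift_of_mem hS hv (S i).isEndpoint_base
  rw [hv.1 i hi] at hn
  have hd := plane_decomp (norm_rootDir hS i) (vertexShift S v (S i).base)
  have h3 : (inner ℝ (vertexShift S v (S i).base) (rot (rootDir S i)) : ℝ) = 0 := by
    rw [rootDir, ← Piece.norAt_eq_rot, Piece.norAt, real_inner_smul_right, hn, mul_zero]
  rwa [h3, zero_smul, add_zero] at hd

/-- Barrier levels above which a peak is no endpoint of an oblique half-line. -/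
def barrierLevel (S : ι → Piece) (b : ℝ) : ℝ := 3 * ∑ i, ‖(S i).base‖ + 2 * halfFacet * b + 1

theorem IsPeak.isSegment (hS : IsSimple S) (hv : v ∈ heightSpace S) (hb : 0 < b)
    (hp : IsPeak S b v j X)
    (hB : barrierLevel S b ≤ barrier S b (rootDir S j) (movedVertex S v X))
    (hX : (S i).IsEndpoint X)
    (h1 : (inner ℝ ((S i).dirAt X) (rootDir S j) : ℝ) = 1 / 2) : (S i).IsSegment := by
  by_contra hi
  have hXb := (Piece.isEndpoint_halfLine_iff hi).1 hX
  subst hXb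
  change (inner ℝ (rootDir S i) (rootDir S j) : ℝ) = 1 / 2 at h1
  have hle := hp.le i hi _ hp.mem
  have hc := halfFacet_pos
  have hnn := notch_nonneg (S := S) hb.le (rootDir S i)
    (inner ℝ (movedVertex S v (S i).base) (rot (rootDir S i)))
  have hnb := notch_le S b (rootDir S j)
    (inner ℝ (movedVertex S v (S i).base) (rot (rootDir S j)))
  have hsh := vertexShift_base hS hv hi
  rw [barrier] at hB
  rw [barrier, barrier] at hle
  set n₁ := notch S b (rootDir S i) (inner ℝ (movedVertex S v (S i).base) (rot (rootDir S i)))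
  set n₂ := notch S b (rootDir S j) (inner ℝ (movedVertex S v (S i).base) (rot (rootDir S j)))
  set r := (inner ℝ (vertexShift S v (S i).base) (rootDir S i) : ℝ)
  rw [movedVertex, inner_add_left, hsh, real_inner_smul_left, h1] at hB
  rw [movedVertex, inner_add_left, inner_add_left, hsh, real_inner_smul_left, real_inner_smul_left,
    h1, inner_self_unit (norm_rootDir hS i)] at hle
  have b1 := (abs_le.1 (abs_inner_unit_le (norm_rootDir hS i) (S i).base)).1
  have b2 := (abs_le.1 (abs_inner_unit_le (norm_rootDir hS j) (S i).base)).2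
  have b3 : ‖(S i).base‖ ≤ ∑ k, ‖(S k).base‖ :=
    Finset.single_le_sum (f := fun k => ‖(S k).base‖) (fun k _ => norm_nonneg _) (Finset.mem_univ i)
  have m1 := mul_nonneg hc.le hnn
  have m2 := mul_le_mul_of_nonneg_left hnb hc.le
  rw [barrierLevel] at hB
  nlinarith

theorem IsPeak.exists_isPair (hS : IsSimple S) (hv : v ∈ heightSpace S) (hb : 0 < b)
    (hsep : Separated S b)
    (hlen : ∀ i, (S i).IsSegment → 0 < deformedLength S v i) (hp : IsPeak S b v j X)
    (hB : barrierLevel S b ≤ barrier S b (rootDir S j) (movedVertex S v X))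
    (hX : (S i).IsEndpoint X)
    (h1 : (inner ℝ ((S i).dirAt X) (rootDir S j) : ℝ) = 1 / 2) :
    ∃ m, IsPair S X i m ∧ (S m).dirAt X = -rootDir S j := by
  have hd := isHexDir_rootDir hS j
  set d := rootDir S j with hdd
  have hs3 := sqrt_three_pos
  have hs3' := sqrt_three_sq
  have hr : ∃ ε : ℝ, (ε = 1 ∨ ε = -1) ∧
      (inner ℝ ((S i).dirAt X) (rot d) : ℝ) = ε * (Real.sqrt 3 / 2) := by
    rcases hd.relative (hS.isHexDir_dirAt hX) with ⟨-, h | h⟩ | ⟨h | h, -⟩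
    · rw [h1] at h; norm_num at h
    · rw [h1] at h; norm_num at h
    · exact ⟨1, Or.inl rfl, by rw [h]; ring⟩
    · exact ⟨-1, Or.inr rfl, by rw [h]; ring⟩
  obtain ⟨ε, hε, h2⟩ := hr
  have hi := hp.isSegment hS hv hb hB hX h1
  obtain ⟨k, hk, hkd, hk1, hk2⟩ := hp.side hS hv hlen hi hX hε h1 h2
  have key : ∀ {m}, m ≠ i → (S m).IsEndpoint X → (S m).dirAt X = -d := by
    intro m hmi hm
    have hin := hS.inner_dirAt hmi hm hX
    have e := inner_decomp hd.1 ((S m).dirAt X) ((S i).dirAt X)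
    rw [hin, h1, h2] at e
    rcases hd.relative (hS.isHexDir_dirAt hm) with ⟨p, q⟩ | ⟨p, q⟩
    · have q' : (inner ℝ ((S m).dirAt X) d : ℝ) = -1 := by
        rcases q with q | q
        · rw [p, q] at e; norm_num at e
        · exact q
      have := plane_decomp hd.1 ((S m).dirAt X)
      rw [p, q', zero_smul, add_zero, neg_one_smul] at this
      exact this
    · exfalso
      have q1 : (inner ℝ ((S m).dirAt X) d : ℝ) = 1 / 2 ∧
          (inner ℝ ((S m).dirAt X) (rot d) : ℝ) = -ε * (Real.sqrt 3 / 2) := by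
        rcases hε with rfl | rfl <;> rcases p with p | p <;> rcases q with q | q <;>
          rw [p, q] at e <;> first | (exfalso; nlinarith) | exact ⟨q, by rw [p]; ring⟩
      obtain ⟨k', hk', hkd', hk1', hk2'⟩ := hp.side hS hv hlen
        (hp.isSegment hS hv hb hB hm q1.1) hm (ε := -ε)
        (by rcases hε with rfl | rfl <;> simp) q1.1 q1.2
      have hnb := notch_le S b d (inner ℝ (movedVertex S v X) (rot d))
      set s := (inner ℝ (movedVertex S v X) (rot d) : ℝ)
      rw [← hdd] at hk1'
      have hdiff : ε * (offset S k - offset S k') = 2 * notch S b d s := by linarith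
      have hpos : 0 < notch S b d s := by linarith
      have hne : offset S k ≠ offset S k' := by
        intro he; rw [he, sub_self, mul_zero] at hdiff; linarith
      have h3 := hsep k k' hk hk' (hkd.trans hkd'.symm) hne
      have h4 : |offset S k - offset S k'| = 2 * notch S b d s := by
        rw [← hdiff, ← abs_of_pos (show 0 < ε * (offset S k - offset S k') by linarith), abs_mul,
          show |ε| = 1 by rcases hε with rfl | rfl <;> simp, one_mul]
      linarith
  rcases hS.degree_eq hX with hdeg | hdeg
  · obtain ⟨m, hm⟩ := hS.exists_pair hX hdeg
    exact ⟨m, hm, key hm.ne.symm hm.right⟩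
  · exfalso
    obtain ⟨m, n, ht⟩ := hS.exists_triple hX hdeg
    have e1 := key ht.ne_ij.symm ht.second
    have e2 := key ht.ne_ik.symm ht.third
    have e3 := ht.inner_jk
    rw [e1, e2, inner_neg_neg, inner_self_unit hd.1] at e3
    norm_num at e3

/-- Where and how fast a high peak moves. -/
inductive PeakMotion (S : ι → Piece) (b : ℝ) (v κ : ι → ℝ) (j : ι) (X : Plane) : Prop
  | guided (i : ι) (hi : ¬ (S i).IsSegment) (hX : X = (S i).base) (hd : rootDir S i = rootDir S j)
      (h : (inner ℝ (vertexShift S (-κ) X) (rootDir S j) : ℝ) ≤ 2 * halfFacet / b)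
  | sliding (k : ι) (ε : ℝ) (hk : ¬ (S k).IsSegment) (hd : rootDir S k = rootDir S j)
      (hn : notch S b (rootDir S j) (inner ℝ (movedVertex S v X) (rot (rootDir S j))) =
        ε * (offset S k - inner ℝ (movedVertex S v X) (rot (rootDir S j))))
      (hpos : 0 < ε * (offset S k - inner ℝ (movedVertex S v X) (rot (rootDir S j))))
      (hε : ε = 1 ∨ ε = -1)
      (h : (inner ℝ (vertexShift S (-κ) X) (rootDir S j) : ℝ) -
        ε * halfFacet * inner ℝ (vertexShift S (-κ) X) (rot (rootDir S j)) ≤ 0)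
  | retreating (h : ∀ ε : ℝ, ε = 1 ∨ ε = -1 →
      (inner ℝ (vertexShift S (-κ) X) (rootDir S j) : ℝ) +
        ε * halfFacet * inner ℝ (vertexShift S (-κ) X) (rot (rootDir S j)) ≤ 0)

theorem IsPeak.motion (hS : IsSimple S) (hv : v ∈ heightSpace S) (hb : 0 < b)
    (hsep : Separated S b)
    (hlen : ∀ i, (S i).IsSegment → 0 < deformedLength S v i)
    (hdr : IsDriven S (deformedLength S v) κ α) (hp : IsPeak S b v j X)
    (hB : barrierLevel S b ≤ barrier S b (rootDir S j) (movedVertex S v X)) :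
    PeakMotion S b v κ j X := by
  have hd := isHexDir_rootDir hS j
  have hs3 := sqrt_three_pos
  have hs3' := sqrt_three_sq
  have hs3c := sqrt_three_eq
  have hc := halfFacet_pos
  have hcc := halfFacet_sq
  have hmem : -κ ∈ heightSpace S := neg_mem hdr.mem
  by_cases hA : ∃ i, (S i).IsEndpoint X ∧ (inner ℝ ((S i).dirAt X) (rootDir S j) : ℝ) = 1
  · obtain ⟨i, hX, h1⟩ := hA
    have hdi : (S i).dirAt X = rootDir S j := by
      rcases hd.relative (hS.isHexDir_dirAt hX) with ⟨p, -⟩ | ⟨-, q | q⟩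
      · have := plane_decomp hd.1 ((S i).dirAt X)
        rwa [h1, p, one_smul, zero_smul, add_zero] at this
      · rw [h1] at q; norm_num at q
      · rw [h1] at q; norm_num at q
    have hi : ¬ (S i).IsSegment := by
      intro hi
      obtain ⟨Z, hZ, -, -, -, -, hm, -⟩ := exists_other_end hS hi hX
      have hle := hp.le j hp.halfLine Z (mem_vertices_of hZ)
      rw [barrier, barrier, hm v hv, hdi, inner_add_left, inner_add_left, real_inner_smul_left,
        real_inner_smul_left, inner_self_rot, inner_self_unit hd.1, mul_zero, add_zero] at hle
      linarith [hlen i hi]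
    have hXb := (Piece.isEndpoint_halfLine_iff hi).1 hX
    have hroot : rootDir S i = rootDir S j := by rw [← hdi, hXb]; rfl
    refine .guided i hi hXb hroot ?_
    obtain ⟨k, hki, hkX⟩ := hS.network.no_free_end i X hX
    have hXdot := vertexShift_base hS hmem hi
    rw [← hXb, hroot] at hXdot
    set a := (inner ℝ (vertexShift S (-κ) X) (rootDir S j) : ℝ)
    have hak := inner_vertexShift_of_mem hS hmem hkX
    rw [hXdot, real_inner_smul_left, Pi.neg_apply] at hak
    have hik := hS.inner_dirAt hki hkX hX
    rw [hdi] at hik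
    have hB2 : (inner ℝ (rootDir S j) (S k).normal : ℝ) ^ 2 = 3 / 4 := by
      have e := inner_rot_sq ((hS.nondegenerate k).norm_dirAt hkX) hd.1 hik
      rw [← Piece.norAt_eq_rot, Piece.norAt, real_inner_smul_left, mul_pow, sq ((S k).sgn X),
        (hS.nondegenerate k).sgn_mul_self hkX, one_mul, real_inner_comm] at e
      exact e
    set β := (inner ℝ (rootDir S j) (S k).normal : ℝ)
    have hCpos : 0 < 2 * halfFacet / b := by positivity
    by_cases hk : (S k).IsSegment
    · have hl := hlen k hk
      obtain ⟨Z, hZ, -, -, hdirZ, -, hm, -⟩ := exists_other_end hS hk hkX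
      rcases le_or_gt (3 / 2 * halfFacet * deformedLength S v k) b with hshort | hlong
      · refine le_trans ?_ hCpos.le
        have hrk : |(inner ℝ ((S k).dirAt X) (rot (rootDir S j)) : ℝ)| = 3 / 2 * halfFacet := by
          have e := inner_rot_sq hd.1 ((hS.nondegenerate k).norm_dirAt hkX)
            (by rw [real_inner_comm]; exact hik)
          rw [← abs_of_pos (show 0 < 3 / 2 * halfFacet by positivity), ← sq_eq_sq_iff_abs_eq_abs,
            real_inner_comm, e]
          linear_combination (-9 / 4) * hcc
        have hpZ : barrier S b (rootDir S j) (movedVertex S v Z) =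
            barrier S b (rootDir S j) (movedVertex S v X) := by
          have hs : (inner ℝ (movedVertex S v X) (rot (rootDir S j)) : ℝ) = offset S i := by
            rw [hXb, ← hroot]; exact inner_movedVertex_base hS hv hi
          have n0 := notch_offset_add hsep hi (σ := 0) (by rw [abs_zero]; exact hb.le)
          have hσ : |deformedLength S v k * (inner ℝ ((S k).dirAt X) (rot (rootDir S j)) : ℝ)| =
              3 / 2 * halfFacet * deformedLength S v k := by
            rw [abs_mul, hrk, abs_of_pos hl]; ring
          have n1 := notch_offset_add hsep hi (σ := deformedLength S v k *
            (inner ℝ ((S k).dirAt X) (rot (rootDir S j)) : ℝ)) (by rw [hσ]; exact hshort)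
          rw [add_zero, abs_zero] at n0
          rw [hroot] at n0 n1
          rw [barrier, barrier, hm v hv, inner_add_left, inner_add_left, real_inner_smul_left,
            real_inner_smul_left, hs, n1, n0, hσ, hik]
          linear_combination (3 / 2 * deformedLength S v k) * hcc
        have hpeakZ : IsPeak S b v j Z := ⟨hp.halfLine, mem_vertices_of hZ, fun k' hk' Y hY => by
          rw [hpZ]; exact hp.le k' hk' Y hY⟩
        obtain ⟨m, hpair, hdm⟩ := hpeakZ.exists_isPair hS hv hb hsep hlen (by rwa [hpZ]) hZ
          (by rw [hdirZ, inner_neg_left, hik]; norm_num)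
        have hsgn := hdr.inner_normal_dirAt_nonneg hS hk hl hpair
        rw [hdm, inner_neg_right, real_inner_comm] at hsgn
        change 0 ≤ -κ k * -β at hsgn
        have e : -κ k * -β = -(a * β ^ 2) := by rw [← hak]; ring
        rw [e, hB2] at hsgn
        linarith
      · have hκ := hdr.abs_current_mul_len_le hS hk
        rw [le_div_iff₀ hb]
        have h3 : |a| * (3 / 2 * halfFacet) = |κ k| := by
          have h4 : (|a| * (3 / 2 * halfFacet)) ^ 2 = |κ k| ^ 2 := by
            rw [mul_pow, sq_abs, sq_abs]
            have : κ k ^ 2 = a ^ 2 * β ^ 2 := by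
              rw [show κ k = -(a * β) by linarith]; ring
            rw [this, hB2]
            linear_combination (9 / 4 * a ^ 2) * hcc
          exact (sq_eq_sq₀ (by positivity) (abs_nonneg _)).1 h4
        rw [abs_mul, abs_of_pos hl, ← h3] at hκ
        have h5 := le_abs_self a
        nlinarith [abs_nonneg a]
    · rw [hdr.mem.1 k hk, neg_zero] at hak
      have : a = 0 := by
        rcases mul_eq_zero.1 hak with h | h
        · exact h
        · rw [h] at hB2; norm_num at hB2
      rw [this]; exact hCpos.le
  by_cases hA' : ∃ i, (S i).IsEndpoint X ∧ (inner ℝ ((S i).dirAt X) (rootDir S j) : ℝ) = 1 / 2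
  · obtain ⟨i, hX, h1⟩ := hA'
    obtain ⟨m, hpair, hdm⟩ := hp.exists_isPair hS hv hb hsep hlen hB hX h1
    have hi := hp.isSegment hS hv hb hB hX h1
    have hr : ∃ ε : ℝ, (ε = 1 ∨ ε = -1) ∧
        (inner ℝ ((S i).dirAt X) (rot (rootDir S j)) : ℝ) = ε * (Real.sqrt 3 / 2) := by
      rcases hd.relative (hS.isHexDir_dirAt hX) with ⟨-, h | h⟩ | ⟨h | h, -⟩
      · rw [h1] at h; norm_num at h
      · rw [h1] at h; norm_num at h
      · exact ⟨1, Or.inl rfl, by rw [h]; ring⟩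
      · exact ⟨-1, Or.inr rfl, by rw [h]; ring⟩
    obtain ⟨ε, hε, h2⟩ := hr
    obtain ⟨k, hk, hkd, hk1, hk2⟩ := hp.side hS hv hlen hi hX hε h1 h2
    refine .sliding k ε hk hkd hk1 hk2 hε ?_
    obtain ⟨p, q, hp0, hq0, hpq⟩ := hdr.exists_cone hS hlen hpair
    rw [hpq, hdm, inner_add_left, inner_add_left, real_inner_smul_left, real_inner_smul_left,
      real_inner_smul_left, real_inner_smul_left, inner_neg_left, inner_neg_left, inner_self_rot,
      inner_self_unit hd.1, h1, h2, hs3c]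
    have hεε : ε * ε = 1 := by rcases hε with rfl | rfl <;> norm_num
    have : p * (1 / 2) + q * -1 - ε * halfFacet * (p * (ε * (3 * halfFacet / 2)) + q * -0) =
        -q := by
      linear_combination (-3 / 2 * p * halfFacet * halfFacet) * hεε - (3 / 2 * p) * hcc
    rw [this]; linarith
  · push Not at hA hA'
    refine .retreating ?_
    obtain ⟨i₀, hi₀⟩ := mem_vertices.1 hp.mem
    have hall : ∀ {i}, (S i).IsEndpoint X →
        (inner ℝ ((S i).dirAt X) (rootDir S j) : ℝ) = -(1 / 2) := by
      intro i hi
      rcases hd.relative (hS.isHexDir_dirAt hi) with ⟨p, q | q⟩ | ⟨-, q | q⟩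
      · exact absurd q (hA i hi)
      · exfalso
        obtain ⟨k, hki, hk⟩ := hS.network.no_free_end i X hi
        have e := inner_decomp hd.1 ((S k).dirAt X) ((S i).dirAt X)
        rw [hS.inner_dirAt hki hk hi, p, q, mul_zero, add_zero] at e
        exact hA' k hk (by linarith)
      · exact absurd q (hA' i hi)
      · exact q
    have hdeg : degree S X = 2 := by
      rcases hS.degree_eq hi₀ with h | h
      · exact h
      · exfalso
        obtain ⟨k, l, ht⟩ := hS.exists_triple hi₀ h
        have hsum := ht.sum_dirAt hS
        rw [ht.sum_eq fun m hm => dirAt_eq_zero hm] at hsum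
        have h0 : (inner ℝ ((S i₀).dirAt X + (S k).dirAt X + (S l).dirAt X) (rootDir S j) : ℝ) = 0 := by
          rw [hsum, inner_zero_left]
        rw [inner_add_left, inner_add_left, hall ht.first, hall ht.second, hall ht.third] at h0
        norm_num at h0
    obtain ⟨m, hpair⟩ := hS.exists_pair hi₀ hdeg
    obtain ⟨p, q, hp0, hq0, hpq⟩ := hdr.exists_cone hS hlen hpair
    have hbound : ∀ {i}, (S i).IsEndpoint X → ∀ ε : ℝ, ε = 1 ∨ ε = -1 →
        (inner ℝ ((S i).dirAt X) (rootDir S j) : ℝ) +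
          ε * halfFacet * inner ℝ ((S i).dirAt X) (rot (rootDir S j)) ≤ 0 := by
      intro i hi ε hε
      rw [hall hi]
      rcases hd.relative (hS.isHexDir_dirAt hi) with ⟨p, -⟩ | ⟨p | p, -⟩ <;> rw [p]
      · norm_num
      · rcases hε with rfl | rfl <;> rw [hs3c] <;> nlinarith
      · rcases hε with rfl | rfl <;> rw [hs3c] <;> nlinarith
    intro ε hε
    have b1 := mul_nonpos_of_nonneg_of_nonpos hp0 (hbound hi₀ ε hε)
    have b2 := mul_nonpos_of_nonneg_of_nonpos hq0 (hbound hpair.right ε hε)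
    rw [hpq, inner_add_left, inner_add_left, real_inner_smul_left, real_inner_smul_left,
      real_inner_smul_left, real_inner_smul_left]
    linarith

end Peak

/-! ### Boundedness of the endpoints of the half-lines -/

theorem continuous_notch (S : ι → Piece) (b : ℝ) (d : Plane) : Continuous (notch S b d) :=
  (LipschitzWith.of_le_add fun s s' => notch_le_add S b d s s').continuous

theorem continuous_barrier (S : ι → Piece) (b : ℝ) (d : Plane) : Continuous (barrier S b d) := by
  unfold barrier
  have := continuous_notch S b d
  fun_prop

theorem eventually_le_add_of_hasDerivWithinAt {f : ℝ → ℝ} {f' K x : ℝ}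
    (hf : HasDerivWithinAt f f' (Ici x) x) (hK : f' < K) :
    ∀ᶠ t in 𝓝[>] x, f t ≤ f x + K * (t - x) := by
  have h := (hf.mono Ioi_subset_Ici_self).limsup_slope_le' (lt_irrefl x) hK
  filter_upwards [h, self_mem_nhdsWithin] with t ht hxt
  rw [slope_def_field, div_lt_iff₀ (sub_pos.2 hxt)] at ht
  linarith

section Bound

variable {T : EReal} {h : ℝ → heightSpace S} {b x : ℝ} {X : Plane}

theorem IsSolution.hasDerivWithinAt_movedVertex
    (hsol : IsSolution (velocity S) (regularHeights S) 0 T h) (hx : x ∈ timeInterval T)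
    (X : Plane) : HasDerivWithinAt (fun t => movedVertex S (h t).1 X)
      (vertexShift S (-(current S (h x).1).1) X) (Ici x) x := by
  have h1 := hsol.hasDerivWithinAt_Ici (fun v hv => contDiffAt_velocity hv) hx
  have h2 := (heightSpace S).subtypeL.hasFDerivAt.comp_hasDerivWithinAt x h1
  exact ((LinearMap.toContinuousLinearMap (vertexShiftLin S X)).hasFDerivAt.comp_hasDerivWithinAt x
    h2).const_add X

theorem IsSolution.eventually_inner_le
    (hsol : IsSolution (velocity S) (regularHeights S) 0 T h) (hx : x ∈ timeInterval T)
    (X d : Plane) {a K : ℝ}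
    (hK : (inner ℝ (vertexShift S (-(current S (h x).1).1) X) d : ℝ) +
      a * inner ℝ (vertexShift S (-(current S (h x).1).1) X) (rot d) < K) :
    ∀ᶠ t in 𝓝[>] x, (inner ℝ (movedVertex S (h t).1 X) d : ℝ) +
        a * inner ℝ (movedVertex S (h t).1 X) (rot d) ≤
      inner ℝ (movedVertex S (h x).1 X) d + a * inner ℝ (movedVertex S (h x).1 X) (rot d) +
        K * (t - x) := by
  have h1 := hsol.hasDerivWithinAt_movedVertex hx X
  have h2 := h1.inner ℝ (hasDerivWithinAt_const x (Ici x) d)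
  have h3 := (h1.inner ℝ (hasDerivWithinAt_const x (Ici x) (rot d))).const_mul a
  simp only [inner_zero_right, zero_add] at h2 h3
  exact eventually_le_add_of_hasDerivWithinAt (h2.add h3) hK

theorem IsSolution.eventually_barrier_le (hS : IsSimple S)
    (hsol : IsSolution (velocity S) (regularHeights S) 0 T h) (hx : x ∈ timeInterval T)
    (hb : 0 < b) (hsep : Separated S b) {j : ι} (hp : IsPeak S b (h x).1 j X)
    (hB : barrierLevel S b ≤ barrier S b (rootDir S j) (movedVertex S (h x).1 X)) :
    ∀ᶠ t in 𝓝[>] x, barrier S b (rootDir S j) (movedVertex S (h t).1 X) ≤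
      barrier S b (rootDir S j) (movedVertex S (h x).1 X) + (2 * halfFacet / b + 1) * (t - x) := by
  have hlen := hsol.mem x hx
  have hc := halfFacet_pos
  have hK : 0 < 2 * halfFacet / b := by positivity
  obtain ⟨α, hdr⟩ := exists_isDriven_current hS hlen
  have hcont : ContinuousWithinAt (fun t => movedVertex S (h t).1 X) (Ioi x) x :=
    (hsol.hasDerivWithinAt_movedVertex hx X).continuousWithinAt.mono Ioi_subset_Ici_self
  rcases hp.motion hS (h x).2 hb hsep hlen hdr hB with
    ⟨i, hi, hX, hd, hle⟩ | ⟨k, ε, hk, hd, hn, hpos, hε, hle⟩ | hle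
  · filter_upwards [hsol.eventually_inner_le hx X (rootDir S j) (a := 0)
      (K := 2 * halfFacet / b + 1) (by linarith)] with t ht
    have hs : (inner ℝ (movedVertex S (h t).1 X) (rot (rootDir S j)) : ℝ) = offset S i := by
      rw [hX, ← hd]; exact inner_movedVertex_base hS (h t).2 hi
    have h1 := notch_le_abs hi hd b (offset S i)
    rw [sub_self, abs_zero] at h1
    have h2 := notch_nonneg (S := S) hb.le (rootDir S j)
      (inner ℝ (movedVertex S (h x).1 X) (rot (rootDir S j)))
    rw [barrier, barrier, hs]
    nlinarith
  · have hev : ∀ᶠ t in 𝓝[>] x,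
        0 < ε * (offset S k - inner ℝ (movedVertex S (h t).1 X) (rot (rootDir S j))) := by
      have : ContinuousWithinAt (fun t => ε * (offset S k -
          inner ℝ (movedVertex S (h t).1 X) (rot (rootDir S j)))) (Ioi x) x :=
        continuousWithinAt_const.mul (continuousWithinAt_const.sub
          (hcont.inner continuousWithinAt_const))
      exact this.eventually (lt_mem_nhds hpos)
    filter_upwards [hev, hsol.eventually_inner_le hx X (rootDir S j) (a := -(ε * halfFacet))
      (K := 2 * halfFacet / b + 1) (by linarith)] with t ht0 ht
    have h1 := notch_le_abs hk hd b (inner ℝ (movedVertex S (h t).1 X) (rot (rootDir S j)))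
    have h2 : |(inner ℝ (movedVertex S (h t).1 X) (rot (rootDir S j)) : ℝ) - offset S k| =
        ε * (offset S k - inner ℝ (movedVertex S (h t).1 X) (rot (rootDir S j))) := by
      rw [← abs_of_pos ht0, abs_mul, show |ε| = 1 by rcases hε with rfl | rfl <;> simp, one_mul,
        abs_sub_comm]
    rw [h2] at h1
    rw [barrier, barrier, hn]
    have h3 := mul_le_mul_of_nonneg_left h1 hc.le
    linarith
  · filter_upwards [hsol.eventually_inner_le hx X (rootDir S j) (a := 1 * halfFacet)
        (K := 2 * halfFacet / b + 1) (by linarith [hle 1 (Or.inl rfl)]),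
      hsol.eventually_inner_le hx X (rootDir S j) (a := -1 * halfFacet)
        (K := 2 * halfFacet / b + 1) (by linarith [hle (-1) (Or.inr rfl)])] with t h1 h2
    have h3 := notch_le_add S b (rootDir S j)
      (inner ℝ (movedVertex S (h t).1 X) (rot (rootDir S j)))
      (inner ℝ (movedVertex S (h x).1 X) (rot (rootDir S j)))
    have h4 := mul_le_mul_of_nonneg_left h3 hc.le
    rw [barrier, barrier]
    rcases abs_cases ((inner ℝ (movedVertex S (h t).1 X) (rot (rootDir S j)) : ℝ) -
      inner ℝ (movedVertex S (h x).1 X) (rot (rootDir S j))) with ⟨e, -⟩ | ⟨e, -⟩ <;>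
    rw [e] at h4 <;> linarith

theorem IsSolution.barrier_le (hS : IsSimple S)
    (hsol : IsSolution (velocity S) (regularHeights S) 0 T h) (hb : 0 < b) (hsep : Separated S b)
    {B : ℝ} (hB : barrierLevel S b ≤ B)
    (h0 : ∀ j, ¬ (S j).IsSegment → ∀ X ∈ vertices S, barrier S b (rootDir S j) X ≤ B)
    {t : ℝ} (ht : t ∈ timeInterval T) :
    ∀ j, ¬ (S j).IsSegment → ∀ X ∈ vertices S,
      barrier S b (rootDir S j) (movedVertex S (h t).1 X) ≤
        B + (2 * halfFacet / b + 1) * t := by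
  have hc := halfFacet_pos
  have hK : 0 < 2 * halfFacet / b + 1 := by positivity
  set K := 2 * halfFacet / b + 1 with hKdef
  have hsub : Icc 0 t ⊆ timeInterval T := fun s hs =>
    ⟨hs.1, (EReal.coe_le_coe_iff.2 hs.2).trans_lt ht.2⟩
  let A := {j : ι // ¬ (S j).IsSegment} × {X : Plane // X ∈ vertices S}
  let g : A → ℝ → ℝ := fun a s => barrier S b (rootDir S a.1.1) (movedVertex S (h s).1 a.2.1)
  have hg : ∀ a, ContinuousOn (g a) (timeInterval T) := fun a =>
    (continuous_barrier S b _).comp_continuousOn ((continuous_movedVertex S _).comp_continuousOn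
      (continuous_subtype_val.comp_continuousOn hsol.cont))
  suffices hmain : Icc 0 t ⊆ {s | ∀ a, g a s ≤ B + K * s} from
    fun j hj X hX => hmain ⟨ht.1, le_rfl⟩ (⟨j, hj⟩, ⟨X, hX⟩)
  apply IsClosed.Icc_subset_of_forall_mem_nhdsWithin
  · have : {s | ∀ a, g a s ≤ B + K * s} ∩ Icc 0 t =
        Icc 0 t ∩ ⋂ a, {s ∈ Icc 0 t | g a s ≤ B + K * s} := by
      ext s
      simp only [mem_inter_iff, mem_ofPred_eq, mem_iInter]
      exact ⟨fun hs => ⟨hs.2, fun a => ⟨hs.2, hs.1 a⟩⟩, fun hs => ⟨fun a => (hs.2 a).2, hs.1⟩⟩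
    rw [this]
    exact isClosed_Icc.inter (isClosed_iInter fun a =>
      isClosed_Icc.isClosed_le ((hg a).mono hsub) (by fun_prop))
  · intro a
    change barrier S b _ (movedVertex S (h 0).1 _) ≤ _
    have : movedVertex S (h 0).1 a.2.1 = a.2.1 := by
      rw [hsol.init, movedVertex]
      change a.2.1 + vertexShift S 0 _ = _
      rw [vertexShift_zero, add_zero]
    rw [this, mul_zero, add_zero]
    exact h0 _ a.1.2 _ a.2.2
  · rintro x ⟨hxs, hx⟩
    have hxT := hsub (Ico_subset_Icc_self hx)
    change ∀ᶠ s in 𝓝[>] x, ∀ a, g a s ≤ B + K * s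
    rw [eventually_all]
    intro a
    rcases (hxs a).lt_or_eq with hlt | heq
    · have h1 : ContinuousWithinAt (g a) (Ioi x) x :=
        (continuousWithinAt_Ici_of_timeInterval (hg a) hxT).mono Ioi_subset_Ici_self
      have h2 : ContinuousWithinAt (fun s => B + K * s) (Ioi x) x := by fun_prop
      exact (h1.tendsto.eventually_lt h2.tendsto hlt).mono fun s hs => hs.le
    · have hp : IsPeak S b (h x).1 a.1.1 a.2.1 := ⟨a.1.2, a.2.2, fun k hk Y hY => by
        have := hxs (⟨k, hk⟩, ⟨Y, hY⟩)
        exact this.trans_eq heq.symm⟩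
      have hlev : barrierLevel S b ≤ g a x := by
        rw [heq]; linarith [mul_nonneg hK.le hx.1]
      filter_upwards [hsol.eventually_barrier_le hS hxT hb hsep hp hlev] with s hs
      change g a s ≤ g a x + K * (s - x) at hs
      rw [heq] at hs
      linarith

/-- The endpoints of the half-lines recede with finite speed. -/
theorem IsSolution.exists_base_le (hS : IsSimple S)
    (hsol : IsSolution (velocity S) (regularHeights S) 0 T h) (τ : ℝ) :
    ∃ M, 0 ≤ M ∧ ∀ t ∈ timeInterval T, t ≤ τ → ∀ j, ¬ (S j).IsSegment →
      (inner ℝ (vertexShift S (h t).1 (S j).base) (rootDir S j) : ℝ) ≤ M := by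
  obtain ⟨b, hb, hsep⟩ := exists_separated S
  have hc := halfFacet_pos
  have hK : 0 < 2 * halfFacet / b + 1 := by positivity
  set K := 2 * halfFacet / b + 1 with hKdef
  let A := {j : ι // ¬ (S j).IsSegment} × {X : Plane // X ∈ vertices S}
  obtain ⟨B₁, hB₁⟩ := (Set.finite_range fun a : A => barrier S b (rootDir S a.1.1) a.2.1).bddAbove
  have h0 : ∀ j, ¬ (S j).IsSegment → ∀ X ∈ vertices S,
      barrier S b (rootDir S j) X ≤ max B₁ (barrierLevel S b) := fun j hj X hX =>
    (hB₁ ⟨(⟨j, hj⟩, ⟨X, hX⟩), rfl⟩).trans (le_max_left _ _)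
  set B := max B₁ (barrierLevel S b)
  refine ⟨|B| + K * |τ| + ∑ i, ‖(S i).base‖, by positivity, fun t ht htτ j hj => ?_⟩
  have h1 := hsol.barrier_le hS hb hsep (le_max_right _ _) h0 ht j hj _
    (mem_vertices_of (S j).isEndpoint_base)
  have h2 := notch_nonneg (S := S) hb.le (rootDir S j)
    (inner ℝ (movedVertex S (h t).1 (S j).base) (rot (rootDir S j)))
  have h3 := mul_nonneg hc.le h2
  rw [barrier] at h1
  have h4 : (inner ℝ (movedVertex S (h t).1 (S j).base) (rootDir S j) : ℝ) =
      inner ℝ (S j).base (rootDir S j) +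
        inner ℝ (vertexShift S (h t).1 (S j).base) (rootDir S j) := by
    rw [movedVertex, inner_add_left]
  have h5 := (abs_le.1 (abs_inner_unit_le (norm_rootDir hS j) (S j).base)).1
  have h6 : ‖(S j).base‖ ≤ ∑ k, ‖(S k).base‖ :=
    Finset.single_le_sum (f := fun k => ‖(S k).base‖) (fun k _ => norm_nonneg _) (Finset.mem_univ j)
  have h7 : K * t ≤ K * |τ| := mul_le_mul_of_nonneg_left (htτ.trans (le_abs_self τ)) hK.le
  have h8 := le_abs_self B
  change _ ≤ B + K * t at h1
  linarith

end Bound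

/-! ### Convergence of the heights in finite time -/

theorem load_eq_sum (S : ι → Piece) (v : ι → ℝ) :
    load S v = ∑ i, -∑ X ∈ vertices S, (S i).sgn X • (inner ℝ (vertexShift S v X) (S i).tangent : ℝ) := by
  have h1 : load S v = -∑ X ∈ vertices S, ∑ i, (S i).sgn X * v i * vertexValue S i X := by
    rw [load, Finset.sum_comm, ← Finset.sum_neg_distrib]
    refine Finset.sum_congr rfl fun i _ => ?_
    rw [mul_neg, Finset.mul_sum]
    congr 1
    exact Finset.sum_congr rfl fun X _ => by ring
  rw [h1, Finset.sum_neg_distrib, Finset.sum_comm]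
  congr 1
  rw [Finset.sum_comm, Finset.sum_comm (s := Finset.univ)]
  refine Finset.sum_congr rfl fun X _ => ?_
  rw [← inner_vertexShift_sum_dirAt, inner_sum]
  refine Finset.sum_congr rfl fun i _ => ?_
  rw [Piece.dirAt, real_inner_smul_right, smul_eq_mul]

theorem neg_sum_sgn_smul_halfLine {i : ι} (hi : ¬ (S i).IsSegment) (v : ι → ℝ) :
    -∑ X ∈ vertices S, (S i).sgn X • (inner ℝ (vertexShift S v X) (S i).tangent : ℝ) =
      -inner ℝ (vertexShift S v (S i).base) (rootDir S i) := by
  rw [sum_sgn_smul, rootDir, Piece.dirAt, real_inner_smul_right]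
  rcases (S i).extent_cases with ⟨L, h'⟩ | h' | h'
  · exact absurd ⟨L, h'⟩ hi
  · simp [Piece.startPt, Piece.endPt, Piece.sgn, h']
  · simp [Piece.startPt, Piece.endPt, Piece.sgn, h']

theorem le_load {v : ι → ℝ} {M : ℝ} (hM : 0 ≤ M) (hL : ∀ i, 0 ≤ deformedLength S 0 i)
    (hlen : ∀ i, (S i).IsSegment → 0 < deformedLength S v i)
    (hbase : ∀ j, ¬ (S j).IsSegment →
      (inner ℝ (vertexShift S v (S j).base) (rootDir S j) : ℝ) ≤ M) :
    -∑ i, (deformedLength S 0 i + M) ≤ load S v := by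
  rw [load_eq_sum, ← Finset.sum_neg_distrib]
  refine Finset.sum_le_sum fun i _ => ?_
  by_cases hi : (S i).IsSegment
  · obtain ⟨L, h⟩ := hi
    have h1 := hlen i ⟨L, h⟩
    rw [sum_sgn_smul_segment _ h, deformedLength_zero h]
    rw [deformedLength_segment h, inner_sub_left] at h1
    linarith
  · rw [neg_sum_sgn_smul_halfLine hi]
    linarith [hbase i hi, hL i]

theorem deformedLength_zero_nonneg (hS : IsSimple S) (i : ι) : 0 ≤ deformedLength S 0 i := by
  by_cases hi : (S i).IsSegment
  · exact (zero_mem_regularHeights hS i hi).le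
  · rw [deformedLength_halfLine hi]

theorem exists_tendsto_of_antitoneOn {f : ℝ → ℝ} {a τ m : ℝ} (hτ : a < τ)
    (hf : AntitoneOn f (Ioo a τ)) (hm : ∀ t ∈ Ioo a τ, m ≤ f t) :
    ∃ l, Tendsto f (𝓝[<] τ) (𝓝 l) :=
  ⟨_, hf.tendsto_nhdsWithin_Ioo_left (nonempty_Ioo.2 hτ)
    ⟨m, by rintro _ ⟨t, ht, rfl⟩; exact hm t ht⟩⟩

theorem exists_tendsto_of_abs_deriv_le {F g : ℝ → ℝ} {τ m : ℝ} (hτ : 0 < τ)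
    {F' g' : ℝ → ℝ} (hF : ∀ t ∈ Ioo 0 τ, HasDerivAt F (F' t) t)
    (hg : ∀ t ∈ Ioo 0 τ, HasDerivAt g (g' t) t) (hle : ∀ t ∈ Ioo 0 τ, |g' t| ≤ -F' t)
    (hm : ∀ t ∈ Ioo 0 τ, m ≤ F t) : ∃ l, Tendsto g (𝓝[<] τ) (𝓝 l) := by
  have anti : ∀ (f f' : ℝ → ℝ), (∀ t ∈ Ioo 0 τ, HasDerivAt f (f' t) t) →
      (∀ t ∈ Ioo 0 τ, f' t ≤ 0) → AntitoneOn f (Ioo 0 τ) := by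
    intro f f' h1 h2
    refine antitoneOn_of_deriv_nonpos (convex_Ioo 0 τ)
      (fun t ht => (h1 t ht).continuousAt.continuousWithinAt) ?_ ?_
    · rw [interior_Ioo]
      exact fun t ht => (h1 t ht).differentiableAt.differentiableWithinAt
    · rw [interior_Ioo]
      intro t ht
      rw [(h1 t ht).deriv]
      exact h2 t ht
  have a1 := anti (fun t => F t + g t) _ (fun t ht => (hF t ht).add (hg t ht))
    (fun t ht => by linarith [(abs_le.1 (hle t ht)).2])
  have a2 := anti (fun t => F t - g t) _ (fun t ht => (hF t ht).sub (hg t ht))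
    (fun t ht => by linarith [(abs_le.1 (hle t ht)).1])
  have ha : τ / 2 ∈ Ioo 0 τ := ⟨by linarith, by linarith⟩
  have hsub : Ioo (τ / 2) τ ⊆ Ioo 0 τ := Ioo_subset_Ioo_left ha.1.le
  obtain ⟨l₁, hl₁⟩ := exists_tendsto_of_antitoneOn (a := τ / 2)
    (m := 2 * m - (F (τ / 2) - g (τ / 2))) ha.2 (a1.mono hsub)
    (fun t ht => by
      have h1 := a2 ha (hsub ht) ht.1.le
      have h2 := hm t (hsub ht)
      simp only at h1
      linarith)
  obtain ⟨l₂, hl₂⟩ := exists_tendsto_of_antitoneOn (a := τ / 2)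
    (m := 2 * m - (F (τ / 2) + g (τ / 2))) ha.2 (a2.mono hsub)
    (fun t ht => by
      have h1 := a1 ha (hsub ht) ht.1.le
      have h2 := hm t (hsub ht)
      simp only at h1
      linarith)
  refine ⟨(l₁ - l₂) / 2, ((hl₁.sub hl₂).div_const 2).congr fun t => ?_⟩
  ring

section Limit

variable {T : EReal} {h : ℝ → heightSpace S}

/-- The heights converge in finite time. -/
theorem IsSolution.exists_tendsto (hS : IsSimple S) {τ : ℝ} (hτ : 0 < τ)
    (hsol : IsSolution (velocity S) (regularHeights S) 0 τ h) :
    ∃ y, Tendsto h (𝓝[<] τ) (𝓝 y) := by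
  obtain ⟨M, hM, hbase⟩ := hsol.exists_base_le hS τ
  have hmem : ∀ t ∈ Ioo 0 τ, t ∈ timeInterval (τ : EReal) := fun t ht =>
    ⟨ht.1.le, EReal.coe_lt_coe_iff.2 ht.2⟩
  have hd : ∀ t ∈ Ioo 0 τ, HasDerivAt h (velocity S (h t)) t := fun t ht =>
    hsol.deriv t ht.1 (hmem t ht).2
  have hc := halfFacet_pos
  have hcoord : ∀ i, ∃ l, Tendsto (fun t => (h t).1 i) (𝓝[<] τ) (𝓝 l) := by
    intro i
    have hE : ∀ t ∈ Ioo 0 τ, loadForm S (velocity S (h t)) =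
        -∑ j, deformedLength S (h t).1 j * ((current S (h t).1).1 j * (current S (h t).1).1 j) := by
      intro t ht
      rw [velocity, map_neg, loadForm_apply,
        sum_current (hsol.mem t (hmem t ht)) (current S (h t).1).2]
    obtain ⟨l, hl⟩ := exists_tendsto_of_abs_deriv_le (F := fun t => loadForm S (h t))
      (g := fun t => 2 * halfFacet * (h t).1 i) (m := -∑ i, (deformedLength S 0 i + M)) hτ
      (fun t ht => (loadForm S).hasFDerivAt.comp_hasDerivAt t (hd t ht))
      (fun t ht => ((hasDerivAt_pi.1 (hasDerivAt_coe (hd t ht))) i).const_mul (2 * halfFacet))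
      (fun t ht => by
        have hlen := hsol.mem t (hmem t ht)
        obtain ⟨α, hdr⟩ := exists_isDriven_current hS hlen
        rw [hE t ht, neg_neg, abs_mul, abs_of_pos (show 0 < 2 * halfFacet by positivity)]
        change _ * |-((current S (h t).1).1 i)| ≤ _
        rw [abs_neg]
        exact hdr.abs_current_le hS hlen i)
      (fun t ht => by
        rw [loadForm_apply]
        exact le_load hM (deformedLength_zero_nonneg hS) (hsol.mem t (hmem t ht))
          (hbase t (hmem t ht) ht.2.le))
    refine ⟨l / (2 * halfFacet), (hl.div_const (2 * halfFacet)).congr fun t => ?_⟩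
    field_simp
  choose y hy using hcoord
  have hy' : Tendsto (fun t => (h t).1) (𝓝[<] τ) (𝓝 y) := tendsto_pi_nhds.2 hy
  have hymem : y ∈ heightSpace S :=
    (Submodule.closed_of_finiteDimensional (heightSpace S)).mem_of_tendsto hy'
      (Eventually.of_forall fun t => (h t).2)
  exact ⟨⟨y, hymem⟩, tendsto_subtype_rng.2 hy'⟩

theorem length_deform {i : ι} (hi : (S i).IsSegment) (v : ι → ℝ) :
    (deform S v i).length = ENNReal.ofReal (deformedLength S v i) := by
  obtain ⟨L, hL⟩ := hi
  rw [Piece.length, deform_segment hL v]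

/-- A maximal solution that ends in finite time makes a segment vanish. -/
theorem IsSolution.exists_tendsto_length (hS : IsSimple S) {τ : ℝ} (hτ : 0 < τ)
    (hsol : IsSolution (velocity S) (regularHeights S) 0 τ h)
    (hmax : ∀ y ∈ regularHeights S, ¬ Tendsto h (𝓝[<] τ) (𝓝 y)) :
    ∃ i, (S i).IsSegment ∧ Tendsto (fun t => (deform S (h t).1 i).length) (𝓝[<] τ) (𝓝 0) := by
  obtain ⟨y, hy⟩ := hsol.exists_tendsto hS hτ
  have hyr : y ∉ regularHeights S := fun hyr => hmax y hyr hy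
  simp only [regularHeights, mem_ofPred_eq, not_forall, not_lt] at hyr
  obtain ⟨i, hi, hle⟩ := hyr
  refine ⟨i, hi, ?_⟩
  simp only [length_deform hi]
  rw [← ENNReal.ofReal_of_nonpos hle]
  exact ENNReal.tendsto_ofReal
    ((((continuous_deformedLength S i).comp continuous_subtype_val).tendsto y).comp hy)

end Limit

/-! ### The curvature flow -/

theorem phiDual_normal (hS : IsSimple S) (i : ι) : phiDual (S i).normal = 1 :=
  phiDual_rot (hS.isHexDir i)

theorem isPhiRegular_of_isSimple (hS : IsSimple S) : IsPhiRegular S := by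
  obtain ⟨α, hdr⟩ := exists_isDriven_current hS (zero_mem_regularHeights hS)
  obtain ⟨a, ha⟩ := hdr.isEquilibrium hS (zero_mem _) fun X _ Y _ hXY => by
    change X + vertexShift S 0 X = Y + vertexShift S 0 Y at hXY
    rwa [vertexShift_zero, vertexShift_zero, add_zero, add_zero] at hXY
  change IsEquilibrium (deform S 0) _ _ at ha
  rw [deform_zero] at ha
  exact ⟨_, ha.isCHField_affineField hS⟩

theorem isOpen_time (T : EReal) : IsOpen {t : ℝ | 0 < t ∧ (t : EReal) < T} :=
  (isOpen_lt continuous_const continuous_id).inter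
    (isOpen_lt continuous_coe_real_ereal continuous_const)

section Flow

variable {T : EReal} {h : ℝ → heightSpace S}

theorem IsSolution.isPhiCurvatureFlow (hS : IsSimple S) (hT : 0 < T)
    (hsol : IsSolution (velocity S) (regularHeights S) 0 T h) :
    IsPhiCurvatureFlow S T fun t => deform S (h t).1 := by
  have hheight : ∀ i, (fun t => (S i).height (deform S (h t).1 i)) = fun t => (h t).1 i :=
    fun i => funext fun t => height_deform hS (h t).2 i
  have hderiv : ∀ i, ∀ t : ℝ, 0 < t → (t : EReal) < T →
      HasDerivAt (fun t => (h t).1 i) ((velocity S (h t)).1 i) t := fun i t h0 ht =>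
    hasDerivAt_pi.1 (hasDerivAt_coe (hsol.deriv t h0 ht)) i
  refine ⟨hT, hS.admissible, isPhiRegular_of_isSimple hS, ?_,
    fun t h0 ht => hsol.isNetwork_deform hS ⟨h0, ht⟩, fun t _ _ => isParallel_deform hS (h t).2,
    fun i => ?_, fun i => ?_, fun t h0 ht i => ?_⟩
  · change deform S (h 0).1 = S
    rw [hsol.init]; exact deform_zero S
  · rw [hheight]
    exact ((continuous_apply i).comp continuous_subtype_val).comp_continuousOn hsol.cont
  · rw [hheight, show (1 : WithTop ℕ∞) = 0 + 1 from rfl,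
      contDiffOn_succ_iff_deriv_of_isOpen (isOpen_time T)]
    refine ⟨fun t ht => (hderiv i t ht.1 ht.2).differentiableAt.differentiableWithinAt,
      fun h0 => by simp at h0, contDiffOn_zero.2 ?_⟩
    have hcont : ContinuousOn (fun t => (velocity S (h t)).1 i)
        {t : ℝ | 0 < t ∧ (t : EReal) < T} := by
      intro t ht
      have h1 := (contDiffAt_velocity (hsol.mem t ⟨ht.1.le, ht.2⟩)).continuousAt
      have h2 := ContinuousAt.comp (f := h) h1 (hsol.deriv t ht.1 ht.2).continuousAt
      exact (((continuous_apply i).comp continuous_subtype_val).continuousAt.comp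
        h2).continuousWithinAt
    exact hcont.congr fun t ht => (hderiv i t ht.1 ht.2).deriv
  · refine ⟨_, hasPhiCurvature_current hS (hsol.mem t ⟨h0.le, ht⟩)
      (hsol.injOn_movedVertex hS ⟨h0.le, ht⟩) (hsol.isSimple_deform hS ⟨h0.le, ht⟩) i, ?_⟩
    change HasDerivAt (fun t => (S i).height (deform S (h t).1 i)) _ t
    rw [hheight, deform_normal, phiDual_normal hS, one_mul]
    exact hderiv i t h0 ht

theorem eventually_injOn_movedVertex {v : heightSpace S}
    (hinj : Set.InjOn (movedVertex S v.1) (vertices S)) :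
    ∀ᶠ w in 𝓝 v, Set.InjOn (movedVertex S w.1) (vertices S) := by
  have : ∀ᶠ w : heightSpace S in 𝓝 v, ∀ p : vertices S × vertices S, p.1 ≠ p.2 →
      movedVertex S w.1 p.1 ≠ movedVertex S w.1 p.2 := by
    rw [eventually_all]
    intro p
    by_cases hp : p.1 = p.2
    · exact Eventually.of_forall fun w hne => absurd hp hne
    · have hc : ∀ X, Continuous fun w : heightSpace S => movedVertex S w.1 X := fun X =>
        (continuous_movedVertex S X).comp continuous_subtype_val
      have := (isOpen_ne_fun (hc p.1) (hc p.2)).mem_nhds (x := v)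
        (fun e => hp (Subtype.ext (hinj p.1.2 p.2.2 e)))
      filter_upwards [this] with w hw _
      exact hw
  filter_upwards [this] with w hw X hX Y hY hXY
  by_contra hne
  exact hw (⟨X, hX⟩, ⟨Y, hY⟩) (fun e => hne (congrArg Subtype.val e)) hXY

theorem exists_projection (S : ι → Piece) :
    ∃ g : (ι → ℝ) →L[ℝ] heightSpace S, ∀ v : heightSpace S, g v.1 = v := by
  obtain ⟨g, hg⟩ := (heightSpace S).subtype.exists_leftInverse_of_injective
    (Submodule.ker_subtype _)
  exact ⟨LinearMap.toContinuousLinearMap g, fun v => LinearMap.congr_fun hg v⟩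

theorem HasPhiCurvature.eq_current (hS : IsSimple S) {v : heightSpace S}
    (hinj : Set.InjOn (movedVertex S v.1) (vertices S)) (hv : v ∈ regularHeights S)
    (hnet : IsNetwork (deform S v.1)) {i : ι} {κ : ℝ} (h : HasPhiCurvature (deform S v.1) i κ) :
    κ = (current S v.1).1 i :=
  h.unique (hnet.nondegenerate i)
    (hasPhiCurvature_current hS hv hinj (isSimple_deform hS v.2 hinj hnet) i)

theorem mem_regularHeights_of_isNetwork {v : heightSpace S} (h : IsNetwork (deform S v.1)) :
    v ∈ regularHeights S := by
  rintro i ⟨L, hL⟩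
  exact (h.nondegenerate i).2 _ (deform_segment hL v.1)

/-- The heights of a curvature flow. -/
theorem IsPhiCurvatureFlow.exists_heights (hS : IsSimple S) {S' : ℝ → ι → Piece}
    (hflow : IsPhiCurvatureFlow S T S') : ∃ k : ℝ → heightSpace S, k 0 = 0 ∧
      ContinuousOn k (timeInterval T) ∧
      (∀ t ∈ timeInterval T, S' t = deform S (k t).1 ∧ k t ∈ regularHeights S) ∧
      ∀ t : ℝ, 0 < t → (t : EReal) < T → Set.InjOn (movedVertex S (k t).1) (vertices S) →
        HasDerivAt k (velocity S (k t)) t := by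
  obtain ⟨g, hg⟩ := exists_projection S
  have hk : ∀ t ∈ timeInterval T, (g (heights S (S' t))).1 = heights S (S' t) := fun t ht =>
    congrArg Subtype.val (hg ⟨_, (hflow.parallel t ht.1 ht.2).heights_mem hS⟩)
  have hS' : ∀ t ∈ timeInterval T, S' t = deform S (g (heights S (S' t))).1 := fun t ht => by
    rw [hk t ht]; exact (hflow.parallel t ht.1 ht.2).eq_deform hS
  have hnet : ∀ t ∈ timeInterval T, IsNetwork (deform S (g (heights S (S' t))).1) := fun t ht => by
    rw [← hS' t ht]; exact hflow.network t ht.1 ht.2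
  refine ⟨fun t => g (heights S (S' t)), ?_, ?_,
    fun t ht => ⟨hS' t ht, mem_regularHeights_of_isNetwork (hnet t ht)⟩, fun t h0 ht hinj => ?_⟩
  · have : heights S S = 0 := by
      funext i
      simp [heights, Piece.height]
    change g (heights S (S' 0)) = 0
    rw [hflow.initial, this, map_zero]
  · exact g.continuous.comp_continuousOn (continuousOn_pi.2 hflow.continuousOn)
  · have hd : HasDerivAt (fun s => heights S (S' s)) (velocity S (g (heights S (S' t)))).1 t := by
      refine hasDerivAt_pi.2 fun i => ?_
      obtain ⟨κ, hκ, hder⟩ := hflow.evolution t h0 ht i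
      have htT : t ∈ timeInterval T := ⟨h0.le, ht⟩
      rw [hS' t htT] at hκ
      have e := hκ.eq_current hS hinj (mem_regularHeights_of_isNetwork (hnet t htT)) (hnet t htT)
      have e2 : phiDual (S' t i).normal = 1 := by
        rw [hS' t htT, deform_normal, phiDual_normal hS]
      rw [e2, one_mul, e] at hder
      exact hder
    have := g.hasFDerivAt.comp_hasDerivAt t hd
    rwa [hg] at this

theorem IsSolution.eq_heights (hS : IsSimple S) {T' : EReal}
    (hsol : IsSolution (velocity S) (regularHeights S) 0 T h) {k : ℝ → heightSpace S}
    (k0 : k 0 = 0) (hkc : ContinuousOn k (timeInterval T'))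
    (hkd : ∀ t : ℝ, 0 < t → (t : EReal) < T' → Set.InjOn (movedVertex S (k t).1) (vertices S) →
        HasDerivAt k (velocity S (k t)) t) :
    ∀ t ∈ timeInterval (min T T'), h t = k t := by
  have s1 : timeInterval (min T T') ⊆ timeInterval T := fun t ht =>
    ⟨ht.1, ht.2.trans_le (min_le_left _ _)⟩
  have s2 : timeInterval (min T T') ⊆ timeInterval T' := fun t ht =>
    ⟨ht.1, ht.2.trans_le (min_le_right _ _)⟩
  refine eq_of_eventually_right (hsol.cont.mono s1) (hkc.mono s2) (hsol.init.trans k0.symm) ?_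
  intro x hx hxx
  have c2 := continuousWithinAt_Ici_of_timeInterval hkc (s2 hx)
  refine ode_eventually_eq_right (contDiffAt_velocity (hsol.mem x (s1 hx))) hxx
    (continuousWithinAt_Ici_of_timeInterval hsol.cont (s1 hx)) c2
    (hsol.eventually_hasDerivAt (s1 hx)) ?_
  have hinj := hsol.injOn_movedVertex hS (s1 hx)
  rw [hxx] at hinj
  filter_upwards [(c2.mono Ioi_subset_Ici_self).eventually (eventually_injOn_movedVertex hinj),
    timeInterval_mem_nhdsGT (s2 hx), self_mem_nhdsWithin] with t ht htT hxt
  exact hkd t (hx.1.trans_lt hxt) htT.2 ht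

end Flow

end HexNetwork

end

theorem theorem3 {ι : Type*} [Fintype ι] (S₀ : ι → Piece) (hS₀ : IsSimple S₀) :
    ∃ (Tdag : EReal) (S : ℝ → ι → Piece),
      0 < Tdag ∧
      IsPhiCurvatureFlow S₀ Tdag S ∧
      (∀ t : ℝ, 0 ≤ t → (t : EReal) < Tdag → IsSimple (S t)) ∧
      (∀ (T' : EReal) (S' : ℝ → ι → Piece), IsPhiCurvatureFlow S₀ T' S' →
        T' ≤ Tdag ∧ ∀ t : ℝ, 0 ≤ t → (t : EReal) < T' → S' t = S t) ∧
      (∀ T : ℝ, Tdag = (T : EReal) →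
        ∃ i, (S₀ i).IsSegment ∧
          Tendsto (fun t => (S t i).length) (𝓝[<] T) (𝓝 0)) := by
  obtain ⟨T, h, hT, hsol, hmax⟩ := IsSolution.exists_maximal (isOpen_regularHeights S₀)
    (fun v hv => contDiffAt_velocity hv) (zero_mem_regularHeights hS₀)
  refine ⟨T, fun t => deform S₀ (h t).1, hT, hsol.isPhiCurvatureFlow hS₀ hT,
    fun t h0 ht => hsol.isSimple_deform hS₀ ⟨h0, ht⟩, fun T' S' hflow => ?_, fun τ hτ => ?_⟩
  · obtain ⟨k, k0, hkc, hk, hkd⟩ := hflow.exists_heights hS₀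
    have heq := hsol.eq_heights hS₀ k0 hkc hkd
    have hle : T' ≤ T := by
      by_contra! hlt
      obtain ⟨τ, rfl⟩ : ∃ τ : ℝ, T = τ :=
        ⟨T.toReal, (EReal.coe_toReal (ne_top_of_lt hlt) (ne_bot_of_gt hT)).symm⟩
      have h0 : 0 < τ := EReal.coe_pos.1 hT
      refine hmax τ rfl (k τ) (hk τ ⟨h0.le, hlt⟩).2 ?_
      have hc := (continuousAt_of_timeInterval hkc h0 hlt).tendsto
      refine (hc.mono_left nhdsWithin_le_nhds).congr' ?_
      filter_upwards [Ioo_mem_nhdsLT h0] with t ht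
      refine (heq t ⟨ht.1.le, ?_⟩).symm
      rw [min_eq_left hlt.le]
      exact EReal.coe_lt_coe_iff.2 ht.2
    refine ⟨hle, fun t h0 ht => ?_⟩
    change S' t = deform S₀ (h t).1
    rw [heq t ⟨h0, by rwa [min_eq_right hle]⟩]
    exact (hk t ⟨h0, ht⟩).1
  · subst hτ
    exact hsol.exists_tendsto_length hS₀ (EReal.coe_pos.1 hT) (hmax τ rfl)
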